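/- Let $0<\beta<1/2$ and $0\le\theta\le 1$. For $\phi\in L^1(0,1)$ and $x\in[0,1]$ put $${}_0^lI_x^{\beta}\phi=\frac1{\Gamma(\beta)}\int_0^x\frac{\phi(s)}{(x-s)^{1-\beta}}\,ds,\qquad {}_x^rI_1^{\beta}\phi=\frac1{\Gamma(\beta)}\int_x^1\frac{\phi(s)}{(s-x)^{1-\beta}}\,ds,$$ $$I^\beta_\theta\phi(x)=\theta\;{}_0^lI_x^{\beta}\phi+(1-\theta)\;{}_x^rI_1^{\beta}\phi .$$ All functions are real valued. Let $H^1(0,1)$ be the space of functions in $L^2(0,1)$ with weak derivative in $L^2(0,1)$, with norm $\|g\|_{H^1(0,1)}=(\|g\|_{L^2(0,1)}^2+\|g'\|_{L^2(0,1)}^2)^{1/2}$; $g(0)$ and $g(1)$ are the boundary values of the continuous representative of $g$. Let $H^1_0(0,1)$ be the closure of $C_0^\infty(0,1)$ in $H^1(0,1)$. Let $H^{1-\beta}_0(0,1)$ be the completion of $C_0^\infty(0,1)$ (realized as functions on $(0,1)$) in the norm $$\|\phi\|_{H^{1-\beta}(0,1)}=\Big(\|\tilde\phi\|^2_{L^2(\mathbb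 R)}+\big\||\omega|^{1-\beta}\mathcal F\tilde\phi\big\|_{L^2(\mathbb R)}^2\Big)^{1/2},$$ where $\tilde\phi$ is the extension of $\phi$ by zero to $\mathbb R$ and $\mathcal F$ is the Fourier transform (unitary on $L^2(\mathbb R)$, in the angular frequency $\omega$). **Theorem 4.3.** (i) For each $g\in H^1(0,1)$ the integral equation $$I^\beta_\theta\phi(x)+\big(g(0)-(1-\theta)\,{}_0^rI_1^{\beta}\phi\big)(1-x)+\big(g(1)-\theta\,{}_0^lI_1^{\beta}\phi\big)\,x=g(x)\quad\text{for a.e. }x\in(0,1)\qquad(*)$$ has a unique solution $\phi\in H^{1-\beta}_0(0,1)$. (ii) Conversely, for each $\phi\in H_0^{1-\beta}(0,1)$ the function $$I^\beta_\theta\phi(x)-(1-\theta)\big({}_0^rI_1^{\beta}\phi\big)(1-x)-\theta\big({}_0^lI_1^{\beta}\phi\big)\,x$$ belongs to $H^1_0(0,1)$. (iii) There are constants $C_3,C_4>0$, depending only on $\beta$ and $\theta$, such that $$C_3\|\phi\|_{H^{1-\beta}(0,1)}\le\|g\|_{H^1(0,1)}\le C_4\|\phi\|_{H^{1-\beta}(0,1)}$$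 for all $g\in H^1_0(0,1)$, where $\phi\in H^{1-\beta}_0(0,1)$ is the solution of $(*)$. -/

import Mathlib

open MeasureTheory Set

namespace FracInt

noncomputable section

/-! Elements of `L²(0,1)` are given as functions `ℝ → ℝ`, of which only the values on `(0,1)`, up to
null sets, matter. -/

/-- Lebesgue measure on `(0,1)`. -/
abbrev vol01 : Measure ℝ := volume.restrict (Ioo 0 1)

/-- `C₀^∞(0,1)`: smooth functions with compact support contained in `(0,1)`. -/
def IsTest (w : ℝ → ℝ) : Prop :=
  ContDiff ℝ (⊤ : ℕ∞) w ∧ HasCompactSupport w ∧ tsupport w ⊆ Ioo 0 1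

/-- `d ∈ L²(0,1)` is a weak derivative of `g` on `(0,1)`. -/
def HasWeakDeriv (g d : ℝ → ℝ) : Prop :=
  MemLp d 2 vol01 ∧ ∀ η : ℝ → ℝ, IsTest η →
    ∫ x, g x * deriv η x ∂vol01 = -∫ x, d x * η x ∂vol01

/-- `g ∈ H¹(0,1)`: `g` and its weak derivative are in `L²(0,1)`. -/
def MemH1 (g : ℝ → ℝ) : Prop :=
  MemLp g 2 vol01 ∧ ∃ d, HasWeakDeriv g d

open Classical in
/-- The weak derivative `Dg` of `g ∈ H¹(0,1)` (unique up to null sets). -/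
def weakDeriv (g : ℝ → ℝ) : ℝ → ℝ :=
  if h : ∃ d, HasWeakDeriv g d then h.choose else 0

/-- `‖g‖_{H¹(0,1)} = (‖g‖² + ‖Dg‖²)^{1/2}`, for `g ∈ H¹(0,1)`. -/
def h1Norm (g : ℝ → ℝ) : ℝ :=
  Real.sqrt ((∫ x, g x ^ 2 ∂vol01) + ∫ x, weakDeriv g x ^ 2 ∂vol01)

/-- `H¹₀(0,1)`: the closure of `C₀^∞(0,1)` in `H¹(0,1)`. -/
def MemH10 (g : ℝ → ℝ) : Prop :=
  MemH1 g ∧ ∀ ε > 0, ∃ w, IsTest w ∧ h1Norm (fun x ↦ g x - w x) < ε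

open Classical in
/-- The continuous representative on `[0,1]` of `g ∈ H¹(0,1)` (unique on `[0,1]`); the boundary
values `g(0)`, `g(1)` are its values. -/
def contRep (g : ℝ → ℝ) : ℝ → ℝ :=
  if h : ∃ G : ℝ → ℝ, ContinuousOn G (Icc 0 1) ∧ G =ᵐ[vol01] g then h.choose else 0

/-- Extension by zero from `(0,1)` to `ℝ`. -/
def zeroExt (φ : ℝ → ℝ) : ℝ → ℝ := (Ioo (0 : ℝ) 1).indicator φ

open scoped FourierTransform in
/-- `|ω|^μ |ŵ(ω)|`, where `w` is the zero extension of `φ ∈ L²(0,1)` (so `w ∈ L¹(ℝ) ∩ L²(ℝ)`).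
Mathlib's Fourier transform is written in the frequency variable `ξ` with `ω = 2πξ`. -/
def fourierWeight (μ : ℝ) (φ : ℝ → ℝ) (ξ : ℝ) : ℝ :=
  |2 * Real.pi * ξ| ^ μ * ‖𝓕 (fun x ↦ (zeroExt φ x : ℂ)) ξ‖

/-- `‖φ‖_{H^μ} = (‖w‖²_{L²(ℝ)} + ‖|ω|^μ ŵ‖²_{L²(ℝ)})^{1/2}`, where `w` is the zero extension of `φ`. -/
def hNorm (μ : ℝ) (φ : ℝ → ℝ) : ℝ :=
  Real.sqrt ((∫ x, φ x ^ 2 ∂vol01) + ∫ ξ, fourierWeight μ φ ξ ^ 2)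

/-- `H^μ₀(0,1)`, for `μ > 0`: the functions `φ` on `(0,1)` of finite `H^μ(ℝ)` norm (after extension
by zero) which are limits of functions in `C₀^∞(0,1)` in that norm. -/
def MemH0 (μ : ℝ) (φ : ℝ → ℝ) : Prop :=
  MemLp φ 2 vol01 ∧ MemLp (fourierWeight μ φ) 2 volume ∧
    ∀ ε > 0, ∃ w, IsTest w ∧ hNorm μ (fun x ↦ φ x - w x) < ε

/-- The left fractional integral of order `σ` on `(0,1)`, at `x ∈ [0,1]`. -/
def leftInt (σ : ℝ) (w : ℝ → ℝ) (x : ℝ) : ℝ :=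
  1 / Real.Gamma σ * ∫ s in Ioo 0 x, w s / (x - s) ^ (1 - σ)

/-- The right fractional integral of order `σ` on `(0,1)`, at `x ∈ [0,1]`. -/
def rightInt (σ : ℝ) (w : ℝ → ℝ) (x : ℝ) : ℝ :=
  1 / Real.Gamma σ * ∫ s in Ioo x 1, w s / (s - x) ^ (1 - σ)

/-- The two-sided fractional integral operator `I^β_θ`. -/
def twoSidedInt (β θ : ℝ) (w : ℝ → ℝ) (x : ℝ) : ℝ :=
  θ * leftInt β w x + (1 - θ) * rightInt β w x

/-- `φ` solves the integral equation with right-hand side `g ∈ H¹(0,1)`. -/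
def Solves (β θ : ℝ) (g φ : ℝ → ℝ) : Prop :=
  (fun x ↦ twoSidedInt β θ φ x
      + (contRep g 0 - (1 - θ) * rightInt β φ 0) * (1 - x)
      + (contRep g 1 - θ * leftInt β φ 1) * x) =ᵐ[vol01] g

end

end FracInt

open FracInt

open scoped RealInnerProductSpace Topology FourierTransform ContDiff
open Filter

/-! For a test function `w`, differentiating the two-sided fractional integral gives `A_θ w = θ L w
+ (1 - θ) R w`, where `L w` and `R w` are the convolutions of `w'` with the kernel `t_+^{β-1}/Γ(β)`
and with its reflection. The linear correction in the integral equation changes the derivative only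
by a constant and fixes the boundary values. So everything reduces to one claim: `A_θ` extends to an
isomorphism from `H^{1-β}₀(0,1)` onto `L²(0,1)` modulo constants.

Lower bound. The symbols of the two kernels are `(iω)^{-β}` and its conjugate. Hence `L` and `R` are
bounded by the norm of `H^{1-β}`, and `⟨L w, R w⟩` is the integral of `Re (iω)^{-2β} |ω|² |ŵ|²`,
which is at least `cos(πβ)` times the squared seminorm (`IsTest.left_right_coercive`); here `β <
1/2` is essential. Pairing `A_θ w` with `L w + R w` bounds `A_θ` from below, uniformly in `θ`
(`le_norm_mixed`).

Codimension at most one. If `v` is orthogonal to the constants and to the range of `A_θ`, then `v`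
is a limit of derivatives `w_n'`. The energy inequality `c ‖w‖² ≤ ⟨A_θ w, w'⟩` forces `w_n → 0`, so
`v = 0` (`eq_zero_of_orthogonal`, `dual_uniqueness`).

Codimension at least one. For `θ = 1` the function `(1 - x)^{-β}` annihilates the range. The uniform
lower bound makes density of the range stable under steps in `θ` of a fixed size, so density at any
`θ` would propagate to `θ = 1` (`not_denseRange_mixed`).

Together these make the orthogonal complement of the range a line that is not perpendicular to `1`,
which yields both the surjectivity and the lower bound modulo constants (`bounded_below_mod_line`).
The estimates pass from test functions to the completion by limits; the embedding of `H^{1-β}₀` into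
bounded functions, valid because `1 - β > 1/2`, allows the fractional integrals themselves to pass
to the limit. -/

namespace FracInt

/-! ### Abstract Hilbert space argument for a segment of operators -/

section Hilbert

variable {V H : Type*} [AddCommGroup V] [Module ℝ V] [NormedAddCommGroup H]
  [InnerProductSpace ℝ H]

/-- The convex combination `θ L + (1 - θ) R` of two linear maps. -/
noncomputable def mixed (L R : V →ₗ[ℝ] H) (θ : ℝ) : V →ₗ[ℝ] H := θ • L + (1 - θ) • R

theorem mixed_apply (L R : V →ₗ[ℝ] H) (θ : ℝ) (w : V) :
    mixed L R θ w = θ • L w + (1 - θ) • R w := rfl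

theorem norm_mixed_le {L R : V →ₗ[ℝ] H} {q : V → ℝ}
    (hL : ∀ w, ‖L w‖ ^ 2 ≤ q w) (hR : ∀ w, ‖R w‖ ^ 2 ≤ q w)
    {θ : ℝ} (h0 : 0 ≤ θ) (h1 : θ ≤ 1) (w : V) : ‖mixed L R θ w‖ ≤ √(q w) := by
  have hl := Real.le_sqrt_of_sq_le (hL w)
  have hr := Real.le_sqrt_of_sq_le (hR w)
  calc ‖mixed L R θ w‖ ≤ ‖θ • L w‖ + ‖(1 - θ) • R w‖ := norm_add_le _ _
    _ = θ * ‖L w‖ + (1 - θ) * ‖R w‖ := by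
        rw [norm_smul, norm_smul, Real.norm_of_nonneg h0, Real.norm_of_nonneg (by linarith)]
    _ ≤ θ * √(q w) + (1 - θ) * √(q w) := by
        gcongr
    _ = √(q w) := by ring

/-- Pair `A_θ w` with `L w + R w`: the two squares have nonnegative coefficients and only the
coercive cross term is kept, while the test vector has norm at most `2 √q`. The constant does not
depend on `θ`, which the continuation in `θ` requires. -/
theorem le_norm_mixed {L R : V →ₗ[ℝ] H} {q : V → ℝ} {γ : ℝ}
    (hL : ∀ w, ‖L w‖ ^ 2 ≤ q w) (hR : ∀ w, ‖R w‖ ^ 2 ≤ q w)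
    (hLR : ∀ w, γ * q w ≤ ⟪L w, R w⟫)
    {θ : ℝ} (h0 : 0 ≤ θ) (h1 : θ ≤ 1) (w : V) : γ / 2 * √(q w) ≤ ‖mixed L R θ w‖ := by
  have hq : 0 ≤ q w := (sq_nonneg _).trans (hL w)
  have hl := Real.le_sqrt_of_sq_le (hL w)
  have hr := Real.le_sqrt_of_sq_le (hR w)
  have hs : √(q w) * √(q w) = q w := Real.mul_self_sqrt hq
  have key : γ * q w ≤ ‖mixed L R θ w‖ * (2 * √(q w)) := by
    calc γ * q w ≤ ⟪L w, R w⟫ := hLR w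
      _ ≤ θ * ‖L w‖ ^ 2 + (1 - θ) * ‖R w‖ ^ 2 + ⟪L w, R w⟫ := by
          have := mul_nonneg h0 (sq_nonneg ‖L w‖)
          have := mul_nonneg (sub_nonneg.2 h1) (sq_nonneg ‖R w‖)
          linarith
      _ = ⟪mixed L R θ w, L w + R w⟫ := by
          rw [mixed_apply, inner_add_left, inner_add_right, inner_add_right, inner_smul_left,
            inner_smul_left, inner_smul_left, inner_smul_left, real_inner_self_eq_norm_sq,
            real_inner_self_eq_norm_sq, real_inner_comm (L w) (R w)]
          simp only [conj_trivial]
          ring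
      _ ≤ ‖mixed L R θ w‖ * ‖L w + R w‖ := real_inner_le_norm _ _
      _ ≤ ‖mixed L R θ w‖ * (2 * √(q w)) := by
          gcongr
          linarith [norm_add_le (L w) (R w)]
  rcases hq.eq_or_lt with h | h
  · rw [← h]; simp
  · have hpos : 0 < √(q w) := Real.sqrt_pos.2 h
    nlinarith [key.trans' (by rw [hs] : γ * (√(q w) * √(q w)) ≤ γ * q w)]

theorem dist_mixed_le {L R : V →ₗ[ℝ] H} {q : V → ℝ}
    (hL : ∀ w, ‖L w‖ ^ 2 ≤ q w) (hR : ∀ w, ‖R w‖ ^ 2 ≤ q w) (θ θ' : ℝ) (w : V) :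
    ‖mixed L R θ w - mixed L R θ' w‖ ≤ 2 * |θ - θ'| * √(q w) := by
  have hl := Real.le_sqrt_of_sq_le (hL w)
  have hr := Real.le_sqrt_of_sq_le (hR w)
  have : mixed L R θ w - mixed L R θ' w = (θ - θ') • (L w - R w) := by
    simp only [mixed_apply]; module
  rw [this, norm_smul, Real.norm_eq_abs]
  nlinarith [norm_sub_le (L w) (R w), abs_nonneg (θ - θ')]

/-- Density of the range is stable under small changes of the parameter. -/
theorem denseRange_mixed_of_near [CompleteSpace H] {L R : V →ₗ[ℝ] H} {q : V → ℝ} {γ : ℝ}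
    (hL : ∀ w, ‖L w‖ ^ 2 ≤ q w) (hR : ∀ w, ‖R w‖ ^ 2 ≤ q w)
    (hLR : ∀ w, γ * q w ≤ ⟪L w, R w⟫)
    {θ θ' : ℝ} (h0 : 0 ≤ θ) (h1 : θ ≤ 1) (hd : |θ' - θ| ≤ γ / 16)
    (hθ : DenseRange (mixed L R θ)) : DenseRange (mixed L R θ') := by
  have hdense : (LinearMap.range (mixed L R θ')).topologicalClosure = ⊤ := by
    -- A nonzero `f` orthogonal to the range at `θ'` has distance at least `‖f‖` from it.
    -- Approximating `f` within `‖f‖/4` by the range at `θ` and then changing the parameter costs at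
    -- most `‖f‖/4 + 5‖f‖/16 < ‖f‖`, a contradiction.
    rw [Submodule.topologicalClosure_eq_top_iff, Submodule.eq_bot_iff]
    intro f hf
    by_contra hne
    have hfp : 0 < ‖f‖ := norm_pos_iff.2 hne
    obtain ⟨w, hw⟩ := hθ.exists_dist_lt f (ε := ‖f‖ / 4) (by positivity)
    rw [dist_eq_norm] at hw
    have horth : ⟪mixed L R θ' w, f⟫ = 0 := hf _ ⟨w, rfl⟩
    have h2 := dist_mixed_le hL hR θ' θ w
    have h3 := le_norm_mixed hL hR hLR h0 h1 w
    have h4 : ‖mixed L R θ w‖ ≤ 5 / 4 * ‖f‖ := by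
      have := norm_sub_norm_le (mixed L R θ w) f
      rw [norm_sub_rev] at this; linarith
    have h5 : ‖mixed L R θ' w - mixed L R θ w‖ ≤ 5 / 16 * ‖f‖ := by
      have hs := Real.sqrt_nonneg (q w)
      calc _ ≤ 2 * |θ' - θ| * √(q w) := h2
        _ ≤ 2 * (γ / 16) * √(q w) := by gcongr
        _ = (γ / 2 * √(q w)) / 4 := by ring
        _ ≤ 5 / 16 * ‖f‖ := by linarith
    have h6 : ‖f - mixed L R θ' w‖ < ‖f‖ := by
      calc ‖f - mixed L R θ' w‖
          = ‖(f - mixed L R θ w) - (mixed L R θ' w - mixed L R θ w)‖ := by congr 1; abel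
        _ ≤ ‖f - mixed L R θ w‖ + ‖mixed L R θ' w - mixed L R θ w‖ := norm_sub_le _ _
        _ < ‖f‖ := by linarith
    have h7 : ‖f‖ ^ 2 ≤ ‖f - mixed L R θ' w‖ * ‖f‖ := by
      calc ‖f‖ ^ 2 = ⟪f - mixed L R θ' w, f⟫ := by
            rw [inner_sub_left, horth, real_inner_self_eq_norm_sq, sub_zero]
        _ ≤ _ := real_inner_le_norm _ _
    nlinarith
  have := Submodule.dense_iff_topologicalClosure_eq_top.2 hdense
  rwa [LinearMap.coe_range] at this

/-- Continuation towards `θ = 1`: a dense range would stay dense along steps of length `γ/16` and so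
be dense at `θ = 1`, where the operator is `L` and `v` is orthogonal to its range. -/
theorem not_denseRange_mixed [CompleteSpace H] {L R : V →ₗ[ℝ] H} {q : V → ℝ} {γ : ℝ} (hγ : 0 < γ)
    (hL : ∀ w, ‖L w‖ ^ 2 ≤ q w) (hR : ∀ w, ‖R w‖ ^ 2 ≤ q w)
    (hLR : ∀ w, γ * q w ≤ ⟪L w, R w⟫)
    {v : H} (hv : v ≠ 0) (hvL : ∀ w, ⟪v, L w⟫ = 0)
    {θ : ℝ} (h0 : 0 ≤ θ) (h1 : θ ≤ 1) : ¬ DenseRange (mixed L R θ) := by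
  intro hθ
  -- Induction on the number of steps of length `γ/16` needed to reach `1`; the last step is cut off
  -- by the minimum.
  have step : ∀ n : ℕ, ∀ θ : ℝ, 0 ≤ θ → θ ≤ 1 → 1 - θ ≤ n * (γ / 16) →
      ¬ DenseRange (mixed L R θ) := by
    intro n
    induction n with
    | zero =>
      intro θ h0 h1 hn hd
      have hθ1 : θ = 1 := by
        have : 1 - θ ≤ 0 := by simpa using hn
        linarith
      subst hθ1
      apply hv
      refine hd.induction_on (p := fun x ↦ ⟪v, x⟫ = 0) v
        (isClosed_eq (by fun_prop) continuous_const) (fun w ↦ ?_) |> inner_self_eq_zero.1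
      simp [mixed_apply, hvL]
    | succ n ih =>
      intro θ h0 h1 hn hd
      refine ih (min 1 (θ + γ / 16)) (le_min zero_le_one (by linarith)) (min_le_left _ _) ?_
        (denseRange_mixed_of_near hL hR hLR h0 h1 ?_ hd)
      · rcases min_cases 1 (θ + γ / 16) with h | h
        · rw [h.1, sub_self]; positivity
        · rw [h.1]; push_cast at hn; linarith
      · rw [abs_of_nonneg (by
          rw [sub_nonneg]; exact le_min h1 (by linarith))]
        linarith [min_le_right 1 (θ + γ / 16)]
  obtain ⟨n, hn⟩ := exists_nat_ge ((1 - θ) / (γ / 16))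
  exact step n θ h0 h1 (by rwa [div_le_iff₀ (by positivity)] at hn) hθ

/-- Uniqueness for the adjoint problem, by the energy inequality. -/
theorem eq_zero_of_orthogonal {A D J : V →ₗ[ℝ] H} {C c : ℝ} (hc : 0 < c) {e : H}
    (hA : ∀ w, ‖A w‖ ≤ C * ‖D w‖) (hE : ∀ w, c * ‖J w‖ ^ 2 ≤ ⟪A w, D w⟫)
    (hDJ : ∀ w η, ⟪D w, J η⟫ = -⟪J w, D η⟫)
    (hJ : ∀ v : H, (∀ η, ⟪v, J η⟫ = 0) → v = 0)
    (hD : ∀ v : H, ⟪v, e⟫ = 0 → v ∈ closure (range D))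
    {v : H} (hv : ⟪v, e⟫ = 0) (hvA : ∀ w, ⟪v, A w⟫ = 0) : v = 0 := by
  obtain ⟨x, hx, hlim⟩ := mem_closure_iff_seq_limit.1 (hD v hv)
  choose w hw using hx
  have hlim' : Filter.Tendsto (fun n ↦ D (w n)) Filter.atTop (𝓝 v) := by simpa [hw] using hlim
  have hsub : Filter.Tendsto (fun n ↦ ‖D (w n) - v‖) Filter.atTop (𝓝 0) := by
    simpa using (hlim'.sub_const v).norm
  -- Since `v` is orthogonal to the range of `A`, the energy equals `⟨A w_n, D w_n - v⟩`. It tends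
  -- to zero because `A w_n` is bounded by the convergent `D w_n`.
  have hJ0 : Filter.Tendsto (fun n ↦ c * ‖J (w n)‖ ^ 2) Filter.atTop (𝓝 0) := by
    have hb : Filter.Tendsto (fun n ↦ C * ‖D (w n)‖ * ‖D (w n) - v‖) Filter.atTop (𝓝 0) := by
      simpa using (hlim'.norm.const_mul C).mul hsub
    refine squeeze_zero (fun n ↦ by positivity) (fun n ↦ ?_) hb
    calc c * ‖J (w n)‖ ^ 2 ≤ ⟪A (w n), D (w n)⟫ := hE _
      _ = ⟪A (w n), D (w n) - v⟫ := by
          rw [inner_sub_right, real_inner_comm v, hvA, sub_zero]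
      _ ≤ ‖A (w n)‖ * ‖D (w n) - v‖ := real_inner_le_norm _ _
      _ ≤ _ := by gcongr; exact hA _
  have hJ1 : Filter.Tendsto (fun n ↦ J (w n)) Filter.atTop (𝓝 0) := by
    rw [tendsto_zero_iff_norm_tendsto_zero]
    have := (hJ0.const_mul c⁻¹).sqrt
    simpa [inv_mul_cancel_left₀ hc.ne'] using this
  -- Thus `v` is the weak derivative of the limit of `J w_n`, which is zero.
  refine hJ v fun η ↦ ?_
  have t1 : Filter.Tendsto (fun n ↦ ⟪D (w n), J η⟫) Filter.atTop (𝓝 ⟪v, J η⟫) :=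
    hlim'.inner tendsto_const_nhds
  have t2 : Filter.Tendsto (fun n ↦ ⟪D (w n), J η⟫) Filter.atTop (𝓝 0) := by
    simp_rw [hDJ]
    simpa using (hJ1.inner (𝕜 := ℝ) (tendsto_const_nhds (x := D η))).neg
  exact tendsto_nhds_unique t1 t2

/-- A linear map bounded below, whose range is not dense but becomes dense after adding the line
through `e`, stays bounded below modulo `e`, and its range closure complements that line. -/
theorem bounded_below_mod_line [CompleteSpace H] {A : V →ₗ[ℝ] H} {q : V → ℝ} {γ : ℝ} (hγ : 0 < γ)
    {e : H} (he : ‖e‖ = 1) (hA : ∀ w, γ * √(q w) ≤ ‖A w‖) (hnd : ¬ DenseRange A)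
    (hdual : ∀ v : H, ⟪v, e⟫ = 0 → (∀ w, ⟪v, A w⟫ = 0) → v = 0) :
    (∃ κ : ℝ, 0 < κ ∧ ∀ (w : V) (c : ℝ), κ * √(q w) ≤ ‖A w - c • e‖) ∧
      ∀ d : H, ∃ c : ℝ, d - c • e ∈ closure (range A) := by
  set K : Submodule ℝ H := (LinearMap.range A).topologicalClosure with hK
  have hKc : (K : Set H) = closure (range A) := by
    rw [hK, Submodule.topologicalClosure_coe, LinearMap.coe_range]
  have : CompleteSpace K := (Submodule.isClosed_topologicalClosure _).completeSpace_coe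
  have hKtop : K ≠ ⊤ := by
    intro h
    apply hnd
    intro x
    rw [← hKc, h]; trivial
  have hmem : ∀ w, A w ∈ K := fun w ↦ Submodule.le_topologicalClosure _ ⟨w, rfl⟩
  -- The failure of density supplies `z ≠ 0` orthogonal to the range; uniqueness for the dual
  -- problem then forces `⟨z, e⟫ ≠ 0`.
  obtain ⟨z, hz, hz0⟩ := (Submodule.ne_bot_iff Kᗮ).1
    (fun h ↦ hKtop ((Submodule.orthogonal_eq_bot_iff).1 h))
  have hzA : ∀ w, ⟪z, A w⟫ = 0 := fun w ↦ by
    rw [real_inner_comm]; exact hz _ (hmem w)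
  have hze : ⟪z, e⟫ ≠ 0 := fun h ↦ hz0 (hdual z h hzA)
  have hzn : 0 < ‖z‖ := norm_pos_iff.2 hz0
  have hab : 0 < |⟪z, e⟫| := abs_pos.2 hze
  constructor
  -- Pairing with `z` removes `A w`, so `|c|` is controlled by the distance from `A w` to `c e`; the
  -- triangle inequality then recovers `‖A w‖`.
  · refine ⟨γ / (1 + ‖z‖ / |⟪z, e⟫|), by positivity, fun w c ↦ ?_⟩
    have h1 : |c| * |⟪z, e⟫| ≤ ‖z‖ * ‖A w - c • e‖ := by
      calc |c| * |⟪z, e⟫| = |⟪z, A w - c • e⟫| := by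
            rw [inner_sub_right, hzA, inner_smul_right, zero_sub, abs_neg, abs_mul]
        _ ≤ _ := abs_real_inner_le_norm _ _
    have h2 : ‖A w‖ ≤ ‖A w - c • e‖ + |c| := by
      calc ‖A w‖ = ‖(A w - c • e) + c • e‖ := by simp
        _ ≤ ‖A w - c • e‖ + ‖c • e‖ := norm_add_le _ _
        _ = _ := by rw [norm_smul, he, mul_one, Real.norm_eq_abs]
    rw [div_mul_eq_mul_div, div_le_iff₀ (by positivity)]
    have h3 : |c| ≤ ‖z‖ / |⟪z, e⟫| * ‖A w - c • e‖ := by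
      rw [div_mul_eq_mul_div, le_div_iff₀ hab]; exact h1
    nlinarith [hA w]
  · intro d
    refine ⟨⟪z, d⟫ / ⟪z, e⟫, ?_⟩
    set y := d - (⟪z, d⟫ / ⟪z, e⟫) • e with hy
    rw [← hKc]
    have hzy : ⟪z, y⟫ = 0 := by
      rw [hy, inner_sub_right, inner_smul_right, div_mul_cancel₀ _ hze, sub_self]
    have hperp : y ∈ Kᗮᗮ := by
      intro f hf
      have hfA : ∀ w, ⟪f, A w⟫ = 0 := fun w ↦ by
        rw [real_inner_comm]; exact hf _ (hmem w)
      -- The corrected vector is orthogonal both to `e` and to the range, hence zero: the orthogonal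
      -- complement of the range is exactly the line through `z`.
      have : f - (⟪f, e⟫ / ⟪z, e⟫) • z = 0 := by
        refine hdual _ ?_ fun w ↦ ?_
        · rw [inner_sub_left, inner_smul_left]
          simp [div_mul_cancel₀ _ hze]
        · rw [inner_sub_left, inner_smul_left, hfA, hzA]; simp
      rw [sub_eq_zero.1 this, inner_smul_left, hzy, mul_zero]
    rwa [Submodule.orthogonal_orthogonal] at hperp

end Hilbert

/-! ### Test functions -/

theorem IsTest.add {u w : ℝ → ℝ} (hu : IsTest u) (hw : IsTest w) : IsTest (u + w) :=
  ⟨hu.1.add hw.1, hu.2.1.add hw.2.1,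
    (tsupport_add u w).trans (union_subset hu.2.2 hw.2.2)⟩

theorem IsTest.smul (c : ℝ) {w : ℝ → ℝ} (hw : IsTest w) : IsTest (c • w) :=
  ⟨hw.1.const_smul c, hw.2.1.mono (by
      intro x; simp only [Function.mem_support, Pi.smul_apply, smul_eq_mul]; exact right_ne_zero_of_mul),
    (closure_mono (by
      intro x; simp only [Function.mem_support, Pi.smul_apply, smul_eq_mul]
      exact right_ne_zero_of_mul)).trans hw.2.2⟩

theorem isTest_zero : IsTest 0 := by
  refine ⟨contDiff_const, HasCompactSupport.zero, ?_⟩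
  simp [tsupport]

/-- The space `C₀^∞(0,1)`. -/
def testSpace : Submodule ℝ (ℝ → ℝ) where
  carrier := {w | IsTest w}
  add_mem' := IsTest.add
  zero_mem' := isTest_zero
  smul_mem' c _ := IsTest.smul c

theorem IsTest.sub {u w : ℝ → ℝ} (hu : IsTest u) (hw : IsTest w) : IsTest (u - w) :=
  testSpace.sub_mem hu hw

theorem IsTest.deriv {w : ℝ → ℝ} (hw : IsTest w) : IsTest (deriv w) := by
  refine ⟨?_, hw.2.1.deriv, (tsupport_deriv_subset).trans hw.2.2⟩
  have := hw.1
  exact (contDiff_infty_iff_deriv.1 this).2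

theorem IsTest.continuous {w : ℝ → ℝ} (hw : IsTest w) : Continuous w := hw.1.continuous

theorem IsTest.differentiable {w : ℝ → ℝ} (hw : IsTest w) : Differentiable ℝ w :=
  hw.1.differentiable (by simp)

theorem IsTest.eq_zero {w : ℝ → ℝ} (hw : IsTest w) {x : ℝ} (hx : x ∉ Ioo (0 : ℝ) 1) : w x = 0 :=
  image_eq_zero_of_notMem_tsupport fun h ↦ hx (hw.2.2 h)

theorem IsTest.zeroExt_eq {w : ℝ → ℝ} (hw : IsTest w) : zeroExt w = w := by
  ext x
  by_cases hx : x ∈ Ioo (0 : ℝ) 1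
  · simp [zeroExt, hx]
  · rw [hw.eq_zero hx, zeroExt, indicator_of_notMem hx]

theorem IsTest.integrable {w : ℝ → ℝ} (hw : IsTest w) : Integrable w :=
  hw.continuous.integrable_of_hasCompactSupport hw.2.1

theorem IsTest.memLp {w : ℝ → ℝ} (hw : IsTest w) (p : ENNReal) : MemLp w p volume :=
  hw.continuous.memLp_of_hasCompactSupport hw.2.1

theorem IsTest.memLp_vol01 {w : ℝ → ℝ} (hw : IsTest w) (p : ENNReal) : MemLp w p vol01 :=
  (hw.memLp p).restrict _

theorem IsTest.exists_bound {w : ℝ → ℝ} (hw : IsTest w) : ∃ C, ∀ x, |w x| ≤ C := by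
  obtain ⟨C, hC⟩ := hw.2.1.exists_bound_of_continuous hw.continuous
  exact ⟨C, hC⟩

theorem integral_vol01_eq {f : ℝ → ℝ} (hf : ∀ x ∉ Ioo (0 : ℝ) 1, f x = 0) :
    ∫ x, f x ∂vol01 = ∫ x, f x :=
  setIntegral_eq_integral_of_forall_compl_eq_zero hf

/-! ### Fourier transforms of test functions -/

/-- The Fourier transform of a real valued function. -/
noncomputable def ft (w : ℝ → ℝ) : ℝ → ℂ := 𝓕 (fun x ↦ (w x : ℂ))

theorem ft_apply (w : ℝ → ℝ) (ξ : ℝ) : ft w ξ = 𝓕 (fun x ↦ (w x : ℂ)) ξ := rfl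

theorem continuous_ft {w : ℝ → ℝ} (hw : Integrable w) : Continuous (ft w) :=
  VectorFourier.fourierIntegral_continuous Real.continuous_fourierChar
    (by exact continuous_inner) hw.ofReal

theorem norm_ft_le {w : ℝ → ℝ} (ξ : ℝ) : ‖ft w ξ‖ ≤ ∫ x, |w x| := by
  have := VectorFourier.norm_fourierIntegral_le_integral_norm Real.fourierChar volume
    (innerₗ ℝ) (fun x ↦ (w x : ℂ)) ξ
  simp only [Complex.norm_real, Real.norm_eq_abs] at this
  exact this

/-- A test function as a complex valued Schwartz function. -/
noncomputable def IsTest.toSchwartz {w : ℝ → ℝ} (hw : IsTest w) : SchwartzMap ℝ ℂ :=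
  HasCompactSupport.toSchwartzMap (f := fun x ↦ (w x : ℂ))
    (hw.2.1.comp_left (g := ((↑) : ℝ → ℂ)) Complex.ofReal_zero)
    (Complex.ofRealCLM.contDiff.comp hw.1)

theorem IsTest.toSchwartz_coe {w : ℝ → ℝ} (hw : IsTest w) :
    (hw.toSchwartz : ℝ → ℂ) = fun x ↦ (w x : ℂ) := rfl

theorem IsTest.ft_eq {w : ℝ → ℝ} (hw : IsTest w) : ft w = (𝓕 hw.toSchwartz : SchwartzMap ℝ ℂ) := by
  rw [SchwartzMap.fourier_coe, IsTest.toSchwartz_coe]; rfl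

theorem IsTest.integrable_ft {w : ℝ → ℝ} (hw : IsTest w) : Integrable (ft w) := by
  rw [hw.ft_eq]; exact SchwartzMap.integrable _

theorem IsTest.integrable_norm_ft_sq {w : ℝ → ℝ} (hw : IsTest w) :
    Integrable (fun ξ ↦ ‖ft w ξ‖ ^ 2) := by
  have := (SchwartzMap.memLp (𝓕 hw.toSchwartz) 2 volume).integrable_norm_pow (by simp)
  rw [hw.ft_eq]; simpa using this

theorem IsTest.ft_deriv {w : ℝ → ℝ} (hw : IsTest w) (ξ : ℝ) :
    ft (_root_.deriv w) ξ = (2 * Real.pi * Complex.I * ξ) * ft w ξ := by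
  have hd : _root_.deriv (fun x ↦ (w x : ℂ)) = fun x ↦ ((_root_.deriv w x : ℝ) : ℂ) := by
    ext x
    exact (hw.differentiable x).hasDerivAt.ofReal_comp.deriv
  have := Real.fourier_deriv (f := fun x ↦ (w x : ℂ)) hw.integrable.ofReal
    (fun x ↦ (hw.differentiable x).hasDerivAt.ofReal_comp.differentiableAt)
    (by rw [hd]; exact hw.deriv.integrable.ofReal)
  rw [hd] at this
  simpa [ft, smul_eq_mul] using congrFun this ξ

theorem IsTest.norm_ft_deriv {w : ℝ → ℝ} (hw : IsTest w) (ξ : ℝ) :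
    ‖ft (_root_.deriv w) ξ‖ ^ 2 = |2 * Real.pi * ξ| ^ 2 * ‖ft w ξ‖ ^ 2 := by
  rw [hw.ft_deriv, norm_mul, mul_pow]
  simp [abs_mul]

/-- Plancherel's identity for integrable functions, one of which satisfies Fourier inversion. -/
theorem integral_conj_ft_mul_ft {f g : ℝ → ℝ} (hf : Integrable f) (hg : Integrable g)
    (hgc : Continuous g) (hgf : Integrable (ft g)) :
    ∫ ξ, (starRingEnd ℂ) (ft f ξ) * ft g ξ = ((∫ x, f x * g x : ℝ) : ℂ) := by
  have key := VectorFourier.integral_sesq_fourierIntegral_eq_neg_flip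
    (M := innerSL ℂ) (L := innerₗ ℝ) (μ := volume) (ν := volume) (f := fun x ↦ (f x : ℂ))
    Real.continuous_fourierChar continuous_inner hf.ofReal hgf
  have hinv : 𝓕⁻ (ft g) = fun x ↦ (g x : ℂ) :=
    Continuous.fourierInv_fourier_eq (Complex.continuous_ofReal.comp hgc) hg.ofReal hgf
  have hflip : (-(innerₗ ℝ).flip : ℝ →ₗ[ℝ] ℝ →ₗ[ℝ] ℝ) = -innerₗ ℝ := by simp
  rw [hflip] at key
  have h2 : ∀ x, VectorFourier.fourierIntegral Real.fourierChar volume (-innerₗ ℝ) (ft g) x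
      = (g x : ℂ) := fun x ↦ congrFun hinv x
  have h3 : ∫ ξ, (starRingEnd ℂ) (ft f ξ) * ft g ξ =
      ∫ ξ, (innerSL ℂ) (VectorFourier.fourierIntegral Real.fourierChar volume (innerₗ ℝ)
        (fun x ↦ (f x : ℂ)) ξ) (ft g ξ) := by
    refine integral_congr_ae (Filter.Eventually.of_forall fun ξ ↦ ?_)
    simp only [innerSL_apply_apply, RCLike.inner_apply]
    rw [mul_comm]; rfl
  rw [h3, key, ← integral_complex_ofReal]
  refine integral_congr_ae (Filter.Eventually.of_forall fun x ↦ ?_)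
  simp [h2, mul_comm]

theorem IsTest.integral_norm_ft_sq {w : ℝ → ℝ} (hw : IsTest w) :
    ∫ ξ, ‖ft w ξ‖ ^ 2 = ∫ x, w x ^ 2 := by
  have := integral_conj_ft_mul_ft hw.integrable hw.integrable hw.continuous hw.integrable_ft
  simp_rw [← Complex.normSq_eq_conj_mul_self, integral_complex_ofReal, Complex.ofReal_inj] at this
  simpa [Complex.normSq_eq_norm_sq, sq] using this

/-- Low frequencies of a function on `(0,1)` are controlled by the high ones. -/
theorem IsTest.integral_sq_le {w : ℝ → ℝ} (hw : IsTest w) {m : ℝ → ℝ} {c : ℝ} (hc : 0 < c)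
    (hm0 : ∀ ξ, 0 ≤ m ξ) (hm : ∀ ξ, 1 ≤ |2 * Real.pi * ξ| → c ≤ m ξ)
    (hint : Integrable (fun ξ ↦ m ξ * ‖ft w ξ‖ ^ 2)) :
    c * ∫ x, w x ^ 2 ≤ 2 * ∫ ξ, m ξ * ‖ft w ξ‖ ^ 2 := by
  -- Cauchy–Schwarz on an interval of length one, obtained from the nonnegativity of the variance of
  -- `|w|`.
  have hL1 : (∫ x, |w x|) ^ 2 ≤ ∫ x, w x ^ 2 := by
    rw [← integral_vol01_eq (f := fun x ↦ |w x|) (fun x hx ↦ by simp [hw.eq_zero hx]),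
      ← integral_vol01_eq (f := fun x ↦ w x ^ 2) (fun x hx ↦ by simp [hw.eq_zero hx])]
    set I := ∫ x, |w x| ∂vol01
    have hi1 : Integrable (fun x ↦ |w x|) vol01 := hw.integrable.abs.restrict
    have hi2 : Integrable (fun x ↦ w x ^ 2) vol01 := (hw.memLp_vol01 2).integrable_sq
    have : 0 ≤ ∫ x, (|w x| - I) ^ 2 ∂vol01 := integral_nonneg fun x ↦ sq_nonneg _
    have h2 : ∫ x, (|w x| - I) ^ 2 ∂vol01 = ∫ x, w x ^ 2 ∂vol01 - I ^ 2 := by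
      have : ∀ x, (|w x| - I) ^ 2 = w x ^ 2 - (2 * I) * |w x| + I ^ 2 := fun x ↦ by
        rw [sub_sq, sq_abs]; ring
      simp_rw [this]
      rw [integral_add (f := fun x ↦ w x ^ 2 - 2 * I * |w x|) (hi2.sub (hi1.const_mul _))
          (integrable_const _),
        integral_sub hi2 (hi1.const_mul _), integral_const_mul]
      simp only [integral_const, measureReal_restrict_apply_univ, Real.volume_real_Ioo]
      norm_num
      ring
    linarith
  set N := ∫ x, w x ^ 2 with hN
  have hN0 : 0 ≤ N := integral_nonneg fun x ↦ sq_nonneg _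
  -- On `|ξ| ≤ 1/4` the bound `|ŵ|² ≤ ‖w‖₁² ≤ N` is used. This interval has length `1/2`, so its
  -- contribution is at most half of the left side and can be absorbed. Outside it, `|2πξ| > π/2 >
  -- 1`, and the lower bound on `m` applies.
  have hpt : ∀ ξ, c * ‖ft w ξ‖ ^ 2 ≤
      (Icc (-(1 / 4) : ℝ) (1 / 4)).indicator (fun _ ↦ c * N) ξ + m ξ * ‖ft w ξ‖ ^ 2 := by
    intro ξ
    by_cases hξ : ξ ∈ Icc (-(1 / 4) : ℝ) (1 / 4)
    · rw [indicator_of_mem hξ]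
      have h1 : ‖ft w ξ‖ ^ 2 ≤ N := by
        refine le_trans ?_ hL1
        gcongr
        exact norm_ft_le ξ
      have := mul_nonneg (hm0 ξ) (sq_nonneg ‖ft w ξ‖)
      nlinarith
    · rw [indicator_of_notMem hξ, zero_add]
      gcongr
      apply hm
      rw [abs_mul, abs_of_pos Real.two_pi_pos]
      have h1 : 1 / 4 < |ξ| := by
        by_contra! h
        exact hξ (abs_le.1 h)
      nlinarith [Real.pi_gt_three]
  have hii : Integrable ((Icc (-(1 / 4) : ℝ) (1 / 4)).indicator (fun _ ↦ c * N)) :=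
    (integrable_indicator_iff measurableSet_Icc).2 (by
      exact integrableOn_const (by simp))
  have := integral_mono (hw.integrable_norm_ft_sq.const_mul c) (hii.add hint) hpt
  simp only [Pi.add_apply] at this
  rw [integral_const_mul, hw.integral_norm_ft_sq, integral_add hii hint,
    integral_indicator measurableSet_Icc] at this
  simp only [integral_const, measureReal_restrict_apply_univ, Real.volume_real_Icc] at this
  norm_num at this
  linarith

/-! ### The damped fractional integration kernel -/

/-- The Laplace transform of `t ^ (β - 1)` on the right half-plane. -/
theorem integral_rpow_mul_cexp {β : ℝ} (hβ : 0 < β) {z : ℂ} (hz : 0 < z.re) :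
    ∫ t in Ioi (0 : ℝ), ((t ^ (β - 1) : ℝ) : ℂ) * Complex.exp (-(z * t))
      = Real.Gamma β * z ^ (-β : ℂ) := by
  -- The integral is the complex moment generating function, at `-z`, of the measure `t^{β-1} dt` on
  -- the half-line, hence analytic in `z`. The formula follows from the real Gamma integral by the
  -- identity theorem on the left half-plane.
  set μ : Measure ℝ :=
    (volume.restrict (Ioi 0)).withDensity (fun t ↦ ENNReal.ofReal (t ^ (β - 1))) with hμ
  have hmeas : Measurable (fun t : ℝ ↦ ENNReal.ofReal (t ^ (β - 1))) := by fun_prop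
  have hfin : ∀ᵐ t ∂(volume.restrict (Ioi (0 : ℝ))), ENNReal.ofReal (t ^ (β - 1)) < ⊤ :=
    Filter.Eventually.of_forall fun t ↦ ENNReal.ofReal_lt_top
  have hμint : ∀ z : ℂ, ProbabilityTheory.complexMGF id μ z =
      ∫ t in Ioi (0 : ℝ), ((t ^ (β - 1) : ℝ) : ℂ) * Complex.exp (z * t) := by
    intro z
    rw [ProbabilityTheory.complexMGF, hμ, integral_withDensity_eq_integral_toReal_smul hmeas hfin]
    refine setIntegral_congr_fun measurableSet_Ioi fun t ht ↦ ?_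
    simp only [id]
    rw [ENNReal.toReal_ofReal (Real.rpow_nonneg (le_of_lt ht) _), Complex.real_smul]
  have hset : Iio (0 : ℝ) ⊆ ProbabilityTheory.integrableExpSet id μ := by
    intro t ht
    rw [ProbabilityTheory.integrableExpSet, mem_ofPred_eq, hμ,
      integrable_withDensity_iff_integrable_smul' hmeas hfin]
    have := integrableOn_rpow_mul_exp_neg_mul_rpow (p := 1) (s := β - 1) (b := -t) (by linarith)
      one_pos (by simpa using ht)
    refine (integrableOn_congr_fun (fun x hx ↦ ?_) measurableSet_Ioi).1 this
    simp only [id, smul_eq_mul]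
    rw [ENNReal.toReal_ofReal (Real.rpow_nonneg (le_of_lt hx) _)]
    simp
  set U : Set ℂ := {z | z.re < 0} with hU
  have hUo : IsOpen U := isOpen_lt Complex.continuous_re continuous_const
  have hUc : Convex ℝ U := convex_halfSpace_re_lt 0
  have hf : AnalyticOnNhd ℂ (ProbabilityTheory.complexMGF id μ) U := by
    refine ProbabilityTheory.analyticOnNhd_complexMGF.mono fun z hz ↦ ?_
    exact interior_maximal hset isOpen_Iio hz
  have hg : AnalyticOnNhd ℂ (fun z : ℂ ↦ (Real.Gamma β : ℂ) * (-z) ^ (-β : ℂ)) U := by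
    refine DifferentiableOn.analyticOnNhd (fun z hz ↦ ?_) hUo
    have hs : -z ∈ Complex.slitPlane := Or.inl (by simpa [hU] using hz)
    exact ((differentiableAt_id.neg.cpow_const hs).const_mul _).differentiableWithinAt
  have hreal : ∀ x : ℝ, x < 0 → ProbabilityTheory.complexMGF id μ (x : ℂ) =
      (Real.Gamma β : ℂ) * (-(x : ℂ)) ^ (-β : ℂ) := by
    intro x hx
    rw [hμint]
    have h1 := Real.integral_rpow_mul_exp_neg_mul_Ioi hβ (neg_pos.2 hx)
    have h2 : (-(x : ℂ)) ^ (-β : ℂ) = ((1 / (-x)) ^ β : ℝ) := by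
      rw [one_div, Real.inv_rpow (by linarith), ← Real.rpow_neg (by linarith),
        Complex.ofReal_cpow (by linarith)]
      push_cast; rfl
    rw [h2, mul_comm, ← Complex.ofReal_mul, ← h1, ← integral_complex_ofReal]
    refine setIntegral_congr_fun measurableSet_Ioi fun t ht ↦ ?_
    push_cast
    ring_nf
  have hfreq : ∃ᶠ w in 𝓝[≠] (-1 : ℂ), ProbabilityTheory.complexMGF id μ w =
      (Real.Gamma β : ℂ) * (-w) ^ (-β : ℂ) := by
    have ht : Filter.Tendsto (fun x : ℝ ↦ (x : ℂ)) (𝓝[≠] (-1)) (𝓝[≠] (-1 : ℂ)) := by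
      refine tendsto_nhdsWithin_of_tendsto_nhds_of_eventually_within _ ?_ ?_
      · have : Filter.Tendsto (fun x : ℝ ↦ (x : ℂ)) (𝓝 (-1)) (𝓝 ((-1 : ℝ) : ℂ)) :=
          Complex.continuous_ofReal.tendsto _
        simpa using this.mono_left nhdsWithin_le_nhds
      · filter_upwards [self_mem_nhdsWithin] with x hx h
        have h' : (x : ℂ) = -1 := h
        exact hx (show x = -1 by exact_mod_cast h')
    refine ht.frequently ?_
    refine Filter.Eventually.frequently ?_
    have : ∀ᶠ x : ℝ in 𝓝 (-1), x < 0 := Iio_mem_nhds (by norm_num)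
    filter_upwards [this.filter_mono nhdsWithin_le_nhds] with x hx using hreal x hx
  have := hf.eqOn_of_preconnected_of_frequently_eq hg hUc.isPreconnected
    (by simp [hU] : (-1 : ℂ) ∈ U) hfreq (show -z ∈ U by simpa [hU] using hz)
  simp only [hμint, neg_neg] at this
  rw [← this]
  simp only [neg_mul]

/-- The damped kernel `t_+^{β-1} e^{-εt} / Γ(β)`. -/
noncomputable def dker (β ε : ℝ) : ℝ → ℝ :=
  (Ioi (0 : ℝ)).indicator fun t ↦ t ^ (β - 1) * Real.exp (-(ε * t)) / Real.Gamma β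

theorem dker_of_pos {β ε t : ℝ} (ht : 0 < t) :
    dker β ε t = t ^ (β - 1) * Real.exp (-(ε * t)) / Real.Gamma β :=
  indicator_of_mem (s := Ioi (0 : ℝ)) ht _

theorem dker_of_nonpos {β ε t : ℝ} (ht : t ≤ 0) : dker β ε t = 0 :=
  indicator_of_notMem (s := Ioi (0 : ℝ)) (not_lt.2 ht) _

theorem dker_nonneg {β : ℝ} (hβ : 0 < β) (ε t : ℝ) : 0 ≤ dker β ε t := by
  refine indicator_nonneg (fun t ht ↦ ?_) t
  have := Real.Gamma_pos_of_pos hβ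
  have : (0 : ℝ) < t := ht
  positivity

theorem dker_eq_exp_mul (β ε t : ℝ) : dker β ε t = Real.exp (-(ε * t)) * dker β 0 t := by
  rcases lt_or_ge 0 t with h | h
  · rw [dker_of_pos h, dker_of_pos h]; simp; ring
  · rw [dker_of_nonpos h, dker_of_nonpos h, mul_zero]

theorem dker_le {β : ℝ} (hβ : 0 < β) {ε : ℝ} (hε : 0 ≤ ε) (t : ℝ) : dker β ε t ≤ dker β 0 t := by
  rcases lt_or_ge 0 t with h | h
  · rw [dker_eq_exp_mul]
    exact mul_le_of_le_one_left (dker_nonneg hβ _ _)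
      (Real.exp_le_one_iff.2 (neg_nonpos.2 (by positivity)))
  · rw [dker_of_nonpos h, dker_of_nonpos h]

theorem integrable_dker {β ε : ℝ} (hβ : 0 < β) (hε : 0 < ε) : Integrable (dker β ε) := by
  refine (integrable_indicator_iff measurableSet_Ioi).2 ?_
  have := integrableOn_rpow_mul_exp_neg_mul_rpow (p := 1) (s := β - 1) (b := ε) (by linarith)
      one_pos hε
  simpa [IntegrableOn] using this.div_const (Real.Gamma β)

/-- Multiplying the integrable damped kernel by the continuous function `e^t` undoes the damping. -/
theorem locallyIntegrable_dker {β : ℝ} (hβ : 0 < β) : LocallyIntegrable (dker β 0) := by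
  have h := (integrable_dker hβ one_pos).locallyIntegrable
  have h2 := (locallyIntegrableOn_univ.2 h).continuousOn_mul (g := fun t : ℝ ↦ Real.exp t)
    (by fun_prop) isOpen_univ.isLocallyClosed
  rw [locallyIntegrableOn_univ] at h2
  refine h2.congr (Filter.Eventually.of_forall fun t ↦ ?_)
  simp only
  rw [dker_eq_exp_mul β 1, ← mul_assoc, ← Real.exp_add]
  simp

/-- This is the Laplace transform evaluated at `ε + iω`. The damping keeps the argument in the open
right half-plane, where the integral converges absolutely. -/
theorem ft_dker {β ε : ℝ} (hβ : 0 < β) (hε : 0 < ε) (ξ : ℝ) :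
    ft (dker β ε) ξ = (ε + (2 * Real.pi * ξ : ℝ) * Complex.I) ^ (-β : ℂ) := by
  have hG : (Real.Gamma β : ℂ) ≠ 0 := by
    exact_mod_cast (Real.Gamma_pos_of_pos hβ).ne'
  have h := integral_rpow_mul_cexp hβ (z := ε + (2 * Real.pi * ξ : ℝ) * Complex.I)
    (by simpa using hε)
  rw [ft_apply, Real.fourier_real_eq_integral_exp_smul]
  have : ∀ t : ℝ, Complex.exp ((-2 * Real.pi * t * ξ : ℝ) * Complex.I) • (dker β ε t : ℂ) =
      (Ioi (0 : ℝ)).indicator (fun t : ℝ ↦ (((t ^ (β - 1) : ℝ) : ℂ) *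
        Complex.exp (-((ε + (2 * Real.pi * ξ : ℝ) * Complex.I) * t))) / Real.Gamma β) t := by
    intro t
    rcases lt_or_ge 0 t with ht | ht
    · rw [dker_of_pos ht, indicator_of_mem (s := Ioi (0 : ℝ)) ht, smul_eq_mul]
      push_cast
      rw [add_mul, neg_add, Complex.exp_add]
      rw [mul_div_assoc', mul_left_comm, mul_comm (Complex.exp (-(ε * t) : ℂ))]
      ring_nf
    · rw [dker_of_nonpos ht, indicator_of_notMem (s := Ioi (0 : ℝ)) (not_lt.2 ht)]
      simp
  simp_rw [this]
  rw [integral_indicator measurableSet_Ioi, integral_div, h, mul_div_cancel_left₀ _ hG]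

/-- Reflection of a real kernel conjugates its symbol, so the right-sided operator inherits its
estimates from the left-sided one. -/
theorem ft_comp_neg (f : ℝ → ℝ) (ξ : ℝ) :
    ft (fun t ↦ f (-t)) ξ = (starRingEnd ℂ) (ft f ξ) := by
  rw [ft_apply, ft_apply, Real.fourier_real_eq_integral_exp_smul,
    Real.fourier_real_eq_integral_exp_smul, ← integral_conj,
    ← integral_neg_eq_self]
  refine integral_congr_ae (Filter.Eventually.of_forall fun t ↦ ?_)
  simp only [smul_eq_mul, map_mul, neg_neg, Complex.conj_ofReal, ← Complex.exp_conj, Complex.conj_I]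
  congr 2
  push_cast; ring

/-! ### Convolutions and their Plancherel identities -/

/-- Convolution of real functions, as an integral. -/
noncomputable def conv (k u : ℝ → ℝ) (x : ℝ) : ℝ := ∫ t, k t * u (x - t)

theorem ft_conv {k u : ℝ → ℝ} (hk : Integrable k) (hu : Integrable u) (ξ : ℝ) :
    ft (conv k u) ξ = ft k ξ * ft u ξ := by
  have := Real.fourier_mul_convolution_eq (R := ℂ) hk.ofReal hu.ofReal ξ
  rw [ft_apply, ft_apply, ft_apply]
  refine Eq.trans ?_ this
  refine congrFun (congrArg _ (funext fun x ↦ ?_)) ξ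
  simp only [conv, convolution, ContinuousLinearMap.mul_apply']
  rw [← integral_complex_ofReal]
  push_cast
  rfl

theorem integrable_conv {k u : ℝ → ℝ} (hk : Integrable k) (hu : Integrable u) :
    Integrable (conv k u) := hk.integrable_convolution (ContinuousLinearMap.lsmul ℝ ℝ) hu

theorem IsTest.continuous_conv {k u : ℝ → ℝ} (hk : LocallyIntegrable k) (hu : IsTest u) :
    Continuous (conv k u) := hu.2.1.continuous_convolution_right (ContinuousLinearMap.lsmul ℝ ℝ) hk hu.continuous

theorem IsTest.integrable_mul_comp_sub {k u : ℝ → ℝ} (hk : LocallyIntegrable k) (hu : IsTest u)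
    (x : ℝ) : Integrable (fun t ↦ k t * u (x - t)) :=
  hu.2.1.convolutionExists_right (ContinuousLinearMap.lsmul ℝ ℝ) hk hu.continuous x

theorem IsTest.hasDerivAt_conv {k u : ℝ → ℝ} (hk : LocallyIntegrable k) (hu : IsTest u) (x : ℝ) :
    HasDerivAt (conv k u) (conv k (_root_.deriv u) x) x :=
  hu.2.1.hasDerivAt_convolution_right (ContinuousLinearMap.lsmul ℝ ℝ) hk (hu.1.of_le (by simp)) x

theorem IsTest.integrable_ft_conv {k u : ℝ → ℝ} (hk : Integrable k) (hu : IsTest u) :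
    Integrable (ft (conv k u)) := by
  have : ft (conv k u) = fun ξ ↦ ft k ξ * ft u ξ := funext (ft_conv hk hu.integrable)
  rw [this]
  exact hu.integrable_ft.bdd_mul (continuous_ft hk).aestronglyMeasurable
    (Filter.Eventually.of_forall fun ξ ↦ norm_ft_le ξ)

theorem IsTest.integral_conv_mul_conv {k l u : ℝ → ℝ} (hk : Integrable k) (hl : Integrable l)
    (hu : IsTest u) :
    ((∫ x, conv k u x * conv l u x : ℝ) : ℂ) =
      ∫ ξ, (starRingEnd ℂ) (ft k ξ) * ft l ξ * (‖ft u ξ‖ ^ 2 : ℝ) := by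
  rw [← integral_conj_ft_mul_ft (integrable_conv hk hu.integrable)
    (integrable_conv hl hu.integrable) (hu.continuous_conv hl.locallyIntegrable)
    (hu.integrable_ft_conv hl)]
  refine integral_congr_ae (Filter.Eventually.of_forall fun ξ ↦ ?_)
  simp only
  rw [ft_conv hk hu.integrable, ft_conv hl hu.integrable, map_mul, ← Complex.normSq_eq_norm_sq,
    Complex.normSq_eq_conj_mul_self]
  ring

theorem IsTest.integral_conv_mul {k u : ℝ → ℝ} (hk : Integrable k) (hu : IsTest u) :
    ((∫ x, conv k u x * u x : ℝ) : ℂ) =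
      ∫ ξ, (starRingEnd ℂ) (ft k ξ) * (‖ft u ξ‖ ^ 2 : ℝ) := by
  rw [← integral_conj_ft_mul_ft (integrable_conv hk hu.integrable) hu.integrable
    hu.continuous hu.integrable_ft]
  refine integral_congr_ae (Filter.Eventually.of_forall fun ξ ↦ ?_)
  simp only
  rw [ft_conv hk hu.integrable, map_mul, ← Complex.normSq_eq_norm_sq,
    Complex.normSq_eq_conj_mul_self]
  ring

/-! ### Removing the damping -/

/-- The left kernel, reflected. -/
noncomputable def rker (β ε : ℝ) (t : ℝ) : ℝ := dker β ε (-t)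

/-- A sequence of damping parameters tending to zero. -/
noncomputable def damp (n : ℕ) : ℝ := 1 / ((n : ℝ) + 1)

theorem damp_pos (n : ℕ) : 0 < damp n := Nat.one_div_pos_of_nat

theorem damp_le_one (n : ℕ) : damp n ≤ 1 := by
  rw [damp, div_le_one (by positivity)]; linarith [n.cast_nonneg (α := ℝ)]

theorem tendsto_damp : Tendsto damp atTop (𝓝 0) := tendsto_one_div_add_atTop_nhds_zero_nat

theorem tendsto_dker (β t : ℝ) : Tendsto (fun n ↦ dker β (damp n) t) atTop (𝓝 (dker β 0 t)) := by
  have h : ∀ n, dker β (damp n) t = Real.exp (-(damp n * t)) * dker β 0 t :=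
    fun n ↦ dker_eq_exp_mul _ _ _
  simp_rw [h]
  have h2 : Tendsto (fun n ↦ Real.exp (-(damp n * t))) atTop (𝓝 (Real.exp (-(0 * t)))) :=
    (Real.continuous_exp.tendsto _).comp ((tendsto_damp.mul_const t).neg)
  simpa using h2.mul_const (dker β 0 t)

/-- A sequence of integrable kernels increasing to a locally integrable one. -/
structure KernelApprox (k : ℕ → ℝ → ℝ) (k₀ : ℝ → ℝ) : Prop where
  integrable : ∀ n, Integrable (k n)
  locallyIntegrable : LocallyIntegrable k₀
  abs_le : ∀ n t, |k n t| ≤ k₀ t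
  tendsto : ∀ t, Tendsto (fun n ↦ k n t) atTop (𝓝 (k₀ t))

theorem kernelApprox_dker {β : ℝ} (hβ : 0 < β) :
    KernelApprox (fun n ↦ dker β (damp n)) (dker β 0) where
  integrable n := integrable_dker hβ (damp_pos n)
  locallyIntegrable := locallyIntegrable_dker hβ
  abs_le n t := by
    rw [abs_of_nonneg (dker_nonneg hβ _ _)]; exact dker_le hβ (damp_pos n).le t
  tendsto := tendsto_dker β

theorem KernelApprox.reflect {k : ℕ → ℝ → ℝ} {k₀ : ℝ → ℝ} (h : KernelApprox k k₀) :
    KernelApprox (fun n t ↦ k n (-t)) (fun t ↦ k₀ (-t)) where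
  integrable n := (h.integrable n).comp_neg
  locallyIntegrable := by
    rw [locallyIntegrable_iff]
    intro K hK
    have h1 : IntegrableOn k₀ (Homeomorph.neg ℝ '' K) :=
      h.locallyIntegrable.integrableOn_isCompact (hK.image (Homeomorph.neg ℝ).continuous)
    have h2 := (MeasurePreserving.integrableOn_image (Measure.measurePreserving_neg (volume : Measure ℝ))
      (Homeomorph.neg ℝ).measurableEmbedding (f := k₀) (s := K)).1 h1
    exact h2
  abs_le n t := h.abs_le n (-t)
  tendsto t := h.tendsto (-t)

theorem kernelApprox_rker {β : ℝ} (hβ : 0 < β) :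
    KernelApprox (fun n ↦ rker β (damp n)) (rker β 0) := (kernelApprox_dker hβ).reflect

section

variable {k l : ℕ → ℝ → ℝ} {k₀ l₀ u : ℝ → ℝ}

theorem KernelApprox.integrable_abs (h : KernelApprox k k₀) (hu : IsTest u) (x : ℝ) :
    Integrable (fun t ↦ k₀ t * |u (x - t)|) :=
  hu.2.1.abs.convolutionExists_right (ContinuousLinearMap.lsmul ℝ ℝ) h.locallyIntegrable
    hu.continuous.abs x

theorem KernelApprox.tendsto_conv (h : KernelApprox k k₀) (hu : IsTest u) (x : ℝ) :
    Tendsto (fun n ↦ conv (k n) u x) atTop (𝓝 (conv k₀ u x)) := by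
  refine tendsto_integral_of_dominated_convergence _ (fun n ↦ ?_) (h.integrable_abs hu x)
    (fun n ↦ Eventually.of_forall fun t ↦ ?_) (Eventually.of_forall fun t ↦ ?_)
  · exact (hu.integrable_mul_comp_sub (h.integrable n).locallyIntegrable x).aestronglyMeasurable
  · rw [Real.norm_eq_abs, abs_mul]
    exact mul_le_mul_of_nonneg_right (h.abs_le n t) (abs_nonneg _)
  · exact (h.tendsto t).mul_const _

/-- The limit kernel dominates every `k n`, and its convolution with `|u|` is continuous, hence
bounded on `[0,1]`. This gives the constant majorant for the limits of integrals over the interval.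
-/
theorem KernelApprox.exists_bound (h : KernelApprox k k₀) (hu : IsTest u) :
    ∃ C, ∀ n, ∀ x ∈ Ioo (0 : ℝ) 1, |conv (k n) u x| ≤ C := by
  have hc : Continuous (conv k₀ (fun x ↦ |u x|)) :=
    hu.2.1.abs.continuous_convolution_right (ContinuousLinearMap.lsmul ℝ ℝ) h.locallyIntegrable
      hu.continuous.abs
  obtain ⟨C, hC⟩ := (isCompact_Icc (a := (0 : ℝ)) (b := 1)).exists_bound_of_continuousOn
    hc.continuousOn
  refine ⟨C, fun n x hx ↦ ?_⟩
  refine le_trans ?_ (hC x (Ioo_subset_Icc_self hx))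
  refine le_trans ?_ (le_abs_self _)
  refine (abs_integral_le_integral_abs).trans (integral_mono_of_nonneg
    (Eventually.of_forall fun t ↦ abs_nonneg _) (h.integrable_abs hu x)
    (Eventually.of_forall fun t ↦ ?_))
  simp only [abs_mul]
  exact mul_le_mul_of_nonneg_right (h.abs_le n t) (abs_nonneg _)

theorem KernelApprox.tendsto_integral (h : KernelApprox k k₀) (h' : KernelApprox l l₀)
    (hu : IsTest u) :
    Tendsto (fun n ↦ ∫ x, conv (k n) u x * conv (l n) u x ∂vol01) atTop
      (𝓝 (∫ x, conv k₀ u x * conv l₀ u x ∂vol01)) := by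
  obtain ⟨C, hC⟩ := h.exists_bound hu
  obtain ⟨C', hC'⟩ := h'.exists_bound hu
  refine tendsto_integral_of_dominated_convergence (fun _ ↦ C * C') (fun n ↦ ?_)
    (integrable_const _) (fun n ↦ ?_) (Eventually.of_forall fun x ↦ ?_)
  · exact ((hu.continuous_conv (h.integrable n).locallyIntegrable).mul
      (hu.continuous_conv (h'.integrable n).locallyIntegrable)).aestronglyMeasurable
  · filter_upwards [ae_restrict_mem measurableSet_Ioo] with x hx
    rw [Real.norm_eq_abs, abs_mul]
    exact mul_le_mul (hC n x hx) (hC' n x hx) (abs_nonneg _) ((abs_nonneg _).trans (hC n x hx))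
  · exact (h.tendsto_conv hu x).mul (h'.tendsto_conv hu x)

theorem KernelApprox.tendsto_integral_mul (h : KernelApprox k k₀) (hu : IsTest u) :
    Tendsto (fun n ↦ ∫ x, conv (k n) u x * u x ∂vol01) atTop
      (𝓝 (∫ x, conv k₀ u x * u x ∂vol01)) := by
  obtain ⟨C, hC⟩ := h.exists_bound hu
  obtain ⟨C', hC'⟩ := hu.exists_bound
  refine tendsto_integral_of_dominated_convergence (fun _ ↦ C * C') (fun n ↦ ?_)
    (integrable_const _) (fun n ↦ ?_) (Eventually.of_forall fun x ↦ ?_)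
  · exact ((hu.continuous_conv (h.integrable n).locallyIntegrable).mul
      hu.continuous).aestronglyMeasurable
  · filter_upwards [ae_restrict_mem measurableSet_Ioo] with x hx
    rw [Real.norm_eq_abs, abs_mul]
    exact mul_le_mul (hC n x hx) (hC' x) (abs_nonneg _) ((abs_nonneg _).trans (hC n x hx))
  · exact (h.tendsto_conv hu x).mul_const _

end

/-! ### Energy estimates for test functions -/

/-- The Fourier seminorm squared `∫ |ω|^{2μ} |ŵ|²`. -/
noncomputable def semi (μ : ℝ) (w : ℝ → ℝ) : ℝ := ∫ ξ, (|2 * Real.pi * ξ| ^ μ) ^ 2 * ‖ft w ξ‖ ^ 2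

theorem sq_rpow_le {a μ : ℝ} (ha : 0 ≤ a) (h0 : 0 ≤ μ) (h1 : μ ≤ 1) :
    (a ^ μ) ^ 2 ≤ 1 + a ^ 2 := by
  rcases le_total a 1 with h | h
  · have := Real.rpow_le_one ha h h0
    have := Real.rpow_nonneg ha μ
    nlinarith
  · have h2 := Real.rpow_le_rpow_of_exponent_le h h1
    rw [Real.rpow_one] at h2
    have := Real.rpow_nonneg ha μ
    nlinarith

theorem IsTest.integrable_weight {w : ℝ → ℝ} (hw : IsTest w) :
    Integrable (fun ξ ↦ |2 * Real.pi * ξ| ^ 2 * ‖ft w ξ‖ ^ 2) := by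
  have := hw.deriv.integrable_norm_ft_sq
  simpa only [hw.norm_ft_deriv] using this

theorem IsTest.integral_weight {w : ℝ → ℝ} (hw : IsTest w) :
    ∫ ξ, |2 * Real.pi * ξ| ^ 2 * ‖ft w ξ‖ ^ 2 = ∫ x, _root_.deriv w x ^ 2 := by
  rw [← hw.deriv.integral_norm_ft_sq]
  simp only [hw.norm_ft_deriv]

theorem IsTest.integrable_weight' {w : ℝ → ℝ} (hw : IsTest w) {m : ℝ → ℝ}
    (hm : AEStronglyMeasurable m) (hb : ∀ ξ, |m ξ| ≤ 1 + |2 * Real.pi * ξ| ^ 2) :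
    Integrable (fun ξ ↦ m ξ * ‖ft w ξ‖ ^ 2) := by
  refine (hw.integrable_norm_ft_sq.add hw.integrable_weight).mono
    (hm.mul hw.integrable_norm_ft_sq.aestronglyMeasurable) (Eventually.of_forall fun ξ ↦ ?_)
  simp only [Pi.add_apply, Real.norm_eq_abs]
  rw [abs_mul, abs_of_nonneg (sq_nonneg ‖ft w ξ‖)]
  refine le_trans ?_ (le_abs_self _)
  nlinarith [hb ξ, sq_nonneg ‖ft w ξ‖]

theorem IsTest.integrable_semi {w : ℝ → ℝ} (hw : IsTest w) {μ : ℝ} (h0 : 0 ≤ μ) (h1 : μ ≤ 1) :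
    Integrable (fun ξ ↦ (|2 * Real.pi * ξ| ^ μ) ^ 2 * ‖ft w ξ‖ ^ 2) := by
  refine hw.integrable_weight' (by fun_prop) fun ξ ↦ ?_
  rw [abs_of_nonneg (by positivity)]
  exact sq_rpow_le (abs_nonneg _) h0 h1

theorem IsTest.integral_sq_le_semi {w : ℝ → ℝ} (hw : IsTest w) {μ : ℝ} (h0 : 0 ≤ μ) (h1 : μ ≤ 1) :
    ∫ x, w x ^ 2 ≤ 2 * semi μ w := by
  have := hw.integral_sq_le one_pos (m := fun ξ ↦ (|2 * Real.pi * ξ| ^ μ) ^ 2)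
    (fun ξ ↦ by positivity) (fun ξ hξ ↦ one_le_pow₀ (Real.one_le_rpow hξ h0))
    (hw.integrable_semi h0 h1)
  rwa [one_mul] at this

theorem IsTest.integral_sq_le_deriv {w : ℝ → ℝ} (hw : IsTest w) :
    ∫ x, w x ^ 2 ≤ 2 * ∫ x, _root_.deriv w x ^ 2 := by
  have := hw.integral_sq_le one_pos (m := fun ξ ↦ |2 * Real.pi * ξ| ^ 2)
    (fun ξ ↦ by positivity) (fun ξ hξ ↦ one_le_pow₀ hξ) hw.integrable_weight
  rwa [one_mul, hw.integral_weight] at this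

theorem IsTest.semi_le {w : ℝ → ℝ} (hw : IsTest w) {μ : ℝ} (h0 : 0 ≤ μ) (h1 : μ ≤ 1) :
    semi μ w ≤ 3 * ∫ x, _root_.deriv w x ^ 2 := by
  have h := integral_mono (hw.integrable_semi h0 h1)
    (hw.integrable_norm_ft_sq.add hw.integrable_weight) (fun ξ ↦ by
      have := sq_rpow_le (abs_nonneg (2 * Real.pi * ξ)) h0 h1
      simp only [Pi.add_apply]
      nlinarith [sq_nonneg ‖ft w ξ‖])
  rw [integral_add' hw.integrable_norm_ft_sq hw.integrable_weight, hw.integral_weight,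
    hw.integral_norm_ft_sq] at h
  have := hw.integral_sq_le_deriv
  rw [semi]
  linarith

/-! ### Bounds on the symbol `(ε + iω)^{-β}` -/

/-- The Laplace variable `ε + iω`. -/
noncomputable def lvar (ε ξ : ℝ) : ℂ := ε + (2 * Real.pi * ξ : ℝ) * Complex.I

theorem lvar_re (ε ξ : ℝ) : (lvar ε ξ).re = ε := by simp [lvar]

theorem lvar_im (ε ξ : ℝ) : (lvar ε ξ).im = 2 * Real.pi * ξ := by simp [lvar]

theorem abs_le_norm_lvar (ε ξ : ℝ) : |2 * Real.pi * ξ| ≤ ‖lvar ε ξ‖ := by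
  rw [← lvar_im ε ξ]; exact Complex.abs_im_le_norm _

theorem lvar_ne_zero {ε : ℝ} (hε : 0 < ε) (ξ : ℝ) : lvar ε ξ ≠ 0 := fun h ↦ by
  have := lvar_re ε ξ; rw [h] at this; simp at this; linarith

theorem continuous_lvar (ε : ℝ) : Continuous (lvar ε) := by unfold lvar; fun_prop

theorem norm_cpow_neg (z : ℂ) (a : ℝ) : ‖z ^ (-a : ℂ)‖ = ‖z‖ ^ (-a) := by
  rw [← Complex.ofReal_neg, Complex.norm_cpow_real]

/-- In the right half-plane `|arg z| ≤ π/2`, so the argument of `z^{-a}` is at most `πa/2` in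
absolute value. The case `a = β` serves the energy inequality, and `a = 2β` the coercivity of `⟨L w,
R w⟩`. -/
theorem re_cpow_neg_ge {z : ℂ} (hz : 0 < z.re) {a : ℝ} (h0 : 0 ≤ a) (h1 : a ≤ 1) :
    Real.cos (Real.pi * a / 2) * ‖z‖ ^ (-a) ≤ (z ^ (-a : ℂ)).re := by
  have hz0 : z ≠ 0 := fun h ↦ by simp [h] at hz
  have harg := Complex.abs_arg_le_pi_div_two_iff.2 hz.le
  rw [← Complex.ofReal_neg, Complex.cpow_ofReal_re, mul_comm]
  refine mul_le_mul_of_nonneg_left ?_ (Real.rpow_nonneg (norm_nonneg _) _)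
  rw [mul_neg, Real.cos_neg, ← Real.cos_abs (z.arg * a), abs_mul, abs_of_nonneg h0]
  refine Real.cos_le_cos_of_nonneg_of_le_pi (by positivity) ?_ ?_
  · nlinarith [Real.pi_pos]
  · nlinarith

theorem norm_ft_dker {β ε : ℝ} (hβ : 0 < β) (hε : 0 < ε) (ξ : ℝ) :
    ‖ft (dker β ε) ξ‖ = ‖lvar ε ξ‖ ^ (-β) := by
  rw [ft_dker hβ hε]; exact norm_cpow_neg _ β

theorem rpow_neg_sq_mul_sq {a β : ℝ} (ha : 0 < a) : (a ^ (-β)) ^ 2 * a ^ 2 = (a ^ (1 - β)) ^ 2 := by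
  rw [← mul_pow]
  congr 1
  nth_rewrite 2 [← Real.rpow_one a]
  rw [← Real.rpow_add ha]
  congr 1
  ring

/-- Damping only decreases the weight because `|ε + iω| ≥ |ω|`. This gives bounds uniform in `ε` and
the majorant for `ε → 0`. -/
theorem norm_lvar_weight_le {β : ℝ} (hβ : 0 < β) (ε ξ : ℝ) :
    (‖lvar ε ξ‖ ^ (-β)) ^ 2 * |2 * Real.pi * ξ| ^ 2 ≤ (|2 * Real.pi * ξ| ^ (1 - β)) ^ 2 := by
  rcases (abs_nonneg (2 * Real.pi * ξ)).eq_or_lt with h | h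
  · rw [← h]; simp; positivity
  · rw [← rpow_neg_sq_mul_sq h]
    have h1 := abs_le_norm_lvar ε ξ
    have := Real.rpow_le_rpow_of_nonpos h h1 (neg_nonpos.2 hβ.le)
    gcongr

section

variable {β : ℝ} {w : ℝ → ℝ}

/-- Only the modulus of the damped symbol matters, so both one-sided kernels are covered. Enlarging
the domain from `(0,1)` to `ℝ` allows Plancherel before the damping is removed. -/
theorem IsTest.integral_conv_sq_le (hβ : 0 < β) (hβ1 : β ≤ 1) (hw : IsTest w) {k : ℕ → ℝ → ℝ}
    {k₀ : ℝ → ℝ} (hk : KernelApprox k k₀)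
    (hn : ∀ n ξ, ‖ft (k n) ξ‖ = ‖lvar (damp n) ξ‖ ^ (-β)) :
    ∫ x, conv k₀ (_root_.deriv w) x ^ 2 ∂vol01 ≤ semi (1 - β) w := by
  have hlim := hk.tendsto_integral hk hw.deriv
  simp_rw [← sq] at hlim
  refine le_of_tendsto' hlim fun n ↦ ?_
  set u := _root_.deriv w
  have hu : IsTest u := hw.deriv
  have hint : Integrable (fun x ↦ conv (k n) u x ^ 2) := by
    obtain ⟨C, hC⟩ := hu.exists_bound
    have h1 := integrable_conv (hk.integrable n) hu.integrable
    have h2 := h1.bdd_mul (c := (∫ t, |k n t|) * C)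
      (f := conv (k n) u) h1.aestronglyMeasurable (Eventually.of_forall fun x ↦ by
        rw [← integral_mul_const]
        refine (norm_integral_le_integral_norm _).trans (integral_mono_of_nonneg
          (Eventually.of_forall fun t ↦ norm_nonneg _)
          ((hk.integrable n).abs.mul_const C) (Eventually.of_forall fun t ↦ ?_))
        simp only [Real.norm_eq_abs, abs_mul]
        gcongr
        exact hC _)
    simpa only [sq] using h2
  refine (setIntegral_le_integral hint (Eventually.of_forall fun x ↦ sq_nonneg _)).trans ?_
  have := hu.integral_conv_mul_conv (hk.integrable n) (hk.integrable n)
  simp_rw [← Complex.normSq_eq_conj_mul_self, ← Complex.ofReal_mul, integral_complex_ofReal,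
    Complex.ofReal_inj, Complex.normSq_eq_norm_sq, ← sq] at this
  rw [this, semi]
  refine integral_mono_of_nonneg (Eventually.of_forall fun ξ ↦ by positivity)
    (hw.integrable_semi (by linarith) (by linarith)) (Eventually.of_forall fun ξ ↦ ?_)
  simp only
  rw [hn, hw.norm_ft_deriv, ← mul_assoc]
  exact mul_le_mul_of_nonneg_right (norm_lvar_weight_le hβ _ _) (sq_nonneg _)

theorem IsTest.integral_left_sq_le (hβ : 0 < β) (hβ1 : β ≤ 1) (hw : IsTest w) :
    ∫ x, conv (dker β 0) (_root_.deriv w) x ^ 2 ∂vol01 ≤ semi (1 - β) w :=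
  hw.integral_conv_sq_le hβ hβ1 (kernelApprox_dker hβ) fun n ξ ↦ norm_ft_dker hβ (damp_pos n) ξ

theorem IsTest.integral_right_sq_le (hβ : 0 < β) (hβ1 : β ≤ 1) (hw : IsTest w) :
    ∫ x, conv (rker β 0) (_root_.deriv w) x ^ 2 ∂vol01 ≤ semi (1 - β) w :=
  hw.integral_conv_sq_le hβ hβ1 (kernelApprox_rker hβ) fun n ξ ↦ by
    rw [← norm_ft_dker hβ (damp_pos n)]
    change ‖ft (fun t ↦ dker β (damp n) (-t)) ξ‖ = _
    rw [ft_comp_neg, RCLike.norm_conj]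

/-- The energy of the one-sided fractional integral. -/
theorem IsTest.energy_conv (hβ : 0 < β) (hβ1 : β ≤ 1) (hw : IsTest w) {k : ℕ → ℝ → ℝ}
    {k₀ : ℝ → ℝ} (hk : KernelApprox k k₀)
    (hn : ∀ n ξ, (ft (k n) ξ).re = (ft (dker β (damp n)) ξ).re) :
    Real.cos (Real.pi * β / 2) / 4 * ∫ x, w x ^ 2 ≤
      ∫ x, conv k₀ (_root_.deriv w) x * _root_.deriv w x ∂vol01 := by
  refine ge_of_tendsto' (hk.tendsto_integral_mul hw.deriv) fun n ↦ ?_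
  have hcos : 0 ≤ Real.cos (Real.pi * β / 2) := Real.cos_nonneg_of_mem_Icc
    ⟨by nlinarith [Real.pi_pos], by nlinarith [Real.pi_pos]⟩
  set u := _root_.deriv w with hudef
  have hu : IsTest u := hw.deriv
  rw [integral_vol01_eq (fun x hx ↦ by rw [hu.eq_zero hx, mul_zero])]
  have h1 := congrArg Complex.re (hu.integral_conv_mul (hk.integrable n))
  have hint : Integrable (fun ξ ↦ (starRingEnd ℂ) (ft (k n) ξ) * (‖ft u ξ‖ ^ 2 : ℝ)) := by
    refine hu.integrable_norm_ft_sq.ofReal.bdd_mul (c := ∫ t, |k n t|)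
      (f := fun ξ ↦ (starRingEnd ℂ) (ft (k n) ξ)) ?_ (Eventually.of_forall fun ξ ↦ ?_)
    · exact (Complex.continuous_conj.comp (continuous_ft (hk.integrable n))).aestronglyMeasurable
    · rw [RCLike.norm_conj]; exact norm_ft_le ξ
  have h2 := integral_re hint
  simp only [RCLike.re_eq_complex_re] at h2
  rw [Complex.ofReal_re, ← h2] at h1
  have hre : ∀ ξ, ((starRingEnd ℂ) (ft (k n) ξ) * ((‖ft u ξ‖ ^ 2 : ℝ) : ℂ)).re =
      (ft (dker β (damp n)) ξ).re * (|2 * Real.pi * ξ| ^ 2 * ‖ft w ξ‖ ^ 2) := by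
    intro ξ
    rw [Complex.re_mul_ofReal, Complex.conj_re, hn, hw.norm_ft_deriv]
  rw [h1]
  simp_rw [hre]
  have hreint := hint.re
  simp only [RCLike.re_eq_complex_re, hre] at hreint
  -- For `ε ≤ 1`, the modulus of the symbol is at least `1/(1+ω²)`. Multiplied by the `ω²` from
  -- `|ŵ'|²`, it leaves a weight independent of `ε` that is at least `1/2` for `|ω| ≥ 1`. The
  -- absorption of low frequencies with `c = 1/2` then gives the factor `1/4`.
  set m : ℝ → ℝ := fun ξ ↦ |2 * Real.pi * ξ| ^ 2 / (1 + |2 * Real.pi * ξ| ^ 2) with hm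
  have hmint : Integrable (fun ξ ↦ m ξ * ‖ft w ξ‖ ^ 2) := by
    refine hw.integrable_weight' (Continuous.aestronglyMeasurable ?_) fun ξ ↦ ?_
    · exact Continuous.div (by fun_prop) (by fun_prop) fun ξ ↦ by positivity
    · rw [abs_of_nonneg (by positivity), hm]
      simp only
      rw [div_le_iff₀ (by positivity)]
      nlinarith [sq_nonneg |2 * Real.pi * ξ|]
  have hP := hw.integral_sq_le (c := 1 / 2) (by norm_num) (m := m) (fun ξ ↦ by positivity)
    (fun ξ hξ ↦ by
      have := one_le_pow₀ (n := 2) hξ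
      simp only [hm]
      rw [le_div_iff₀ (by positivity)]
      linarith) hmint
  calc Real.cos (Real.pi * β / 2) / 4 * ∫ x, w x ^ 2
      ≤ Real.cos (Real.pi * β / 2) * ∫ ξ, m ξ * ‖ft w ξ‖ ^ 2 := by nlinarith
    _ = ∫ ξ, Real.cos (Real.pi * β / 2) * (m ξ * ‖ft w ξ‖ ^ 2) := (integral_const_mul _ _).symm
    _ ≤ _ := by
      refine integral_mono (hmint.const_mul _) hreint fun ξ ↦ ?_
      simp only
      have h3 : Real.cos (Real.pi * β / 2) * ‖lvar (damp n) ξ‖ ^ (-β) ≤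
          (ft (dker β (damp n)) ξ).re := by
        rw [ft_dker hβ (damp_pos n)]
        exact re_cpow_neg_ge (z := lvar (damp n) ξ) (by rw [lvar_re]; exact damp_pos n) hβ.le hβ1
      have h4 : 1 / (1 + |2 * Real.pi * ξ| ^ 2) ≤ ‖lvar (damp n) ξ‖ ^ (-β) := by
        have hpos : 0 < ‖lvar (damp n) ξ‖ := norm_pos_iff.2 (lvar_ne_zero (damp_pos n) ξ)
        rw [Real.rpow_neg hpos.le, ← one_div]
        refine one_div_le_one_div_of_le (by positivity) ?_
        have h5 : ‖lvar (damp n) ξ‖ ^ 2 ≤ 1 + |2 * Real.pi * ξ| ^ 2 := by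
          rw [← Complex.normSq_eq_norm_sq, Complex.normSq_apply, lvar_re, lvar_im, sq_abs]
          nlinarith [damp_pos n, damp_le_one n]
        rcases le_total ‖lvar (damp n) ξ‖ 1 with h | h
        · exact (Real.rpow_le_one hpos.le h hβ.le).trans (by nlinarith [sq_nonneg |2 * Real.pi * ξ|])
        · have := Real.rpow_le_rpow_of_exponent_le h hβ1
          rw [Real.rpow_one] at this
          nlinarith
      calc Real.cos (Real.pi * β / 2) * (m ξ * ‖ft w ξ‖ ^ 2)
          = Real.cos (Real.pi * β / 2) * (1 / (1 + |2 * Real.pi * ξ| ^ 2)) *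
            (|2 * Real.pi * ξ| ^ 2 * ‖ft w ξ‖ ^ 2) := by rw [hm]; ring
        _ ≤ Real.cos (Real.pi * β / 2) * ‖lvar (damp n) ξ‖ ^ (-β) *
            (|2 * Real.pi * ξ| ^ 2 * ‖ft w ξ‖ ^ 2) := by gcongr
        _ ≤ _ := by gcongr

theorem IsTest.energy_left (hβ : 0 < β) (hβ1 : β ≤ 1) (hw : IsTest w) :
    Real.cos (Real.pi * β / 2) / 4 * ∫ x, w x ^ 2 ≤
      ∫ x, conv (dker β 0) (_root_.deriv w) x * _root_.deriv w x ∂vol01 :=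
  hw.energy_conv hβ hβ1 (kernelApprox_dker hβ) fun _ _ ↦ rfl

theorem IsTest.energy_right (hβ : 0 < β) (hβ1 : β ≤ 1) (hw : IsTest w) :
    Real.cos (Real.pi * β / 2) / 4 * ∫ x, w x ^ 2 ≤
      ∫ x, conv (rker β 0) (_root_.deriv w) x * _root_.deriv w x ∂vol01 :=
  hw.energy_conv hβ hβ1 (kernelApprox_rker hβ) fun n ξ ↦ by
    change (ft (fun t ↦ dker β (damp n) (-t)) ξ).re = _
    rw [ft_comp_neg, Complex.conj_re]

theorem conv_dker_eq_zero {u : ℝ → ℝ} (hu : IsTest u) (ε : ℝ) {x : ℝ} (hx : x ≤ 0) :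
    conv (dker β ε) u x = 0 := by
  rw [conv, ← integral_zero ℝ ℝ (μ := volume)]
  refine integral_congr_ae (Eventually.of_forall fun t ↦ ?_)
  rcases le_or_gt t 0 with h | h
  · simp [dker_of_nonpos h]
  · simp only
    rw [hu.eq_zero (fun h' ↦ by linarith [h'.1]), mul_zero]

theorem conv_rker_eq_zero {u : ℝ → ℝ} (hu : IsTest u) (ε : ℝ) {x : ℝ} (hx : 1 ≤ x) :
    conv (rker β ε) u x = 0 := by
  rw [conv, ← integral_zero ℝ ℝ (μ := volume)]
  refine integral_congr_ae (Eventually.of_forall fun t ↦ ?_)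
  rcases le_or_gt 0 t with h | h
  · simp [rker, dker_of_nonpos (neg_nonpos.2 h)]
  · simp only
    rw [hu.eq_zero (fun h' ↦ by linarith [h'.2]), mul_zero]

/-- The left and right fractional derivatives have a coercive inner product. -/
theorem IsTest.left_right_coercive (hβ : 0 < β) (hβ' : β < 1 / 2) (hw : IsTest w) :
    Real.cos (Real.pi * β) * semi (1 - β) w ≤
      ∫ x, conv (dker β 0) (_root_.deriv w) x * conv (rker β 0) (_root_.deriv w) x ∂vol01 := by
  have hlim := (kernelApprox_dker hβ).tendsto_integral (kernelApprox_rker hβ) hw.deriv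
  have hcos : 0 ≤ Real.cos (Real.pi * β) := Real.cos_nonneg_of_mem_Icc
    ⟨by nlinarith [Real.pi_pos], by nlinarith [Real.pi_pos]⟩
  have hmeas : ∀ n, AEStronglyMeasurable (fun ξ ↦ (‖lvar (damp n) ξ‖ ^ (-β)) ^ 2 *
      |2 * Real.pi * ξ| ^ 2) := fun n ↦ by
    have := continuous_lvar (damp n)
    have h2 : Continuous fun ξ ↦ ‖lvar (damp n) ξ‖ ^ (-β) :=
      this.norm.rpow_const fun ξ ↦ Or.inl (norm_ne_zero_iff.2 (lvar_ne_zero (damp_pos n) ξ))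
    exact ((h2.pow 2).mul (by fun_prop)).aestronglyMeasurable
  have hlim2 : Tendsto (fun n ↦ Real.cos (Real.pi * β) *
      ∫ ξ, ((‖lvar (damp n) ξ‖ ^ (-β)) ^ 2 * |2 * Real.pi * ξ| ^ 2) * ‖ft w ξ‖ ^ 2) atTop
      (𝓝 (Real.cos (Real.pi * β) * semi (1 - β) w)) := by
    refine Tendsto.const_mul _ (tendsto_integral_of_dominated_convergence _ (fun n ↦ ?_)
      (hw.integrable_semi (μ := 1 - β) (by linarith) (by linarith)) (fun n ↦ ?_) ?_)
    · exact (hmeas n).mul hw.integrable_norm_ft_sq.aestronglyMeasurable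
    · refine Eventually.of_forall fun ξ ↦ ?_
      rw [Real.norm_of_nonneg (by positivity)]
      exact mul_le_mul_of_nonneg_right (norm_lvar_weight_le hβ _ _) (sq_nonneg _)
    · have : ∀ᵐ ξ : ℝ, ξ ≠ 0 := by simp [ae_iff]
      filter_upwards [this] with ξ hξ
      have hω : 0 < |2 * Real.pi * ξ| := abs_pos.2 (by positivity)
      rw [← rpow_neg_sq_mul_sq hω]
      refine Tendsto.mul_const _ (Tendsto.mul_const _ (Tendsto.pow ?_ 2))
      refine Tendsto.rpow_const ?_ (Or.inl hω.ne')
      have h1 : Tendsto (fun n ↦ ‖lvar (damp n) ξ‖) atTop (𝓝 ‖lvar 0 ξ‖) := by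
        refine Tendsto.norm ?_
        unfold lvar
        refine Tendsto.add_const _ ?_
        exact (Complex.continuous_ofReal.tendsto 0).comp tendsto_damp
      have h2 : ‖lvar 0 ξ‖ = |2 * Real.pi * ξ| := by
        simp [lvar, abs_mul]
      rwa [h2] at h1
  refine le_of_tendsto_of_tendsto' hlim2 hlim fun n ↦ ?_
  set u := _root_.deriv w with hudef
  have hu : IsTest u := hw.deriv
  have hk := (kernelApprox_dker hβ).integrable n
  have hl := (kernelApprox_rker hβ).integrable n
  -- The left convolution vanishes for `x ≤ 0` and the right one for `x ≥ 1`, so their product lives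
  -- on `(0,1)`. The inner product there is exactly one over `ℝ`, and Plancherel applies without
  -- loss.
  rw [integral_vol01_eq (fun x hx ↦ by
    rcases not_and_or.1 hx with h | h
    · rw [conv_dker_eq_zero hu _ (not_lt.1 h), zero_mul]
    · rw [conv_rker_eq_zero hu _ (not_lt.1 h), mul_zero])]
  have hint : Integrable (fun ξ ↦ (starRingEnd ℂ) (ft (dker β (damp n)) ξ) *
      ft (rker β (damp n)) ξ * (‖ft u ξ‖ ^ 2 : ℝ)) := by
    refine hu.integrable_norm_ft_sq.ofReal.bdd_mul
      (c := (∫ t, |dker β (damp n) t|) * (∫ t, |rker β (damp n) t|)) ?_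
      (Eventually.of_forall fun ξ ↦ ?_)
    · exact ((Complex.continuous_conj.comp (continuous_ft hk)).mul
        (continuous_ft hl)).aestronglyMeasurable
    · rw [norm_mul, RCLike.norm_conj]
      have := norm_ft_le (w := dker β (damp n)) ξ
      have := norm_ft_le (w := rker β (damp n)) ξ
      gcongr
  have h1 := congrArg Complex.re (hu.integral_conv_mul_conv hk hl)
  have h2 := integral_re hint
  simp only [RCLike.re_eq_complex_re] at h2
  rw [Complex.ofReal_re, ← h2] at h1
  rw [h1, ← integral_const_mul]
  refine integral_mono ((hw.integrable_weight' (hmeas n) fun ξ ↦ ?_).const_mul _) hint.re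
    fun ξ ↦ ?_
  · rw [abs_of_nonneg (by positivity)]
    exact (norm_lvar_weight_le hβ _ _).trans
      (sq_rpow_le (abs_nonneg _) (by linarith) (by linarith))
  -- The right symbol is the conjugate of the left one, so the cross product is the conjugate of the
  -- squared left symbol `(ε + iω)^{-2β}`. Its argument stays within `πβ`, whence the factor
  -- `cos(πβ)`.
  · have h3 : ft (rker β (damp n)) ξ = (starRingEnd ℂ) (ft (dker β (damp n)) ξ) :=
      ft_comp_neg _ ξ
    simp only
    rw [Complex.re_mul_ofReal, h3, ← map_mul, Complex.conj_re, hw.norm_ft_deriv]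
    have h4 : ft (dker β (damp n)) ξ * ft (dker β (damp n)) ξ =
        lvar (damp n) ξ ^ (-(2 * β : ℝ) : ℂ) := by
      rw [ft_dker hβ (damp_pos n)]
      change lvar (damp n) ξ ^ _ * lvar (damp n) ξ ^ _ = _
      rw [← Complex.cpow_add _ _ (lvar_ne_zero (damp_pos n) ξ)]
      congr 1
      push_cast; ring
    have h5 := re_cpow_neg_ge (z := lvar (damp n) ξ) (by rw [lvar_re]; exact damp_pos n)
      (a := 2 * β) (by linarith) (by linarith)
    rw [h4]
    have h6 : ‖lvar (damp n) ξ‖ ^ (-(2 * β)) = (‖lvar (damp n) ξ‖ ^ (-β)) ^ 2 := by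
      rw [← Real.rpow_natCast, ← Real.rpow_mul (norm_nonneg _)]
      congr 1; push_cast; ring
    rw [h6, show Real.pi * (2 * β) / 2 = Real.pi * β by ring] at h5
    calc _ = (Real.cos (Real.pi * β) * (‖lvar (damp n) ξ‖ ^ (-β)) ^ 2) *
          (|2 * Real.pi * ξ| ^ 2 * ‖ft w ξ‖ ^ 2) := by ring
      _ ≤ _ := by gcongr

end

/-! ### The du Bois-Reymond lemma -/

/-- The primitive from `-∞` vanishes to the left of the support, and the zero mean makes it vanish
to the right as well. -/
theorem IsTest.exists_antideriv {χ : ℝ → ℝ} (hχ : IsTest χ) (h0 : ∫ x, χ x = 0) :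
    ∃ ψ, IsTest ψ ∧ _root_.deriv ψ = χ := by
  obtain ⟨a, b, ha, hb, hab⟩ : ∃ a b : ℝ, 0 < a ∧ b < 1 ∧ tsupport χ ⊆ Icc a b := by
    have hK : IsCompact (tsupport χ) := hχ.2.1
    rcases (tsupport χ).eq_empty_or_nonempty with h | h
    · exact ⟨1 / 2, 1 / 2, by norm_num, by norm_num, by rw [h]; exact empty_subset _⟩
    · obtain ⟨a, ha, ha'⟩ := hK.exists_isLeast h
      obtain ⟨b, hb, hb'⟩ := hK.exists_isGreatest h
      exact ⟨a, b, (hχ.2.2 ha).1, (hχ.2.2 hb).2, fun x hx ↦ ⟨ha' hx, hb' hx⟩⟩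
  have hz : ∀ x ∉ Icc a b, χ x = 0 := fun x hx ↦
    image_eq_zero_of_notMem_tsupport fun h ↦ hx (hab h)
  set ψ : ℝ → ℝ := fun x ↦ ∫ t in Iic x, χ t with hψ
  have hψ' : ∀ x, HasDerivAt ψ (χ x) x := by
    intro x
    have h1 : ∀ y, ψ y = ∫ t in (0 : ℝ)..y, χ t := by
      intro y
      have h2 := intervalIntegral.integral_Iic_sub_Iic (a := 0) (b := y)
        hχ.integrable.integrableOn hχ.integrable.integrableOn
      have h3 : ∫ t in Iic (0 : ℝ), χ t = 0 := by
        refine setIntegral_eq_zero_of_forall_eq_zero fun t ht ↦ ?_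
        exact hχ.eq_zero fun h ↦ absurd h.1 (not_lt.2 ht)
      rw [h3, sub_zero] at h2
      exact h2
    have h4 : ψ = fun y ↦ ∫ t in (0 : ℝ)..y, χ t := funext h1
    rw [h4]
    exact intervalIntegral.integral_hasDerivAt_right
      (hχ.continuous.intervalIntegrable _ _)
      (hχ.continuous.stronglyMeasurableAtFilter _ _) hχ.continuous.continuousAt
  have hder : _root_.deriv ψ = χ := funext fun x ↦ (hψ' x).deriv
  have hsupp : Function.support ψ ⊆ Icc a b := by
    intro x hx
    by_contra h
    apply hx
    rcases not_and_or.1 h with h | h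
    · refine setIntegral_eq_zero_of_forall_eq_zero fun t ht ↦ hz t fun h' ↦ h ?_
      exact h'.1.trans ht
    · rw [← h0]
      refine setIntegral_eq_integral_of_forall_compl_eq_zero fun t ht ↦ hz t fun h' ↦ ?_
      exact h ((not_le.1 ht).le.trans h'.2)
  have hts : tsupport ψ ⊆ Icc a b := closure_minimal hsupp isClosed_Icc
  refine ⟨ψ, ⟨?_, HasCompactSupport.of_support_subset_isCompact isCompact_Icc hsupp,
    hts.trans (Icc_subset_Ioo ha hb)⟩, hder⟩
  exact contDiff_infty_iff_deriv.2 ⟨fun x ↦ (hψ' x).differentiableAt, by rw [hder]; exact hχ.1⟩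

theorem exists_isTest_integral_one : ∃ η, IsTest η ∧ ∫ x, η x = 1 := by
  let f : ContDiffBump (1 / 2 : ℝ) := ⟨1 / 8, 1 / 4, by norm_num, by norm_num⟩
  refine ⟨f.normed volume, ⟨f.contDiff_normed, f.hasCompactSupport_normed, ?_⟩, f.integral_normed⟩
  rw [f.tsupport_normed_eq]
  intro x hx
  rw [Metric.mem_closedBall, Real.dist_eq, abs_le] at hx
  have h1 : f.rOut = 1 / 4 := rfl
  rw [h1] at hx
  constructor <;> linarith [hx.1, hx.2]

theorem ae_eq_zero_of_integral_mul_test {f : ℝ → ℝ} (hf : Integrable f vol01)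
    (h : ∀ η, IsTest η → ∫ x, f x * η x ∂vol01 = 0) : f =ᵐ[vol01] 0 := by
  have hf' : IntegrableOn f (Ioo 0 1) := hf
  have := isOpen_Ioo.ae_eq_zero_of_integral_contDiff_smul_eq_zero hf'.locallyIntegrableOn
    fun g hg hgc hgs ↦ by
      have hgt : IsTest g := ⟨hg, hgc, hgs⟩
      rw [← integral_vol01_eq (f := fun x ↦ g x • f x)
        (fun x hx ↦ by simp [hgt.eq_zero hx]), ← h g hgt]
      simp only [smul_eq_mul, mul_comm]
  exact (ae_restrict_iff' measurableSet_Ioo).2 this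

/-- Subtracting `(∫ η) η₀`, with `∫ η₀ = 1`, turns any test function into the derivative of one. So
`f` minus its pairing with `η₀` is orthogonal to all test functions. -/
theorem ae_eq_const_of_integral_mul_deriv {f : ℝ → ℝ} (hf : Integrable f vol01)
    (h : ∀ η, IsTest η → ∫ x, f x * deriv η x ∂vol01 = 0) : ∃ c : ℝ, f =ᵐ[vol01] fun _ ↦ c := by
  obtain ⟨η₀, hη₀, hη₀1⟩ := exists_isTest_integral_one
  have hmul : ∀ {η : ℝ → ℝ}, IsTest η → Integrable (fun x ↦ f x * η x) vol01 := by
    intro η hη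
    obtain ⟨C, hC⟩ := hη.exists_bound
    exact hf.mul_bdd (c := C) hη.continuous.aestronglyMeasurable (Eventually.of_forall hC)
  set c := ∫ x, f x * η₀ x ∂vol01 with hc
  have := ae_eq_zero_of_integral_mul_test (f := fun x ↦ f x - c) (hf.sub (integrable_const _))
    fun η hη ↦ by
      set I := ∫ x, η x with hI
      have hχ : IsTest (η - I • η₀) := hη.sub (hη₀.smul _)
      obtain ⟨ψ, hψ, hd⟩ := hχ.exists_antideriv (by
        simp only [Pi.sub_apply, Pi.smul_apply, smul_eq_mul]
        rw [integral_sub hη.integrable (hη₀.integrable.const_mul _), integral_const_mul, hη₀1,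
          mul_one, sub_self])
      have h1 := h ψ hψ
      rw [hd] at h1
      have h2 : ∀ x, f x * (η - I • η₀) x = f x * η x - I * (f x * η₀ x) := fun x ↦ by
        simp only [Pi.sub_apply, Pi.smul_apply, smul_eq_mul]; ring
      simp_rw [h2] at h1
      rw [integral_sub (hmul hη) ((hmul hη₀).const_mul _), integral_const_mul, ← hc] at h1
      simp_rw [sub_mul]
      rw [integral_sub (hmul hη) ((hη.integrable.restrict).const_mul _), integral_const_mul,
        integral_vol01_eq (fun x hx ↦ hη.eq_zero hx), ← hI]
      linarith
  exact ⟨c, this.mono fun x hx ↦ sub_eq_zero.1 hx⟩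

/-! ### An annihilator of the range of the left fractional derivative -/

/-- `(1 - x)^{-β}` on `(0,1)`, extended by zero. -/
noncomputable def annih (β : ℝ) : ℝ → ℝ := (Ioo (0 : ℝ) 1).indicator fun x ↦ (1 - x) ^ (-β)

theorem annih_of_mem {β x : ℝ} (hx : x ∈ Ioo (0 : ℝ) 1) : annih β x = (1 - x) ^ (-β) :=
  indicator_of_mem hx _

theorem annih_of_notMem {β x : ℝ} (hx : x ∉ Ioo (0 : ℝ) 1) : annih β x = 0 :=
  indicator_of_notMem hx _

theorem measurable_annih (β : ℝ) : Measurable (annih β) :=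
  Measurable.indicator (by fun_prop) measurableSet_Ioo

/-- Square integrability at `x = 1` is the condition `2β < 1`. -/
theorem memLp_annih {β : ℝ} (hβ' : β < 1 / 2) : MemLp (annih β) 2 volume := by
  rw [memLp_two_iff_integrable_sq (measurable_annih β).aestronglyMeasurable]
  have h : (fun x ↦ annih β x ^ 2) =
      (Ioo (0 : ℝ) 1).indicator fun x ↦ (1 - x) ^ (-(2 * β)) := by
    ext x
    by_cases hx : x ∈ Ioo (0 : ℝ) 1
    · rw [annih_of_mem hx, indicator_of_mem hx, ← Real.rpow_natCast,
        ← Real.rpow_mul (by linarith [hx.2])]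
      congr 1; push_cast; ring
    · rw [annih_of_notMem hx, indicator_of_notMem hx]; simp
  rw [h, integrable_indicator_iff measurableSet_Ioo]
  have h1 : IntervalIntegrable (fun x : ℝ ↦ x ^ (-(2 * β))) volume 0 1 :=
    intervalIntegral.intervalIntegrable_rpow' (by linarith)
  have h2 := h1.comp_sub_left 1
  simp only [sub_zero, sub_self] at h2
  exact ((intervalIntegrable_iff_integrableOn_Ioo_of_le zero_le_one).1 h2.symm)

theorem integrable_annih {β : ℝ} (hβ' : β < 1 / 2) : Integrable (annih β) := by
  have h := ((memLp_annih hβ').restrict (Ioo 0 1)).integrable (by norm_num)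
  have h2 := (integrable_indicator_iff measurableSet_Ioo).2 h
  refine h2.congr (Eventually.of_forall fun x ↦ ?_)
  by_cases hx : x ∈ Ioo (0 : ℝ) 1
  · rw [indicator_of_mem hx]
  · rw [indicator_of_notMem hx, annih_of_notMem hx]

/-- The substitution `x = s + (1 - s)τ` maps `(0,1)` onto `(s,1)`, and the powers `-β` and `β - 1`
of `1 - s` combine with the Jacobian to cancel: a Beta integral free of `s`. -/
theorem annih_conv_const (β : ℝ) {s : ℝ} (hs : s ∈ Ioo (0 : ℝ) 1) :
    ∫ x, annih β x * dker β 0 (x - s) = ∫ x, annih β x * dker β 0 x := by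
  have h1s : 0 < 1 - s := by linarith [hs.2]
  have hpt : ∀ τ : ℝ, annih β ((1 - s) * τ + s) * dker β 0 ((1 - s) * τ + s - s) =
      (1 - s)⁻¹ * (annih β τ * dker β 0 τ) := by
    intro τ
    rw [add_sub_cancel_right]
    rcases le_or_gt τ 0 with h | h
    · rw [dker_of_nonpos h, dker_of_nonpos (mul_nonpos_of_nonneg_of_nonpos h1s.le h)]; simp
    · rcases le_or_gt 1 τ with h' | h'
      · rw [annih_of_notMem (fun h ↦ not_lt.2 h' h.2),
          annih_of_notMem (fun h ↦ by nlinarith [h.2])]; simp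
      · have hm : (1 - s) * τ + s ∈ Ioo (0 : ℝ) 1 :=
          ⟨by nlinarith [mul_pos h1s h, hs.1], by nlinarith⟩
        rw [annih_of_mem hm, annih_of_mem ⟨h, h'⟩, dker_of_pos h, dker_of_pos (mul_pos h1s h),
          show 1 - ((1 - s) * τ + s) = (1 - s) * (1 - τ) by ring,
          Real.mul_rpow h1s.le (by linarith), Real.mul_rpow h1s.le h.le]
        have : (1 - s) ^ (-β) * (1 - s) ^ (β - 1) = (1 - s)⁻¹ := by
          rw [← Real.rpow_add h1s, ← Real.rpow_neg_one]; congr 1; ring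
        rw [← this]
        simp
        ring
  have h := Measure.integral_comp_mul_left (fun y ↦ annih β (y + s) * dker β 0 (y + s - s)) (1 - s)
  simp_rw [hpt] at h
  rw [integral_const_mul, integral_add_right_eq_self (fun y ↦ annih β y * dker β 0 (y - s)),
    abs_of_pos (inv_pos.2 h1s), smul_eq_mul] at h
  exact (mul_left_cancel₀ (inv_pos.2 h1s).ne' h).symm

/-- After Fubini the adjoint of the left fractional integral acts on the annihilator and produces a
constant, which is paired with `w'`; the latter has mean zero. -/
theorem IsTest.integral_annih_mul_conv {β : ℝ} (hβ : 0 < β) (hβ' : β < 1 / 2) {w : ℝ → ℝ}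
    (hw : IsTest w) : ∫ x, annih β x * conv (dker β 0) (_root_.deriv w) x ∂vol01 = 0 := by
  set u := _root_.deriv w with hudef
  have hu : IsTest u := hw.deriv
  rw [integral_vol01_eq (fun x hx ↦ by rw [annih_of_notMem hx, zero_mul])]
  -- Only kernel arguments in `(-1,1)` occur. Truncating to `[0,1]` makes the kernel integrable, as
  -- Fubini requires.
  set k : ℝ → ℝ := fun t ↦ (Icc (0 : ℝ) 1).indicator (dker β 0) (-t) with hk
  have hkint : Integrable k := by
    have h1 : IntegrableOn (dker β 0) (Icc 0 1) :=
      (locallyIntegrable_dker hβ).integrableOn_isCompact isCompact_Icc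
    exact ((integrable_indicator_iff measurableSet_Icc).2 h1).comp_neg
  have hkeq : ∀ x ∈ Ioo (0 : ℝ) 1, ∀ s ∈ Ioo (0 : ℝ) 1, k (s - x) = dker β 0 (x - s) := by
    intro x hx s hs
    simp only [hk, neg_sub]
    by_cases h : x - s ∈ Icc (0 : ℝ) 1
    · rw [indicator_of_mem h]
    · rw [indicator_of_notMem h, dker_of_nonpos]
      by_contra! h'
      exact h ⟨h'.le, by linarith [hx.2, hs.1]⟩
  have hI : Integrable (fun p : ℝ × ℝ ↦ u p.1 * (annih β p.2 * k (p.1 - p.2)))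
      (volume.prod volume) := by
    obtain ⟨C, hC⟩ := hu.exists_bound
    have := (integrable_annih hβ').convolution_integrand (ContinuousLinearMap.mul ℝ ℝ) hkint
    exact this.bdd_mul (c := C) (hu.continuous.comp continuous_fst).aestronglyMeasurable
      (Eventually.of_forall fun p ↦ hC _)
  have hswap := integral_integral_swap (f := fun s x ↦ u s * (annih β x * k (s - x))) hI
  have h1 : ∀ x, annih β x * conv (dker β 0) u x = ∫ s, u s * (annih β x * k (s - x)) := by
    intro x
    by_cases hx : x ∈ Ioo (0 : ℝ) 1
    · rw [conv, ← integral_sub_left_eq_self (fun t ↦ dker β 0 t * u (x - t)) _ x,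
        ← integral_const_mul]
      refine integral_congr_ae (Eventually.of_forall fun s ↦ ?_)
      simp only [sub_sub_cancel]
      by_cases hs : s ∈ Ioo (0 : ℝ) 1
      · rw [hkeq x hx s hs]; ring
      · rw [hu.eq_zero hs]; ring
    · simp [annih_of_notMem hx]
  have h2 : ∀ s, ∫ x, u s * (annih β x * k (s - x)) =
      u s * ∫ x, annih β x * dker β 0 x := by
    intro s
    by_cases hs : s ∈ Ioo (0 : ℝ) 1
    · rw [integral_const_mul, ← annih_conv_const β hs]
      congr 1
      refine integral_congr_ae (Eventually.of_forall fun x ↦ ?_)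
      simp only
      by_cases hx : x ∈ Ioo (0 : ℝ) 1
      · rw [hkeq x hx s hs]
      · rw [annih_of_notMem hx, zero_mul, zero_mul]
    · simp [hu.eq_zero hs]
  simp_rw [h1]
  rw [← hswap]
  simp_rw [h2]
  rw [integral_mul_const]
  have h3 : ∫ s, u s = 0 := integral_eq_zero_of_hasDerivAt_of_integrable
    (fun x ↦ (hw.differentiable x).hasDerivAt) hu.integrable hw.integrable
  rw [h3, zero_mul]

/-! ### Fractional integrals as integrals against the kernel -/

theorem leftInt_eq (β : ℝ) (f : ℝ → ℝ) {x : ℝ} (hx : x ≤ 1) :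
    leftInt β f x = ∫ s, dker β 0 (x - s) * f s ∂vol01 := by
  rw [leftInt, ← integral_const_mul, ← integral_indicator measurableSet_Ioo,
    ← integral_indicator measurableSet_Ioo]
  refine integral_congr_ae (Eventually.of_forall fun s ↦ ?_)
  by_cases hs : s ∈ Ioo 0 x
  · rw [indicator_of_mem hs, indicator_of_mem (show s ∈ Ioo (0 : ℝ) 1 from ⟨hs.1, hs.2.trans_le hx⟩),
      dker_of_pos (sub_pos.2 hs.2), div_eq_mul_inv (f s),
      ← Real.rpow_neg (sub_pos.2 hs.2).le, neg_sub]
    simp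
    ring
  · rw [indicator_of_notMem hs]
    by_cases hs' : s ∈ Ioo (0 : ℝ) 1
    · rw [indicator_of_mem hs', dker_of_nonpos, zero_mul]
      by_contra! h
      exact hs ⟨hs'.1, sub_pos.1 h⟩
    · rw [indicator_of_notMem hs']

theorem rightInt_eq (β : ℝ) (f : ℝ → ℝ) {x : ℝ} (hx : 0 ≤ x) :
    rightInt β f x = ∫ s, rker β 0 (x - s) * f s ∂vol01 := by
  rw [rightInt, ← integral_const_mul, ← integral_indicator measurableSet_Ioo,
    ← integral_indicator measurableSet_Ioo]
  refine integral_congr_ae (Eventually.of_forall fun s ↦ ?_)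
  simp only [rker, neg_sub]
  by_cases hs : s ∈ Ioo x 1
  · rw [indicator_of_mem hs, indicator_of_mem (show s ∈ Ioo (0 : ℝ) 1 from ⟨hx.trans_lt hs.1, hs.2⟩),
      dker_of_pos (sub_pos.2 hs.1), div_eq_mul_inv (f s),
      ← Real.rpow_neg (sub_pos.2 hs.1).le, neg_sub]
    simp
    ring
  · rw [indicator_of_notMem hs]
    by_cases hs' : s ∈ Ioo (0 : ℝ) 1
    · rw [indicator_of_mem hs', dker_of_nonpos, zero_mul]
      by_contra! h
      exact hs ⟨sub_pos.1 h, hs'.2⟩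
    · rw [indicator_of_notMem hs']

theorem IsTest.conv_eq_vol01 {u : ℝ → ℝ} (hu : IsTest u) (k : ℝ → ℝ) (x : ℝ) :
    conv k u x = ∫ s, k (x - s) * u s ∂vol01 := by
  rw [integral_vol01_eq (fun s hs ↦ by rw [hu.eq_zero hs, mul_zero]), conv,
    ← integral_sub_left_eq_self (fun t ↦ k t * u (x - t)) _ x]
  simp only [sub_sub_cancel]

/-- The derivative of `I^β_θ w`, for a test function `w`. -/
noncomputable def fracDeriv (β θ : ℝ) (w : ℝ → ℝ) (x : ℝ) : ℝ :=
  θ * conv (dker β 0) (deriv w) x + (1 - θ) * conv (rker β 0) (deriv w) x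

theorem locallyIntegrable_rker {β : ℝ} (hβ : 0 < β) : LocallyIntegrable (rker β 0) :=
  (kernelApprox_rker hβ).locallyIntegrable

theorem IsTest.continuous_fracDeriv {β : ℝ} (hβ : 0 < β) (θ : ℝ) {w : ℝ → ℝ} (hw : IsTest w) :
    Continuous (fracDeriv β θ w) :=
  ((hw.deriv.continuous_conv (locallyIntegrable_dker hβ)).const_mul θ).add
    ((hw.deriv.continuous_conv (locallyIntegrable_rker hβ)).const_mul (1 - θ))

theorem IsTest.twoSidedInt_eq {β : ℝ} (hβ : 0 < β) (θ : ℝ) {w : ℝ → ℝ} (hw : IsTest w) {x : ℝ}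
    (hx : x ∈ Icc (0 : ℝ) 1) :
    twoSidedInt β θ w x = twoSidedInt β θ w 0 + ∫ t in (0 : ℝ)..x, fracDeriv β θ w t := by
  have h : ∀ y ∈ Icc (0 : ℝ) 1, twoSidedInt β θ w y =
      θ * conv (dker β 0) w y + (1 - θ) * conv (rker β 0) w y := by
    intro y hy
    rw [twoSidedInt, leftInt_eq β w hy.2, rightInt_eq β w hy.1, ← hw.conv_eq_vol01,
      ← hw.conv_eq_vol01]
  have hd : ∀ y, HasDerivAt (fun y ↦ θ * conv (dker β 0) w y + (1 - θ) * conv (rker β 0) w y)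
      (fracDeriv β θ w y) y := fun y ↦
    ((hw.hasDerivAt_conv (locallyIntegrable_dker hβ) y).const_mul θ).add
      ((hw.hasDerivAt_conv (locallyIntegrable_rker hβ) y).const_mul (1 - θ))
  rw [intervalIntegral.integral_eq_sub_of_hasDerivAt (fun y _ ↦ hd y)
    ((hw.continuous_fracDeriv hβ θ).intervalIntegrable _ _), h x hx, h 0 (by simp)]
  ring

/-! ### Maps into `L²(0,1)` -/

theorem memLp_vol01_of_continuous {f : ℝ → ℝ} (hf : Continuous f) : MemLp f 2 vol01 := by
  obtain ⟨C, hC⟩ := (isCompact_Icc (a := (0 : ℝ)) (b := 1)).exists_bound_of_continuousOn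
    hf.continuousOn
  refine MemLp.of_bound hf.aestronglyMeasurable C ?_
  filter_upwards [ae_restrict_mem measurableSet_Ioo] with x hx
  exact hC x (Ioo_subset_Icc_self hx)

theorem inner_toLp {f g : ℝ → ℝ} (hf : MemLp f 2 vol01) (hg : MemLp g 2 vol01) :
    ⟪hf.toLp f, hg.toLp g⟫ = ∫ x, f x * g x ∂vol01 := by
  rw [L2.inner_def]
  refine integral_congr_ae ?_
  filter_upwards [hf.coeFn_toLp, hg.coeFn_toLp] with x h1 h2
  rw [h1, h2]; simp [mul_comm]

theorem norm_toLp_sq {f : ℝ → ℝ} (hf : MemLp f 2 vol01) :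
    ‖hf.toLp f‖ ^ 2 = ∫ x, f x ^ 2 ∂vol01 := by
  rw [← real_inner_self_eq_norm_sq, inner_toLp]; simp only [sq]

/-- The linear map into `L²(0,1)` given by a linear operator on test functions with continuous
values. -/
noncomputable def l2Map (T : (ℝ → ℝ) → ℝ → ℝ) (hT : ∀ w, IsTest w → Continuous (T w))
    (hadd : ∀ u w, IsTest u → IsTest w → T (u + w) = T u + T w)
    (hsmul : ∀ (c : ℝ) w, IsTest w → T (c • w) = c • T w) : testSpace →ₗ[ℝ] Lp ℝ 2 vol01 where
  toFun w := (memLp_vol01_of_continuous (hT w w.2)).toLp (T w)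
  map_add' u w := by
    rw [← MemLp.toLp_add]
    congr 1
    exact hadd u w u.2 w.2
  map_smul' c w := by
    rw [RingHom.id_apply, ← MemLp.toLp_const_smul]
    congr 1
    exact hsmul c w w.2

theorem IsTest.deriv_add {u w : ℝ → ℝ} (hu : IsTest u) (hw : IsTest w) :
    _root_.deriv (u + w) = _root_.deriv u + _root_.deriv w :=
  funext fun x ↦ _root_.deriv_add (hu.differentiable x) (hw.differentiable x)

theorem IsTest.deriv_smul (c : ℝ) {w : ℝ → ℝ} (hw : IsTest w) :
    _root_.deriv (c • w) = c • _root_.deriv w :=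
  funext fun x ↦ deriv_const_smul c (hw.differentiable x)

theorem IsTest.conv_add {k u w : ℝ → ℝ} (hk : LocallyIntegrable k) (hu : IsTest u)
    (hw : IsTest w) : conv k (u + w) = conv k u + conv k w := by
  ext x
  simp only [conv, Pi.add_apply, mul_add]
  exact integral_add (hu.integrable_mul_comp_sub hk x) (hw.integrable_mul_comp_sub hk x)

theorem conv_smul (k : ℝ → ℝ) (c : ℝ) (u : ℝ → ℝ) : conv k (c • u) = c • conv k u := by
  ext x
  simp only [conv, Pi.smul_apply, smul_eq_mul, mul_left_comm _ c]
  exact integral_const_mul _ _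

/-- Convolution of the derivative with a locally integrable kernel, as a map into `L²(0,1)`. -/
noncomputable def convMap (k : ℝ → ℝ) (hk : LocallyIntegrable k) : testSpace →ₗ[ℝ] Lp ℝ 2 vol01 :=
  l2Map (fun w ↦ conv k (deriv w)) (fun _ hw ↦ hw.deriv.continuous_conv hk)
    (fun u w hu hw ↦ by rw [hu.deriv_add hw, hu.deriv.conv_add hk hw.deriv])
    (fun c w hw ↦ by rw [hw.deriv_smul, conv_smul])

noncomputable def derivMap : testSpace →ₗ[ℝ] Lp ℝ 2 vol01 :=
  l2Map deriv (fun _ hw ↦ hw.deriv.continuous) (fun _ _ hu hw ↦ hu.deriv_add hw)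
    (fun c _ hw ↦ hw.deriv_smul c)

noncomputable def inclMap : testSpace →ₗ[ℝ] Lp ℝ 2 vol01 :=
  l2Map id (fun _ hw ↦ hw.continuous) (fun _ _ _ _ ↦ rfl) (fun _ _ _ ↦ rfl)

theorem memLp_one : MemLp (fun _ : ℝ ↦ (1 : ℝ)) 2 vol01 := memLp_const 1

/-- The constant function `1` in `L²(0,1)`. -/
noncomputable def oneL2 : Lp ℝ 2 vol01 := memLp_one.toLp _

theorem norm_oneL2 : ‖oneL2‖ = 1 := by
  have := norm_toLp_sq memLp_one
  simp only [one_pow, integral_const, measureReal_restrict_apply_univ, Real.volume_real_Ioo] at this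
  rw [sub_zero, max_eq_left zero_le_one, one_smul] at this
  exact (pow_eq_one_iff_of_nonneg (norm_nonneg _) two_ne_zero).1 this

theorem integrable_coe (v : Lp ℝ 2 vol01) : Integrable v vol01 :=
  (Lp.memLp v).integrable (by norm_num)

theorem inner_l2Map {T : (ℝ → ℝ) → ℝ → ℝ} {hT : ∀ w, IsTest w → Continuous (T w)}
    {hadd : ∀ u w, IsTest u → IsTest w → T (u + w) = T u + T w}
    {hsmul : ∀ (c : ℝ) w, IsTest w → T (c • w) = c • T w} (v : Lp ℝ 2 vol01) (w : testSpace) :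
    ⟪v, l2Map T hT hadd hsmul w⟫ = ∫ x, v x * T w x ∂vol01 := by
  conv_lhs => rw [← Lp.toLp_coeFn v (Lp.memLp v)]
  exact inner_toLp (Lp.memLp v) (memLp_vol01_of_continuous (hT w w.2))

theorem derivMap_eq (w : testSpace) : derivMap w = (w.2.deriv.memLp_vol01 2).toLp _ := rfl

theorem inclMap_eq (w : testSpace) : inclMap w = (w.2.memLp_vol01 2).toLp _ := rfl

theorem inner_derivMap (v : Lp ℝ 2 vol01) (w : testSpace) :
    ⟪v, derivMap w⟫ = ∫ x, v x * deriv w x ∂vol01 := inner_l2Map v w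

theorem inner_inclMap (v : Lp ℝ 2 vol01) (w : testSpace) :
    ⟪v, inclMap w⟫ = ∫ x, v x * (w : ℝ → ℝ) x ∂vol01 := inner_l2Map v w

/-- By the du Bois-Reymond lemma the orthogonal complement of the derivatives consists of constants.
Taking the complement again gives the claim. -/
theorem mem_closure_range_derivMap {v : Lp ℝ 2 vol01} (hv : ⟪v, oneL2⟫ = 0) :
    v ∈ closure (range derivMap) := by
  set K : Submodule ℝ (Lp ℝ 2 vol01) := (LinearMap.range derivMap).topologicalClosure with hK
  have hKc : (K : Set (Lp ℝ 2 vol01)) = closure (range derivMap) := by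
    rw [hK, Submodule.topologicalClosure_coe, LinearMap.coe_range]
  have : CompleteSpace K := (Submodule.isClosed_topologicalClosure _).completeSpace_coe
  rw [← hKc, SetLike.mem_coe, ← Submodule.orthogonal_orthogonal K]
  intro z hz
  obtain ⟨c, hc⟩ := ae_eq_const_of_integral_mul_deriv (f := z) (integrable_coe z) fun η hη ↦ by
    have h1 : ⟪derivMap ⟨η, hη⟩, z⟫ = 0 := hz _ (Submodule.le_topologicalClosure _ ⟨_, rfl⟩)
    rw [real_inner_comm] at h1
    rw [← h1]
    exact (inner_derivMap z ⟨η, hη⟩).symm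
  have hz1 : z = c • oneL2 := by
    refine Lp.ext ?_
    filter_upwards [hc, Lp.coeFn_smul c oneL2, memLp_one.coeFn_toLp] with x h1 h2 h3
    rw [h1, h2, Pi.smul_apply, oneL2, h3, smul_eq_mul, mul_one]
  rw [hz1, inner_smul_left, real_inner_comm, hv, mul_zero]

/-! ### The fractional derivatives as operators into `L²(0,1)` -/

/-- The squared `H^μ` norm of a test function. -/
noncomputable def testSq (μ : ℝ) (w : ℝ → ℝ) : ℝ := (∫ x, w x ^ 2) + semi μ w

section

variable {β θ : ℝ}

noncomputable def leftMap (hβ : 0 < β) : testSpace →ₗ[ℝ] Lp ℝ 2 vol01 :=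
  convMap (dker β 0) (locallyIntegrable_dker hβ)

noncomputable def rightMap (hβ : 0 < β) : testSpace →ₗ[ℝ] Lp ℝ 2 vol01 :=
  convMap (rker β 0) (locallyIntegrable_rker hβ)

theorem IsTest.memLp_left (hβ : 0 < β) {w : ℝ → ℝ} (hw : IsTest w) :
    MemLp (conv (dker β 0) (_root_.deriv w)) 2 vol01 :=
  memLp_vol01_of_continuous (hw.deriv.continuous_conv (locallyIntegrable_dker hβ))

theorem IsTest.memLp_right (hβ : 0 < β) {w : ℝ → ℝ} (hw : IsTest w) :
    MemLp (conv (rker β 0) (_root_.deriv w)) 2 vol01 :=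
  memLp_vol01_of_continuous (hw.deriv.continuous_conv (locallyIntegrable_rker hβ))

theorem leftMap_eq (hβ : 0 < β) (w : testSpace) :
    leftMap hβ w = (w.2.memLp_left hβ).toLp _ := rfl

theorem rightMap_eq (hβ : 0 < β) (w : testSpace) :
    rightMap hβ w = (w.2.memLp_right hβ).toLp _ := rfl

theorem IsTest.memLp_fracDeriv (hβ : 0 < β) (θ : ℝ) {w : ℝ → ℝ} (hw : IsTest w) :
    MemLp (fracDeriv β θ w) 2 vol01 :=
  memLp_vol01_of_continuous (hw.continuous_fracDeriv hβ θ)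

theorem mixed_eq (hβ : 0 < β) (θ : ℝ) (w : testSpace) :
    mixed (leftMap hβ) (rightMap hβ) θ w = (w.2.memLp_fracDeriv hβ θ).toLp _ := by
  rw [mixed_apply, leftMap_eq, rightMap_eq, ← MemLp.toLp_const_smul, ← MemLp.toLp_const_smul, ← MemLp.toLp_add]
  rfl

theorem norm_leftMap_sq (hβ : 0 < β) (hβ1 : β ≤ 1) (w : testSpace) :
    ‖leftMap hβ w‖ ^ 2 ≤ testSq (1 - β) w := by
  rw [leftMap_eq, norm_toLp_sq]
  refine ((w.2.integral_left_sq_le hβ hβ1).trans ?_)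
  exact le_add_of_nonneg_left (integral_nonneg fun x ↦ sq_nonneg _)

theorem norm_rightMap_sq (hβ : 0 < β) (hβ1 : β ≤ 1) (w : testSpace) :
    ‖rightMap hβ w‖ ^ 2 ≤ testSq (1 - β) w := by
  rw [rightMap_eq, norm_toLp_sq]
  refine ((w.2.integral_right_sq_le hβ hβ1).trans ?_)
  exact le_add_of_nonneg_left (integral_nonneg fun x ↦ sq_nonneg _)

/-- The factor `1/3` passes from the seminorm to the full norm, since the `L²` part is at most twice
the squared seminorm. -/
theorem inner_leftMap_rightMap (hβ : 0 < β) (hβ' : β < 1 / 2) (w : testSpace) :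
    Real.cos (Real.pi * β) / 3 * testSq (1 - β) w ≤ ⟪leftMap hβ w, rightMap hβ w⟫ := by
  have h1 := w.2.left_right_coercive hβ hβ'
  have h2 := w.2.integral_sq_le_semi (μ := 1 - β) (by linarith) (by linarith)
  have hcos : 0 ≤ Real.cos (Real.pi * β) := Real.cos_nonneg_of_mem_Icc
    ⟨by nlinarith [Real.pi_pos], by nlinarith [Real.pi_pos]⟩
  rw [leftMap_eq, rightMap_eq, inner_toLp, testSq]
  nlinarith

theorem cos_pos_of_lt_half (hβ : 0 < β) (hβ' : β < 1 / 2) : 0 < Real.cos (Real.pi * β) :=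
  Real.cos_pos_of_mem_Ioo ⟨by nlinarith [Real.pi_pos], by nlinarith [Real.pi_pos]⟩

theorem not_denseRange_frac (hβ : 0 < β) (hβ' : β < 1 / 2) (h0 : 0 ≤ θ) (h1 : θ ≤ 1) :
    ¬ DenseRange (mixed (leftMap hβ) (rightMap hβ) θ) := by
  have hm : MemLp (annih β) 2 vol01 := (memLp_annih hβ').restrict _
  refine not_denseRange_mixed (γ := Real.cos (Real.pi * β) / 3)
    (by have := cos_pos_of_lt_half hβ hβ'; positivity)
    (norm_leftMap_sq hβ (by linarith)) (norm_rightMap_sq hβ (by linarith))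
    (inner_leftMap_rightMap hβ hβ') (v := hm.toLp _) (fun h ↦ ?_) (fun w ↦ ?_) h0 h1
  · have h1 := hm.coeFn_toLp
    rw [h] at h1
    have h2 : ∀ᵐ x ∂vol01, False := by
      filter_upwards [h1, Lp.coeFn_zero ℝ 2 vol01, ae_restrict_mem measurableSet_Ioo]
        with x h1 h2 h3
      rw [h2, annih_of_mem h3] at h1
      have := Real.rpow_pos_of_pos (show 0 < 1 - x by linarith [h3.2]) (-β)
      simp at h1
      linarith
    have h3 : vol01 = 0 := ae_eq_bot.1 (Filter.eventually_false_iff_eq_bot.1 h2)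
    have h4 := congrArg (fun μ : Measure ℝ ↦ μ univ) h3
    simp at h4
  · rw [leftMap_eq, inner_toLp]
    exact (w.2.integral_annih_mul_conv hβ hβ')

theorem dual_uniqueness (hβ : 0 < β) (hβ' : β < 1 / 2) (h0 : 0 ≤ θ) (h1 : θ ≤ 1)
    {v : Lp ℝ 2 vol01} (hv : ⟪v, oneL2⟫ = 0)
    (hvA : ∀ w, ⟪v, mixed (leftMap hβ) (rightMap hβ) θ w⟫ = 0) : v = 0 := by
  have hJn : ∀ w : testSpace, ‖inclMap w‖ ^ 2 = ∫ x, (w : ℝ → ℝ) x ^ 2 := fun w ↦ by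
    rw [inclMap_eq, norm_toLp_sq]
    exact integral_vol01_eq fun x hx ↦ by simp [w.2.eq_zero hx]
  have hDn : ∀ w : testSpace, ‖derivMap w‖ ^ 2 = ∫ x, deriv (w : ℝ → ℝ) x ^ 2 := fun w ↦ by
    rw [derivMap_eq, norm_toLp_sq]
    exact integral_vol01_eq fun x hx ↦ by simp [w.2.deriv.eq_zero hx]
  have hcos : 0 < Real.cos (Real.pi * β / 2) := Real.cos_pos_of_mem_Ioo
    ⟨by nlinarith [Real.pi_pos], by nlinarith [Real.pi_pos]⟩
  -- The constant `√5` comes from bounding the `L²` part by `2 ‖w'‖²` and the squared seminorm by `3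
  -- ‖w'‖²`.
  refine eq_zero_of_orthogonal (A := mixed (leftMap hβ) (rightMap hβ) θ) (D := derivMap)
    (J := inclMap) (C := √5) (c := Real.cos (Real.pi * β / 2) / 4) (by positivity)
    (fun w ↦ ?_) (fun w ↦ ?_) (fun w η ↦ ?_) (fun v h ↦ ?_)
    (fun v ↦ mem_closure_range_derivMap) hv hvA
  · refine (norm_mixed_le (norm_leftMap_sq hβ (by linarith)) (norm_rightMap_sq hβ (by linarith))
      h0 h1 w).trans ?_
    rw [← Real.sqrt_sq (norm_nonneg (derivMap w)), ← Real.sqrt_mul (by norm_num), hDn]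
    refine Real.sqrt_le_sqrt ?_
    have := w.2.integral_sq_le_deriv
    have := w.2.semi_le (μ := 1 - β) (by linarith) (by linarith)
    rw [testSq]; linarith
  · rw [hJn, mixed_apply, inner_add_left, inner_smul_left, inner_smul_left]
    have e1 := w.2.energy_left hβ (by linarith)
    have e2 := w.2.energy_right hβ (by linarith)
    rw [leftMap_eq, rightMap_eq, derivMap_eq, inner_toLp, inner_toLp]
    simp only [conj_trivial]
    nlinarith
  · have hw := w.2
    have hη := η.2
    rw [derivMap_eq, inclMap_eq, derivMap_eq, inclMap_eq, inner_toLp, inner_toLp, integral_vol01_eq (fun x hx ↦ by rw [hη.eq_zero hx, mul_zero]),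
      integral_vol01_eq (fun x hx ↦ by rw [hw.eq_zero hx, zero_mul])]
    have hmul : ∀ {f g : ℝ → ℝ}, IsTest f → IsTest g → Integrable (f * g) := fun {f g} hf hg ↦
      (hf.continuous.mul hg.continuous).integrable_of_hasCompactSupport hf.2.1.mul_right
    rw [integral_mul_deriv_eq_deriv_mul_of_integrable
      (fun x _ ↦ (hw.differentiable x).hasDerivAt) (fun x _ ↦ (hη.differentiable x).hasDerivAt)
      (hmul hw hη.deriv) (hmul hw.deriv hη) (hmul hw hη), neg_neg]
  · have := ae_eq_zero_of_integral_mul_test (f := v) (integrable_coe v) fun η hη ↦ by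
      rw [← h ⟨η, hη⟩]
      exact (inner_inclMap v ⟨η, hη⟩).symm
    exact (Lp.eq_zero_iff_ae_eq_zero).2 this

theorem bounded_below_frac (hβ : 0 < β) (hβ' : β < 1 / 2) (h0 : 0 ≤ θ) (h1 : θ ≤ 1) :
    (∃ κ : ℝ, 0 < κ ∧ ∀ (w : testSpace) (c : ℝ), κ * √(testSq (1 - β) w) ≤
        ‖mixed (leftMap hβ) (rightMap hβ) θ w - c • oneL2‖) ∧
      ∀ d : Lp ℝ 2 vol01, ∃ c : ℝ,
        d - c • oneL2 ∈ closure (range (mixed (leftMap hβ) (rightMap hβ) θ)) := by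
  have hcos := cos_pos_of_lt_half hβ hβ'
  exact bounded_below_mod_line (γ := Real.cos (Real.pi * β) / 3 / 2) (by positivity) norm_oneL2
    (q := fun w : testSpace ↦ testSq (1 - β) w)
    (le_norm_mixed (norm_leftMap_sq hβ (by linarith)) (norm_rightMap_sq hβ (by linarith))
      (inner_leftMap_rightMap hβ hβ') h0 h1)
    (not_denseRange_frac hβ hβ' h0 h1) (fun v ↦ dual_uniqueness hβ hβ' h0 h1)

theorem exists_test_deriv_near {v : ℝ → ℝ} (hv : MemLp v 2 vol01) (h0 : ∫ x, v x ∂vol01 = 0)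
    {ε : ℝ} (hε : 0 < ε) : ∃ w, IsTest w ∧ ∫ x, (v x - deriv w x) ^ 2 ∂vol01 < ε := by
  have h1 : hv.toLp v ∈ closure (range derivMap) := mem_closure_range_derivMap (by
    rw [oneL2, inner_toLp]; simpa using h0)
  obtain ⟨_, ⟨w, rfl⟩, hw⟩ := Metric.mem_closure_iff.1 h1 (√ε) (Real.sqrt_pos.2 hε)
  refine ⟨w, w.2, ?_⟩
  rw [dist_eq_norm] at hw
  rw [derivMap_eq, ← MemLp.toLp_sub, Real.lt_sqrt (norm_nonneg _), norm_toLp_sq] at hw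
  exact hw

theorem IsTest.integral_fracDeriv_sq_le (hβ : 0 < β) (hβ1 : β ≤ 1) (h0 : 0 ≤ θ) (h1 : θ ≤ 1)
    {w : ℝ → ℝ} (hw : IsTest w) :
    ∫ x, fracDeriv β θ w x ^ 2 ∂vol01 ≤ testSq (1 - β) w := by
  have h := norm_mixed_le (norm_leftMap_sq hβ hβ1) (norm_rightMap_sq hβ hβ1) h0 h1 ⟨w, hw⟩
  have hq : 0 ≤ testSq (1 - β) w := (sq_nonneg _).trans (norm_leftMap_sq hβ hβ1 ⟨w, hw⟩)
  rw [mixed_eq, Real.le_sqrt (norm_nonneg _) hq, norm_toLp_sq] at h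
  exact h

/-- The fractional derivative is bounded below modulo constants. -/
theorem exists_testSq_le (hβ : 0 < β) (hβ' : β < 1 / 2) (h0 : 0 ≤ θ) (h1 : θ ≤ 1) :
    ∃ κ : ℝ, 0 < κ ∧ ∀ w, IsTest w → ∀ c : ℝ,
      κ * testSq (1 - β) w ≤ ∫ x, (fracDeriv β θ w x - c) ^ 2 ∂vol01 := by
  obtain ⟨κ, hκ, h⟩ := (bounded_below_frac hβ hβ' h0 h1).1
  refine ⟨κ ^ 2, by positivity, fun w hw c ↦ ?_⟩
  have hq : 0 ≤ testSq (1 - β) w :=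
    (sq_nonneg _).trans (norm_leftMap_sq hβ (by linarith) ⟨w, hw⟩)
  have h2 := h ⟨w, hw⟩ c
  rw [mixed_eq, oneL2, ← MemLp.toLp_const_smul, ← MemLp.toLp_sub] at h2
  have h3 := pow_le_pow_left₀ (by positivity) h2 2
  rw [norm_toLp_sq, mul_pow, Real.sq_sqrt hq] at h3
  simpa using h3

/-- Every element of `L²(0,1)` is, modulo constants, a limit of fractional derivatives. -/
theorem exists_fracDeriv_near (hβ : 0 < β) (hβ' : β < 1 / 2) (h0 : 0 ≤ θ) (h1 : θ ≤ 1)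
    {d : ℝ → ℝ} (hd : MemLp d 2 vol01) : ∃ c : ℝ, ∀ ε > 0, ∃ w, IsTest w ∧
      ∫ x, (fracDeriv β θ w x - (d x - c)) ^ 2 ∂vol01 < ε := by
  obtain ⟨c, hc⟩ := (bounded_below_frac hβ hβ' h0 h1).2 (hd.toLp d)
  refine ⟨c, fun ε hε ↦ ?_⟩
  obtain ⟨_, ⟨w, rfl⟩, hw⟩ := Metric.mem_closure_iff.1 hc (√ε) (Real.sqrt_pos.2 hε)
  refine ⟨w, w.2, ?_⟩
  rw [dist_comm, dist_eq_norm, mixed_eq, oneL2, ← MemLp.toLp_const_smul, ← MemLp.toLp_sub,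
    ← MemLp.toLp_sub, Real.lt_sqrt (norm_nonneg _), norm_toLp_sq] at hw
  simpa using hw

end

/-! ### The Sobolev inequality for test functions -/

/-- The weight decays like `|ξ|^{-2μ}`, so `μ > 1/2` is what makes it integrable. -/
theorem integrable_sobolev_weight {μ : ℝ} (hμ : 1 / 2 < μ) (hμ1 : μ ≤ 1) :
    Integrable (fun ξ : ℝ ↦ (1 + (|2 * Real.pi * ξ| ^ μ) ^ 2)⁻¹) := by
  have h := integrable_one_add_norm (E := ℝ) (μ := volume) (r := 2 * μ) (by simp; linarith)
  refine (h.const_mul 4).mono (Measurable.aestronglyMeasurable (by fun_prop))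
    (Eventually.of_forall fun ξ ↦ ?_)
  rw [Real.norm_of_nonneg (by positivity), Real.norm_of_nonneg (by positivity),
    Real.rpow_neg (by positivity), ← div_eq_mul_inv, inv_eq_one_div,
    div_le_div_iff₀ (by positivity) (by positivity), one_mul, Real.norm_eq_abs]
  have h2 : (|2 * Real.pi * ξ| ^ μ) ^ 2 = |2 * Real.pi * ξ| ^ (2 * μ) := by
    rw [← Real.rpow_natCast, ← Real.rpow_mul (abs_nonneg _)]; congr 1; push_cast; ring
  rw [h2]
  have h4 : (2 : ℝ) ^ (2 * μ) ≤ 4 := by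
    calc (2 : ℝ) ^ (2 * μ) ≤ 2 ^ (2 : ℝ) :=
          Real.rpow_le_rpow_of_exponent_le one_le_two (by linarith)
      _ = 4 := by norm_num
  have hpi : |ξ| ≤ |2 * Real.pi * ξ| := by
    rw [abs_mul, abs_of_pos Real.two_pi_pos]
    nlinarith [Real.pi_gt_three, abs_nonneg ξ]
  have h5 : (0 : ℝ) ≤ |2 * Real.pi * ξ| ^ (2 * μ) := by positivity
  rcases le_total |ξ| 1 with h | h
  · calc (1 + |ξ|) ^ (2 * μ) ≤ 2 ^ (2 * μ) :=
          Real.rpow_le_rpow (by positivity) (by linarith) (by linarith)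
      _ ≤ _ := by linarith
  · calc (1 + |ξ|) ^ (2 * μ) ≤ (2 * |2 * Real.pi * ξ|) ^ (2 * μ) :=
          Real.rpow_le_rpow (by positivity) (by linarith) (by linarith)
      _ = 2 ^ (2 * μ) * |2 * Real.pi * ξ| ^ (2 * μ) := Real.mul_rpow (by norm_num) (by positivity)
      _ ≤ _ := by nlinarith

theorem IsTest.abs_le_integral_ft {w : ℝ → ℝ} (hw : IsTest w) (x : ℝ) :
    |w x| ≤ ∫ ξ, ‖ft w ξ‖ := by
  have hinv : 𝓕⁻ (ft w) = fun x ↦ (w x : ℂ) :=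
    Continuous.fourierInv_fourier_eq (Complex.continuous_ofReal.comp hw.continuous)
      hw.integrable.ofReal hw.integrable_ft
  have h1 := congrFun hinv x
  rw [Real.fourierInv_eq] at h1
  have h2 := norm_integral_le_integral_norm (μ := volume)
    (fun v ↦ Real.fourierChar (inner ℝ v x) • ft w v)
  rw [h1] at h2
  simpa [Complex.norm_real] using h2

theorem IsTest.exists_sobolev {μ : ℝ} (hμ : 1 / 2 < μ) (hμ1 : μ ≤ 1) :
    ∃ C : ℝ, 0 < C ∧ ∀ w, IsTest w → ∀ x, w x ^ 2 ≤ C * testSq μ w := by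
  set m : ℝ → ℝ := fun ξ ↦ 1 + (|2 * Real.pi * ξ| ^ μ) ^ 2 with hm
  have hm0 : ∀ ξ, 0 < m ξ := fun ξ ↦ by positivity
  have hmi : Integrable (fun ξ ↦ (m ξ)⁻¹) := integrable_sobolev_weight hμ hμ1
  set A := ∫ ξ, (m ξ)⁻¹ with hA
  have hA0 : 0 ≤ A := integral_nonneg fun ξ ↦ (inv_pos.2 (hm0 ξ)).le
  refine ⟨A + 1, by positivity, fun w hw x ↦ ?_⟩
  set I := ∫ ξ, ‖ft w ξ‖ with hI
  have hI0 : 0 ≤ I := integral_nonneg fun ξ ↦ norm_nonneg _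
  have h1 : w x ^ 2 ≤ I ^ 2 := by
    rw [← sq_abs]
    exact pow_le_pow_left₀ (abs_nonneg _) (hw.abs_le_integral_ft x) 2
  refine h1.trans ?_
  -- Integrating `2t|ŵ| ≤ t²/m + m|ŵ|²` gives `2tI ≤ t²A + Q`, with `Q` the squared norm; this `t`
  -- turns it into a bound for `I²`. Dividing by `A + 1` avoids having to show `A > 0`.
  set t := I / (A + 1) with ht
  have hQi : Integrable (fun ξ ↦ m ξ * ‖ft w ξ‖ ^ 2) := by
    simp only [hm, add_mul, one_mul]
    exact hw.integrable_norm_ft_sq.add (hw.integrable_semi (by linarith) hμ1)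
  have hQ : ∫ ξ, m ξ * ‖ft w ξ‖ ^ 2 = testSq μ w := by
    simp only [hm, add_mul, one_mul]
    rw [integral_add hw.integrable_norm_ft_sq (hw.integrable_semi (by linarith) hμ1),
      hw.integral_norm_ft_sq]
    rfl
  have h2 := integral_mono ((hw.integrable_ft.norm).const_mul (2 * t))
    ((hmi.const_mul (t ^ 2)).add hQi) (fun ξ ↦ by
      simp only [Pi.add_apply]
      have e : t ^ 2 * (m ξ)⁻¹ + m ξ * ‖ft w ξ‖ ^ 2 - 2 * t * ‖ft w ξ‖ =
          (m ξ)⁻¹ * (t - m ξ * ‖ft w ξ‖) ^ 2 := by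
        field_simp [(hm0 ξ).ne']
        ring
      have := mul_nonneg (inv_pos.2 (hm0 ξ)).le (sq_nonneg (t - m ξ * ‖ft w ξ‖))
      linarith)
  rw [integral_add' (hmi.const_mul (t ^ 2)) hQi, integral_const_mul, integral_const_mul,
    hQ, ← hI, ← hA] at h2
  have hIt : I = t * (A + 1) := by rw [ht]; field_simp
  rw [hIt] at h2 ⊢
  have h3 : 0 ≤ t := by positivity
  nlinarith [sq_nonneg t]

/-! ### The space `H^μ₀(0,1)` -/

/-- The squared `H^μ` norm. -/
noncomputable def hSq (μ : ℝ) (φ : ℝ → ℝ) : ℝ :=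
  (∫ x, φ x ^ 2 ∂vol01) + ∫ ξ, fourierWeight μ φ ξ ^ 2

theorem hNorm_eq (μ : ℝ) (φ : ℝ → ℝ) : hNorm μ φ = √(hSq μ φ) := rfl

theorem hSq_nonneg (μ : ℝ) (φ : ℝ → ℝ) : 0 ≤ hSq μ φ :=
  add_nonneg (integral_nonneg fun _ ↦ sq_nonneg _) (integral_nonneg fun _ ↦ sq_nonneg _)

theorem fourierWeight_eq (μ : ℝ) (φ : ℝ → ℝ) (ξ : ℝ) :
    fourierWeight μ φ ξ = |2 * Real.pi * ξ| ^ μ * ‖ft (zeroExt φ) ξ‖ := rfl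

theorem IsTest.hSq_eq {w : ℝ → ℝ} (hw : IsTest w) (μ : ℝ) : hSq μ w = testSq μ w := by
  rw [hSq, testSq, integral_vol01_eq (fun x hx ↦ by simp [hw.eq_zero hx]), semi]
  simp only [fourierWeight_eq, hw.zeroExt_eq, mul_pow]

theorem integrable_zeroExt {φ : ℝ → ℝ} (hφ : MemLp φ 2 vol01) : Integrable (zeroExt φ) :=
  (integrable_indicator_iff measurableSet_Ioo).2 (hφ.integrable (by norm_num))

/-- Functions of finite `H^μ` norm. -/
def FinNorm (μ : ℝ) (φ : ℝ → ℝ) : Prop :=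
  MemLp φ 2 vol01 ∧ MemLp (fourierWeight μ φ) 2 volume

theorem measurable_fourierWeight (μ : ℝ) {φ : ℝ → ℝ} (hφ : MemLp φ 2 vol01) :
    Measurable (fourierWeight μ φ) := by
  have := (continuous_ft (integrable_zeroExt hφ)).norm.measurable
  have h2 : Measurable fun ξ : ℝ ↦ |2 * Real.pi * ξ| ^ μ := by fun_prop
  exact h2.mul this

theorem IsTest.finNorm {w : ℝ → ℝ} (hw : IsTest w) {μ : ℝ} (h0 : 0 ≤ μ) (h1 : μ ≤ 1) :
    FinNorm μ w := by
  refine ⟨hw.memLp_vol01 2, ?_⟩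
  rw [memLp_two_iff_integrable_sq
    (measurable_fourierWeight μ (hw.memLp_vol01 2)).aestronglyMeasurable]
  simp only [fourierWeight_eq, hw.zeroExt_eq, mul_pow]
  exact hw.integrable_semi h0 h1

theorem ft_sub {f g : ℝ → ℝ} (hf : Integrable f) (hg : Integrable g) (ξ : ℝ) :
    ft (f - g) ξ = ft f ξ - ft g ξ := by
  rw [ft_apply, ft_apply, ft_apply, Real.fourier_eq, Real.fourier_eq, Real.fourier_eq,
    ← integral_sub ((Real.fourierIntegral_convergent_iff ξ).2 hf.ofReal)
      ((Real.fourierIntegral_convergent_iff ξ).2 hg.ofReal)]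
  simp only [Pi.sub_apply, Complex.ofReal_sub, smul_sub]

theorem zeroExt_sub (f g : ℝ → ℝ) : zeroExt (f - g) = zeroExt f - zeroExt g :=
  indicator_sub' _ _ _

theorem fourierWeight_sub_le (μ : ℝ) {f g : ℝ → ℝ} (hf : MemLp f 2 vol01) (hg : MemLp g 2 vol01)
    (ξ : ℝ) : fourierWeight μ (f - g) ξ ≤ fourierWeight μ f ξ + fourierWeight μ g ξ := by
  rw [fourierWeight_eq, fourierWeight_eq, fourierWeight_eq, zeroExt_sub,
    ft_sub (integrable_zeroExt hf) (integrable_zeroExt hg), ← mul_add]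
  gcongr
  exact norm_sub_le _ _

theorem fourierWeight_nonneg (μ : ℝ) (f : ℝ → ℝ) (ξ : ℝ) : 0 ≤ fourierWeight μ f ξ := by
  rw [fourierWeight_eq]; positivity

theorem FinNorm.sub {μ : ℝ} {f g : ℝ → ℝ} (hf : FinNorm μ f) (hg : FinNorm μ g) :
    FinNorm μ (f - g) := by
  refine ⟨hf.1.sub hg.1, (hf.2.add hg.2).mono
    (measurable_fourierWeight μ (hf.1.sub hg.1)).aestronglyMeasurable
    (Eventually.of_forall fun ξ ↦ ?_)⟩
  have h1 := fourierWeight_nonneg μ f ξ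
  have h2 := fourierWeight_nonneg μ g ξ
  rw [Real.norm_of_nonneg (fourierWeight_nonneg _ _ _), Pi.add_apply,
    Real.norm_of_nonneg (add_nonneg h1 h2)]
  exact fourierWeight_sub_le μ hf.1 hg.1 ξ

theorem integral_sub_sq_le {m : Measure ℝ} {f g : ℝ → ℝ} (hf : MemLp f 2 m) (hg : MemLp g 2 m) :
    ∫ x, (f x - g x) ^ 2 ∂m ≤ 2 * (∫ x, f x ^ 2 ∂m) + 2 * ∫ x, g x ^ 2 ∂m := by
  rw [← integral_const_mul, ← integral_const_mul,
    ← integral_add (hf.integrable_sq.const_mul 2) (hg.integrable_sq.const_mul 2)]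
  refine integral_mono (hf.sub hg).integrable_sq
    ((hf.integrable_sq.const_mul 2).add (hg.integrable_sq.const_mul 2)) fun x ↦ ?_
  simp only
  nlinarith [sq_nonneg (f x + g x)]

/-- A triangle inequality with a factor `2`, by `(a + b)² ≤ 2a² + 2b²`. Working with squared norms
avoids square roots in the later limits. -/
theorem hSq_sub_le {μ : ℝ} {f g : ℝ → ℝ} (hf : FinNorm μ f) (hg : FinNorm μ g) :
    hSq μ (f - g) ≤ 2 * hSq μ f + 2 * hSq μ g := by
  have h1 := integral_sub_sq_le hf.1 hg.1
  have h2 : ∫ ξ, fourierWeight μ (f - g) ξ ^ 2 ≤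
      2 * (∫ ξ, fourierWeight μ f ξ ^ 2) + 2 * ∫ ξ, fourierWeight μ g ξ ^ 2 := by
    rw [← integral_const_mul, ← integral_const_mul, ← integral_add
      (hf.2.integrable_sq.const_mul 2) (hg.2.integrable_sq.const_mul 2)]
    refine integral_mono (hf.sub hg).2.integrable_sq
      ((hf.2.integrable_sq.const_mul 2).add (hg.2.integrable_sq.const_mul 2)) fun ξ ↦ ?_
    have e1 := fourierWeight_sub_le μ hf.1 hg.1 ξ
    have e2 := fourierWeight_nonneg μ (f - g) ξ
    simp only
    nlinarith [sq_nonneg (fourierWeight μ f ξ - fourierWeight μ g ξ)]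
  rw [hSq, hSq, hSq]
  simp only [Pi.sub_apply]
  linarith

/-! ### Approximating sequences and completeness of `H^μ₀` -/

/-- `w` is a sequence of test functions converging to `φ` in the `H^μ` norm. -/
structure Approx (μ : ℝ) (φ : ℝ → ℝ) (w : ℕ → ℝ → ℝ) : Prop where
  finNorm : FinNorm μ φ
  isTest : ∀ n, IsTest (w n)
  tendsto : Tendsto (fun n ↦ hSq μ (φ - w n)) atTop (𝓝 0)

theorem MemH0.exists_approx {μ : ℝ} {φ : ℝ → ℝ} (h : MemH0 μ φ) : ∃ w, Approx μ φ w := by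
  choose w hw hlt using fun n : ℕ ↦ h.2.2 (damp n) (damp_pos n)
  refine ⟨w, ⟨h.1, h.2.1⟩, hw, ?_⟩
  have h1 : ∀ n, hSq μ (φ - w n) ≤ damp n ^ 2 := fun n ↦
    (Real.sqrt_le_left (damp_pos n).le).1 (hlt n).le
  refine squeeze_zero (fun n ↦ hSq_nonneg _ _) h1 ?_
  simpa using tendsto_damp.pow 2

theorem Approx.memH0 {μ : ℝ} {φ : ℝ → ℝ} {w : ℕ → ℝ → ℝ} (h : Approx μ φ w) : MemH0 μ φ := by
  refine ⟨h.finNorm.1, h.finNorm.2, fun ε hε ↦ ?_⟩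
  obtain ⟨n, hn⟩ := (h.tendsto.eventually (gt_mem_nhds (show 0 < ε ^ 2 by positivity))).exists
  refine ⟨w n, h.isTest n, ?_⟩
  exact (Real.sqrt_lt' hε).2 hn

section

variable {μ : ℝ} {φ : ℝ → ℝ} {w : ℕ → ℝ → ℝ}

theorem Approx.finNorm_sub (h : Approx μ φ w) (h0 : 0 ≤ μ) (h1 : μ ≤ 1) (n : ℕ) :
    FinNorm μ (φ - w n) := h.finNorm.sub ((h.isTest n).finNorm h0 h1)

theorem Approx.testSq_sub_le (h : Approx μ φ w) (h0 : 0 ≤ μ) (h1 : μ ≤ 1) (n m : ℕ) :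
    testSq μ (w n - w m) ≤ 2 * hSq μ (φ - w n) + 2 * hSq μ (φ - w m) := by
  have h2 := hSq_sub_le (h.finNorm_sub h0 h1 m) (h.finNorm_sub h0 h1 n)
  rw [sub_sub_sub_cancel_left, ((h.isTest n).sub (h.isTest m)).hSq_eq] at h2
  linarith

theorem Approx.testSq_le (h : Approx μ φ w) (h0 : 0 ≤ μ) (h1 : μ ≤ 1) (n : ℕ) :
    testSq μ (w n) ≤ 2 * hSq μ φ + 2 * hSq μ (φ - w n) := by
  have h2 := hSq_sub_le h.finNorm (h.finNorm_sub h0 h1 n)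
  rwa [sub_sub_cancel, (h.isTest n).hSq_eq] at h2

theorem Approx.hSq_le (h : Approx μ φ w) (h0 : 0 ≤ μ) (h1 : μ ≤ 1) (n : ℕ) :
    hSq μ φ ≤ 2 * testSq μ (w n) + 2 * hSq μ (φ - w n) := by
  have hz : FinNorm μ (0 : ℝ → ℝ) := isTest_zero.finNorm h0 h1
  have h2 := hSq_sub_le (h.finNorm_sub h0 h1 n) (hz.sub ((h.isTest n).finNorm h0 h1))
  -- The function is written as a difference whose second term is `0 - w n`, so that the estimate
  -- for differences yields one for a sum.
  have e : φ - w n - (0 - w n) = φ := by abel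
  have e2 : hSq μ (0 - w n) = testSq μ (w n) := by
    have ht : IsTest (0 - w n) := isTest_zero.sub (h.isTest n)
    have e3 : ft (0 - w n) = fun ξ ↦ -ft (w n) ξ := by
      ext ξ
      rw [ft_sub isTest_zero.integrable (h.isTest n).integrable]
      have : ft 0 ξ = 0 := by
        rw [ft_apply, Real.fourier_eq]; simp
      rw [this, zero_sub]
    rw [ht.hSq_eq, testSq, testSq, semi, semi, e3]
    simp
  rw [e, e2] at h2
  linarith

theorem tendsto_toLp_of_integral_sq {f : ℕ → ℝ → ℝ} {g : ℝ → ℝ} (hf : ∀ n, MemLp (f n) 2 vol01)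
    (hg : MemLp g 2 vol01) (h : Tendsto (fun n ↦ ∫ x, (g x - f n x) ^ 2 ∂vol01) atTop (𝓝 0)) :
    Tendsto (fun n ↦ (hf n).toLp (f n)) atTop (𝓝 (hg.toLp g)) := by
  rw [tendsto_iff_norm_sub_tendsto_zero]
  have h1 : ∀ n, ‖(hf n).toLp (f n) - hg.toLp g‖ = √(∫ x, (g x - f n x) ^ 2 ∂vol01) := by
    intro n
    rw [norm_sub_rev, ← MemLp.toLp_sub, ← Real.sqrt_sq (norm_nonneg _), norm_toLp_sq]
    rfl
  simp_rw [h1]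
  simpa using h.sqrt

theorem Approx.tendsto_integral_sq (h : Approx μ φ w) :
    Tendsto (fun n ↦ ∫ x, (φ x - w n x) ^ 2 ∂vol01) atTop (𝓝 0) :=
  squeeze_zero (fun _ ↦ integral_nonneg fun _ ↦ sq_nonneg _)
    (fun _ ↦ le_add_of_nonneg_right (integral_nonneg fun _ ↦ sq_nonneg _)) h.tendsto

theorem exists_subseq_tendsto_ae {f : ℕ → ℝ → ℝ} {g : ℝ → ℝ} (hf : ∀ n, MemLp (f n) 2 vol01)
    (hg : MemLp g 2 vol01) (h : Tendsto (fun n ↦ ∫ x, (g x - f n x) ^ 2 ∂vol01) atTop (𝓝 0)) :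
    ∃ ns : ℕ → ℕ, StrictMono ns ∧
      ∀ᵐ x ∂vol01, Tendsto (fun i ↦ f (ns i) x) atTop (𝓝 (g x)) := by
  have h1 := tendsto_toLp_of_integral_sq hf hg h
  obtain ⟨ns, hns, hae⟩ := (tendstoInMeasure_of_tendsto_Lp h1).exists_seq_tendsto_ae
  refine ⟨ns, hns, ?_⟩
  have h2 : ∀ᵐ x ∂vol01, ∀ n, (hf n).toLp (f n) x = f n x :=
    ae_all_iff.2 fun n ↦ (hf n).coeFn_toLp
  filter_upwards [hae, h2, hg.coeFn_toLp] with x e1 e2 e3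
  simpa only [e2, e3] using e1

/-- The Sobolev inequality on `H^μ₀(0,1)`, for the approximation errors. -/
theorem Approx.ae_sub_sq_le (h : Approx μ φ w) (h0 : 1 / 2 < μ) (h1 : μ ≤ 1) {C : ℝ}
    (hC : ∀ w, IsTest w → ∀ x, w x ^ 2 ≤ C * testSq μ w) (hC0 : 0 < C) :
    ∀ᵐ x ∂vol01, ∀ n, (φ x - w n x) ^ 2 ≤ C * (2 * hSq μ (φ - w n)) := by
  obtain ⟨ns, hns, hae⟩ := exists_subseq_tendsto_ae (fun n ↦ (h.isTest n).memLp_vol01 2)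
    h.finNorm.1 h.tendsto_integral_sq
  filter_upwards [hae] with x hx n
  have e1 : Tendsto (fun i ↦ (w (ns i) x - w n x) ^ 2) atTop (𝓝 ((φ x - w n x) ^ 2)) :=
    (hx.sub_const _).pow 2
  have e2 : Tendsto (fun i ↦ C * (2 * hSq μ (φ - w (ns i)) + 2 * hSq μ (φ - w n))) atTop
      (𝓝 (C * (2 * 0 + 2 * hSq μ (φ - w n)))) :=
    (((h.tendsto.comp hns.tendsto_atTop).const_mul 2).add_const _).const_mul C
  rw [mul_zero, zero_add] at e2
  refine le_of_tendsto_of_tendsto' e1 e2 fun i ↦ ?_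
  exact (hC _ ((h.isTest _).sub (h.isTest n)) x).trans
    (mul_le_mul_of_nonneg_left (h.testSq_sub_le (by linarith) h1 _ _) hC0.le)

/-- The Sobolev inequality turns convergence in norm into almost everywhere convergence of the whole
sequence together with a uniform bound. -/
theorem Approx.ae_tendsto_and_bound (h : Approx μ φ w) (h0 : 1 / 2 < μ) (h1 : μ ≤ 1) :
    (∀ᵐ x ∂vol01, Tendsto (fun n ↦ w n x) atTop (𝓝 (φ x))) ∧ ∃ M, ∀ n x, |w n x| ≤ M := by
  obtain ⟨C, hC0, hC⟩ := IsTest.exists_sobolev h0 h1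
  constructor
  · filter_upwards [h.ae_sub_sq_le h0 h1 hC hC0] with x hx
    have e1 : Tendsto (fun n ↦ C * (2 * hSq μ (φ - w n))) atTop (𝓝 0) := by
      simpa using (h.tendsto.const_mul 2).const_mul C
    have e2 := (squeeze_zero (fun n ↦ sq_nonneg _) hx e1).sqrt
    simp only [Real.sqrt_sq_eq_abs, Real.sqrt_zero] at e2
    rw [tendsto_iff_norm_sub_tendsto_zero]
    simpa only [Real.norm_eq_abs, abs_sub_comm] using e2
  · obtain ⟨B, hB⟩ := h.tendsto.bddAbove_range
    refine ⟨√(C * (2 * hSq μ φ + 2 * B)), fun n x ↦ Real.abs_le_sqrt ?_⟩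
    refine (hC _ (h.isTest n) x).trans (mul_le_mul_of_nonneg_left ?_ hC0.le)
    have := h.testSq_le (by linarith) h1 n
    have := hB ⟨n, rfl⟩
    simp only at this
    linarith

/-- For `β < 1/2` the kernel `t^{β-1}` is integrable but not square integrable near `0`, so
convergence in `L²` is not enough. The uniform bound supplies the majorant. -/
theorem Approx.tendsto_integral_mul (h : Approx μ φ w) (h0 : 1 / 2 < μ) (h1 : μ ≤ 1) {k : ℝ → ℝ}
    (hk : Integrable k vol01) :
    Tendsto (fun n ↦ ∫ s, k s * w n s ∂vol01) atTop (𝓝 (∫ s, k s * φ s ∂vol01)) := by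
  obtain ⟨hae, M, hM⟩ := h.ae_tendsto_and_bound h0 h1
  refine tendsto_integral_of_dominated_convergence (fun s ↦ |k s| * M) (fun n ↦ ?_)
    (hk.abs.mul_const M) (fun n ↦ Eventually.of_forall fun s ↦ ?_) ?_
  · exact hk.aestronglyMeasurable.mul (h.isTest n).continuous.aestronglyMeasurable
  · rw [Real.norm_eq_abs, abs_mul]
    exact mul_le_mul_of_nonneg_left (hM n s) (abs_nonneg _)
  · filter_upwards [hae] with s hs using hs.const_mul _

theorem integrable_comp_sub_vol01 {k : ℝ → ℝ} (hk : LocallyIntegrable k) (x : ℝ) :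
    Integrable (fun s ↦ k (x - s)) vol01 := by
  have h1 : IntervalIntegrable k volume (x - 0) (x - 1) :=
    (hk.integrableOn_isCompact isCompact_uIcc).intervalIntegrable
  have h2 := h1.comp_sub_left x
  simp only [sub_sub_cancel] at h2
  exact (intervalIntegrable_iff_integrableOn_Ioo_of_le zero_le_one).1 h2

theorem Approx.tendsto_twoSidedInt (h : Approx μ φ w) (h0 : 1 / 2 < μ) (h1 : μ ≤ 1) {β : ℝ}
    (hβ : 0 < β) (θ : ℝ) {x : ℝ} (hx : x ∈ Icc (0 : ℝ) 1) :
    Tendsto (fun n ↦ twoSidedInt β θ (w n) x) atTop (𝓝 (twoSidedInt β θ φ x)) := by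
  simp only [twoSidedInt, leftInt_eq _ _ hx.2, rightInt_eq _ _ hx.1]
  exact ((h.tendsto_integral_mul h0 h1
    (integrable_comp_sub_vol01 (locallyIntegrable_dker hβ) x)).const_mul θ).add
    ((h.tendsto_integral_mul h0 h1
    (integrable_comp_sub_vol01 (locallyIntegrable_rker hβ) x)).const_mul (1 - θ))

/-- Completeness of `H^μ₀(0,1)`. -/
theorem exists_approx_of_cauchy (h0 : 0 ≤ μ) (h1 : μ ≤ 1) (hw : ∀ n, IsTest (w n))
    (hc : ∀ ε > 0, ∃ N, ∀ n ≥ N, ∀ m ≥ N, testSq μ (w n - w m) ≤ ε) : ∃ φ, Approx μ φ w := by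
  have hmem : ∀ n, MemLp (w n) 2 vol01 := fun n ↦ (hw n).memLp_vol01 2
  have hsemi0 : ∀ f, 0 ≤ semi μ f := fun f ↦ integral_nonneg fun ξ ↦ by positivity
  have hcau : CauchySeq fun n ↦ (hmem n).toLp (w n) := by
    rw [Metric.cauchySeq_iff]
    intro ε hε
    obtain ⟨N, hN⟩ := hc ((ε / 2) ^ 2) (by positivity)
    refine ⟨N, fun n hn m hm ↦ ?_⟩
    rw [dist_eq_norm, ← MemLp.toLp_sub]
    refine lt_of_le_of_lt (abs_le_of_sq_le_sq' ?_ (half_pos hε).le).2 (half_lt_self hε)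
    rw [norm_toLp_sq, integral_vol01_eq (fun x hx ↦ by
      simp [(hw n).eq_zero hx, (hw m).eq_zero hx])]
    exact (le_add_of_nonneg_right (hsemi0 _)).trans (hN n hn m hm)
  obtain ⟨f, hf⟩ := cauchySeq_tendsto_of_complete hcau
  have hfm : MemLp f 2 vol01 := Lp.memLp f
  have hL2 : Tendsto (fun n ↦ ∫ x, (f x - w n x) ^ 2 ∂vol01) atTop (𝓝 0) := by
    have h2 : ∀ n, ∫ x, (f x - w n x) ^ 2 ∂vol01 = ‖(hmem n).toLp (w n) - f‖ ^ 2 := by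
      intro n
      conv_rhs => rw [← Lp.toLp_coeFn f hfm]
      rw [norm_sub_rev, ← MemLp.toLp_sub, norm_toLp_sq]
      rfl
    simp_rw [h2]
    simpa using (tendsto_iff_norm_sub_tendsto_zero.1 hf).pow 2
  -- On an interval of length one the `L²` norm dominates the `L¹` norm, so the Fourier transforms
  -- converge pointwise, indeed uniformly.
  have hft : ∀ ξ, Tendsto (fun m ↦ ft (w m) ξ) atTop (𝓝 (ft (zeroExt f) ξ)) := by
    intro ξ
    rw [tendsto_iff_norm_sub_tendsto_zero]
    have hb : ∀ m, ‖ft (w m) ξ - ft (zeroExt f) ξ‖ ≤ √(∫ x, (f x - w m x) ^ 2 ∂vol01) := by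
      intro m
      rw [norm_sub_rev, ← ft_sub (integrable_zeroExt hfm) (hw m).integrable]
      refine (norm_ft_le ξ).trans (Real.le_sqrt_of_sq_le ?_)
      have hd : MemLp (fun x ↦ f x - w m x) 2 vol01 := hfm.sub (hmem m)
      have e1 : ∫ x, |(zeroExt f - w m) x| = ∫ x, |f x - w m x| ∂vol01 := by
        rw [← integral_vol01_eq (fun x hx ↦ by
          simp [zeroExt, indicator_of_notMem hx, (hw m).eq_zero hx])]
        refine setIntegral_congr_fun measurableSet_Ioo fun x hx ↦ ?_
        simp [zeroExt, indicator_of_mem hx]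
      rw [e1]
      have habs : MemLp (fun x ↦ |f x - w m x|) 2 vol01 := hd.norm
      have e2 := real_inner_le_norm (habs.toLp _) (memLp_one.toLp _)
      have e3 : ‖memLp_one.toLp _‖ = 1 := norm_oneL2
      rw [inner_toLp, e3, mul_one] at e2
      simp only [mul_one] at e2
      have e4 := pow_le_pow_left₀ (integral_nonneg fun x ↦ abs_nonneg _) e2 2
      rw [norm_toLp_sq] at e4
      simpa only [sq_abs] using e4
    refine squeeze_zero (fun m ↦ norm_nonneg _) hb ?_
    simpa using hL2.sqrt
  have hbound : ∀ ε > 0, ∃ N, ∀ n ≥ N,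
      Integrable (fun ξ ↦ fourierWeight μ (f - w n) ξ ^ 2) ∧
      ∫ ξ, fourierWeight μ (f - w n) ξ ^ 2 ≤ ε := by
    intro ε hε
    obtain ⟨N, hN⟩ := hc ε hε
    refine ⟨N, fun n hn ↦ ?_⟩
    have hmeas := measurable_fourierWeight μ (hfm.sub (hmem n))
    have hlim : ∀ ξ, Tendsto (fun m ↦ ENNReal.ofReal (fourierWeight μ (w m - w n) ξ ^ 2)) atTop
        (𝓝 (ENNReal.ofReal (fourierWeight μ (f - w n) ξ ^ 2))) := by
      intro ξ
      refine ENNReal.tendsto_ofReal (Tendsto.pow ?_ 2)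
      simp only [fourierWeight_eq, zeroExt_sub, (hw _).zeroExt_eq]
      refine Tendsto.const_mul _ (Tendsto.norm ?_)
      simp only [ft_sub (hw _).integrable (hw n).integrable,
        ft_sub (integrable_zeroExt hfm) (hw n).integrable]
      exact (hft ξ).sub_const _
    -- Fatou's lemma in the second index `m` transfers the Cauchy bound to the limit, giving
    -- finiteness of its weighted norm and convergence at once.
    have hfat : ∫⁻ ξ, ENNReal.ofReal (fourierWeight μ (f - w n) ξ ^ 2) ≤ ENNReal.ofReal ε := by
      have e1 : ∀ ξ, ENNReal.ofReal (fourierWeight μ (f - w n) ξ ^ 2) =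
          liminf (fun m ↦ ENNReal.ofReal (fourierWeight μ (w m - w n) ξ ^ 2)) atTop :=
        fun ξ ↦ (hlim ξ).liminf_eq.symm
      simp_rw [e1]
      have hmm : ∀ m, Measurable fun ξ ↦ ENNReal.ofReal (fourierWeight μ (w m - w n) ξ ^ 2) :=
        fun m ↦ ENNReal.measurable_ofReal.comp
          ((measurable_fourierWeight μ ((hmem m).sub (hmem n))).pow_const 2)
      refine (lintegral_liminf_le hmm).trans ?_
      refine liminf_le_of_frequently_le' (Eventually.frequently ?_)
      filter_upwards [eventually_ge_atTop N] with m hm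
      have ht := (hw m).sub (hw n)
      rw [← ofReal_integral_eq_lintegral_ofReal (ht.finNorm h0 h1).2.integrable_sq
        (Eventually.of_forall fun ξ ↦ sq_nonneg _)]
      refine ENNReal.ofReal_le_ofReal ?_
      refine le_trans ?_ (hN m hm n hn)
      rw [← ht.hSq_eq]
      exact le_add_of_nonneg_left (integral_nonneg fun x ↦ sq_nonneg _)
    have hint : Integrable (fun ξ ↦ fourierWeight μ (f - w n) ξ ^ 2) := by
      refine ⟨(hmeas.pow_const 2).aestronglyMeasurable, ?_⟩
      rw [hasFiniteIntegral_iff_ofReal (Eventually.of_forall fun ξ ↦ sq_nonneg _)]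
      exact hfat.trans_lt ENNReal.ofReal_lt_top
    refine ⟨hint, ?_⟩
    rw [← ofReal_integral_eq_lintegral_ofReal hint (Eventually.of_forall fun ξ ↦ sq_nonneg _)]
      at hfat
    exact (ENNReal.ofReal_le_ofReal_iff hε.le).1 hfat
  have hfin : FinNorm μ f := by
    obtain ⟨N, hN⟩ := hbound 1 one_pos
    have e1 : FinNorm μ (f - w N) := ⟨hfm.sub (hmem N), (memLp_two_iff_integrable_sq
      (measurable_fourierWeight μ (hfm.sub (hmem N))).aestronglyMeasurable).2 (hN N le_rfl).1⟩
    have e2 := e1.sub ((isTest_zero.sub (hw N)).finNorm h0 h1)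
    have e3 : (f : ℝ → ℝ) - w N - (0 - w N) = f := by abel
    rwa [e3] at e2
  refine ⟨f, hfin, hw, ?_⟩
  have h3 : Tendsto (fun n ↦ ∫ ξ, fourierWeight μ (f - w n) ξ ^ 2) atTop (𝓝 0) := by
    rw [Metric.tendsto_atTop]
    intro ε hε
    obtain ⟨N, hN⟩ := hbound (ε / 2) (half_pos hε)
    refine ⟨N, fun n hn ↦ ?_⟩
    rw [Real.dist_eq, sub_zero, abs_of_nonneg (integral_nonneg fun ξ ↦ sq_nonneg _)]
    linarith [(hN n hn).2]
  have h4 := hL2.add h3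
  rw [add_zero] at h4
  exact h4

end

/-! ### Primitives of square integrable functions -/

/-- The primitive of `d` vanishing at `0`. -/
noncomputable def prim (d : ℝ → ℝ) (x : ℝ) : ℝ := ∫ t in (0 : ℝ)..x, d t

theorem integrable_of_memLp {d : ℝ → ℝ} (hd : MemLp d 2 vol01) : Integrable d vol01 :=
  hd.integrable (by norm_num)

theorem intervalIntegrable_of_memLp {d : ℝ → ℝ} (hd : MemLp d 2 vol01) :
    IntervalIntegrable d volume 0 1 :=
  (intervalIntegrable_iff_integrableOn_Ioo_of_le zero_le_one).2 (integrable_of_memLp hd)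

theorem intervalIntegrable_of_memLp_of_mem {d : ℝ → ℝ} (hd : MemLp d 2 vol01) {x : ℝ}
    (hx : x ∈ Icc (0 : ℝ) 1) : IntervalIntegrable d volume 0 x :=
  (intervalIntegrable_of_memLp hd).mono_set (by
    rw [uIcc_of_le hx.1, uIcc_of_le zero_le_one]; exact Icc_subset_Icc_right hx.2)

theorem intervalIntegral_eq_vol01 (f : ℝ → ℝ) : ∫ x in (0 : ℝ)..1, f x = ∫ x, f x ∂vol01 := by
  rw [intervalIntegral.integral_of_le zero_le_one, integral_Ioc_eq_integral_Ioo]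

theorem prim_zero (d : ℝ → ℝ) : prim d 0 = 0 := intervalIntegral.integral_same

theorem prim_one (d : ℝ → ℝ) : prim d 1 = ∫ x, d x ∂vol01 := intervalIntegral_eq_vol01 d

theorem prim_sub {d e : ℝ → ℝ} (hd : MemLp d 2 vol01) (he : MemLp e 2 vol01) {x : ℝ}
    (hx : x ∈ Icc (0 : ℝ) 1) : prim (d - e) x = prim d x - prim e x :=
  intervalIntegral.integral_sub (intervalIntegrable_of_memLp_of_mem hd hx)
    (intervalIntegrable_of_memLp_of_mem he hx)

theorem prim_const (c x : ℝ) : prim (fun _ ↦ c) x = c * x := by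
  rw [prim, intervalIntegral.integral_const]; simp [mul_comm]

theorem continuousOn_prim {d : ℝ → ℝ} (hd : MemLp d 2 vol01) : ContinuousOn (prim d) (Icc 0 1) := by
  have := intervalIntegral.continuousOn_primitive_interval (f := d) (μ := volume) (a := 0) (b := 1)
    ((intervalIntegrable_iff' (by simp)).1 (intervalIntegrable_of_memLp hd))
  rwa [uIcc_of_le zero_le_one] at this

theorem IsTest.prim_deriv {w : ℝ → ℝ} (hw : IsTest w) (x : ℝ) : prim (_root_.deriv w) x = w x := by
  rw [prim, intervalIntegral.integral_deriv_eq_sub (fun y _ ↦ hw.differentiable y)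
    (hw.deriv.continuous.intervalIntegrable _ _), hw.eq_zero (x := 0) (by simp), sub_zero]

theorem integral_abs_sq_le {f : ℝ → ℝ} (hf : MemLp f 2 vol01) :
    (∫ x, |f x| ∂vol01) ^ 2 ≤ ∫ x, f x ^ 2 ∂vol01 := by
  set m := ∫ x, |f x| ∂vol01 with hm
  have hi : Integrable (fun x ↦ |f x|) vol01 := (integrable_of_memLp hf).abs
  have h : 0 ≤ ∫ x, (f x ^ 2 - (2 * m * |f x| - m ^ 2)) ∂vol01 := integral_nonneg fun x ↦ by
    have : f x ^ 2 - (2 * m * |f x| - m ^ 2) = (|f x| - m) ^ 2 := by rw [← sq_abs (f x)]; ring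
    simp only [Pi.zero_apply, this]
    positivity
  have hc : Integrable (fun _ : ℝ ↦ m ^ 2) vol01 := integrable_const _
  rw [integral_sub (f := fun x ↦ f x ^ 2) (g := fun x ↦ 2 * m * |f x| - m ^ 2) hf.integrable_sq
      ((hi.const_mul (2 * m)).sub hc), integral_sub (hi.const_mul _) hc, integral_const_mul, ← hm] at h
  simp at h
  linarith

theorem prim_sq_le {d : ℝ → ℝ} (hd : MemLp d 2 vol01) {x : ℝ} (hx : x ∈ Icc (0 : ℝ) 1) :
    prim d x ^ 2 ≤ ∫ t, d t ^ 2 ∂vol01 := by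
  refine le_trans ?_ (integral_abs_sq_le hd)
  rw [← sq_abs]
  refine pow_le_pow_left₀ (abs_nonneg _) ?_ 2
  refine (intervalIntegral.norm_integral_le_integral_norm (f := d) hx.1).trans ?_
  rw [intervalIntegral.integral_of_le hx.1, integral_Ioc_eq_integral_Ioo]
  exact setIntegral_mono_set (integrable_of_memLp hd).norm
    (Eventually.of_forall fun t ↦ norm_nonneg _)
    (Ioo_subset_Ioo_right hx.2).eventuallyLE

theorem memLp_of_continuousOn {f : ℝ → ℝ} (hf : ContinuousOn f (Icc 0 1)) : MemLp f 2 vol01 := by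
  obtain ⟨C, hC⟩ := isCompact_Icc.exists_bound_of_continuousOn hf
  refine MemLp.of_bound ((hf.mono Ioo_subset_Icc_self).aestronglyMeasurable measurableSet_Ioo) C ?_
  filter_upwards [ae_restrict_mem measurableSet_Ioo] with x hx
  exact hC x (Ioo_subset_Icc_self hx)

theorem integral_vol01_le {f : ℝ → ℝ} {C : ℝ} (hf : Integrable f vol01)
    (h : ∀ x ∈ Icc (0 : ℝ) 1, f x ≤ C) : ∫ x, f x ∂vol01 ≤ C := by
  have h1 := setIntegral_mono_on (μ := volume) (s := Ioo (0 : ℝ) 1) hf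
    (integrable_const C) measurableSet_Ioo fun x hx ↦ h x (Ioo_subset_Icc_self hx)
  simpa using h1

theorem integral_prim_sq_le {d : ℝ → ℝ} (hd : MemLp d 2 vol01) :
    ∫ x, prim d x ^ 2 ∂vol01 ≤ ∫ t, d t ^ 2 ∂vol01 :=
  integral_vol01_le (memLp_of_continuousOn (continuousOn_prim hd)).integrable_sq
    fun _ ↦ prim_sq_le hd

/-! ### Weak derivatives -/

theorem HasWeakDeriv.congr {g h d : ℝ → ℝ} (hg : HasWeakDeriv g d) (e : g =ᵐ[vol01] h) :
    HasWeakDeriv h d :=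
  ⟨hg.1, fun η hη ↦ (integral_congr_ae (e.mono fun x hx ↦ by simp only [hx])).symm.trans
    (hg.2 η hη)⟩

theorem IsTest.integral_deriv_eq_zero {η : ℝ → ℝ} (hη : IsTest η) :
    ∫ x, _root_.deriv η x ∂vol01 = 0 := by
  rw [← prim_one, hη.prim_deriv, hη.eq_zero (by simp)]

/-- Integration by parts for absolutely continuous functions; the boundary terms vanish with the
test function. -/
theorem hasWeakDeriv_prim {d : ℝ → ℝ} (hd : MemLp d 2 vol01) : HasWeakDeriv (prim d) d := by
  refine ⟨hd, fun η hη ↦ ?_⟩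
  have hi := intervalIntegrable_of_memLp hd
  have h1 := (hi.absolutelyContinuousOnInterval_intervalIntegral
    (c := 0) (by simp)).integral_mul_deriv_eq_deriv_mul
    (g := η) (ContDiffOn.absolutelyContinuousOnInterval (hη.1.of_le (by simp)).contDiffOn)
  rw [hη.eq_zero (x := 0) (by simp), hη.eq_zero (x := 1) (by simp), mul_zero, mul_zero, sub_zero,
    zero_sub, intervalIntegral_eq_vol01, intervalIntegral_eq_vol01] at h1
  refine h1.trans (congrArg _ (integral_congr_ae ?_))
  filter_upwards [ae_restrict_of_ae hi.ae_hasDerivAt_integral, ae_restrict_mem measurableSet_Ioo]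
    with x hx hm
  rw [uIcc_of_le zero_le_one] at hx
  rw [(hx (Ioo_subset_Icc_self hm) 0 (by simp)).deriv]

theorem integrable_mul_test {f η : ℝ → ℝ} (hf : Integrable f vol01) (hη : IsTest η) :
    Integrable (fun x ↦ f x * η x) vol01 := by
  obtain ⟨C, hC⟩ := hη.exists_bound
  exact hf.mul_bdd (c := C) hη.continuous.aestronglyMeasurable (Eventually.of_forall hC)

theorem HasWeakDeriv.sub {g h d e : ℝ → ℝ} (hg : HasWeakDeriv g d) (hh : HasWeakDeriv h e)
    (hgm : MemLp g 2 vol01) (hhm : MemLp h 2 vol01) : HasWeakDeriv (g - h) (d - e) := by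
  refine ⟨hg.1.sub hh.1, fun η hη ↦ ?_⟩
  simp only [Pi.sub_apply, sub_mul]
  rw [integral_sub (integrable_mul_test (integrable_of_memLp hgm) hη.deriv)
    (integrable_mul_test (integrable_of_memLp hhm) hη.deriv),
    integral_sub (integrable_mul_test (integrable_of_memLp hg.1) hη)
    (integrable_mul_test (integrable_of_memLp hh.1) hη), hg.2 η hη, hh.2 η hη]
  ring

theorem IsTest.hasWeakDeriv {w : ℝ → ℝ} (hw : IsTest w) : HasWeakDeriv w (_root_.deriv w) :=
  (hasWeakDeriv_prim (hw.deriv.memLp_vol01 2)).congr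
    (Eventually.of_forall fun x ↦ hw.prim_deriv x)

theorem HasWeakDeriv.ae_eq {g d e : ℝ → ℝ} (hd : HasWeakDeriv g d) (he : HasWeakDeriv g e) :
    d =ᵐ[vol01] e := by
  have h := ae_eq_zero_of_integral_mul_test (f := d - e) (integrable_of_memLp (hd.1.sub he.1))
    fun η hη ↦ by
      simp only [Pi.sub_apply, sub_mul]
      rw [integral_sub (integrable_mul_test (integrable_of_memLp hd.1) hη)
        (integrable_mul_test (integrable_of_memLp he.1) hη), sub_eq_zero]
      exact neg_injective ((hd.2 η hη).symm.trans (he.2 η hη))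
  exact h.mono fun x hx ↦ sub_eq_zero.1 hx

/-- Functions in `H¹(0,1)` are primitives of their weak derivatives. -/
theorem HasWeakDeriv.exists_ae_eq {g d : ℝ → ℝ} (hg : HasWeakDeriv g d) (hgm : MemLp g 2 vol01) :
    ∃ c : ℝ, g =ᵐ[vol01] fun x ↦ c + prim d x := by
  have hm := memLp_of_continuousOn (continuousOn_prim hg.1)
  obtain ⟨c, hc⟩ := ae_eq_const_of_integral_mul_deriv (f := g - prim d)
    (integrable_of_memLp (hgm.sub hm)) fun η hη ↦ by
      rw [(hg.sub (hasWeakDeriv_prim hg.1) hgm hm).2 η hη]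
      simp
  exact ⟨c, hc.mono fun x hx ↦ sub_eq_iff_eq_add.1 hx⟩

theorem hasWeakDeriv_of_ae_eq {g d : ℝ → ℝ} {c : ℝ} (hd : MemLp d 2 vol01)
    (h : g =ᵐ[vol01] fun x ↦ c + prim d x) : HasWeakDeriv g d := by
  refine HasWeakDeriv.congr ⟨hd, fun η hη ↦ ?_⟩ h.symm
  simp only [add_mul]
  rw [integral_add (integrable_mul_test (integrable_const c) hη.deriv) (integrable_mul_test
    (integrable_of_memLp (memLp_of_continuousOn (continuousOn_prim hd))) hη.deriv),
    integral_const_mul, hη.integral_deriv_eq_zero, mul_zero, zero_add,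
    (hasWeakDeriv_prim hd).2 η hη]

theorem h1Norm_eq {g d : ℝ → ℝ} (hg : HasWeakDeriv g d) :
    h1Norm g = √((∫ x, g x ^ 2 ∂vol01) + ∫ x, d x ^ 2 ∂vol01) := by
  have he : ∃ d, HasWeakDeriv g d := ⟨d, hg⟩
  have h : HasWeakDeriv g (weakDeriv g) := by
    rw [weakDeriv, dif_pos he]
    exact he.choose_spec
  rw [h1Norm, integral_congr_ae (f := fun x ↦ weakDeriv g x ^ 2) (g := fun x ↦ d x ^ 2)
    ((h.ae_eq hg).mono fun x hx ↦ by simp only [hx])]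

theorem continuousOn_const_add_prim {d : ℝ → ℝ} (c : ℝ) (hd : MemLp d 2 vol01) :
    ContinuousOn (fun x ↦ c + prim d x) (Icc 0 1) := continuousOn_const.add (continuousOn_prim hd)

theorem memH1_of_ae_eq {g d : ℝ → ℝ} {c : ℝ} (hd : MemLp d 2 vol01)
    (h : g =ᵐ[vol01] fun x ↦ c + prim d x) : MemH1 g :=
  ⟨(memLp_of_continuousOn (continuousOn_const_add_prim c hd)).ae_eq h.symm, d,
    hasWeakDeriv_of_ae_eq hd h⟩

theorem eqOn_of_ae_eq_vol01 {F G : ℝ → ℝ} (hF : ContinuousOn F (Icc 0 1))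
    (hG : ContinuousOn G (Icc 0 1)) (h : F =ᵐ[vol01] G) : EqOn F G (Icc 0 1) := by
  refine Measure.eqOn_Icc_of_ae_eq volume zero_ne_one ?_ hF hG
  rwa [← Measure.restrict_congr_set Ioo_ae_eq_Icc]

theorem contRep_eq {g G : ℝ → ℝ} (hG : ContinuousOn G (Icc 0 1)) (h : G =ᵐ[vol01] g) :
    EqOn (contRep g) G (Icc 0 1) := by
  have he : ∃ G : ℝ → ℝ, ContinuousOn G (Icc 0 1) ∧ G =ᵐ[vol01] g := ⟨G, hG, h⟩
  rw [contRep, dif_pos he]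
  exact eqOn_of_ae_eq_vol01 he.choose_spec.1 hG (he.choose_spec.2.trans h.symm)

theorem contRep_zero {g d : ℝ → ℝ} {c : ℝ} (hd : MemLp d 2 vol01)
    (h : g =ᵐ[vol01] fun x ↦ c + prim d x) : contRep g 0 = c := by
  simp [contRep_eq (continuousOn_const_add_prim c hd) h.symm (show (0 : ℝ) ∈ Icc 0 1 by simp),
    prim_zero]

theorem contRep_one {g d : ℝ → ℝ} {c : ℝ} (hd : MemLp d 2 vol01)
    (h : g =ᵐ[vol01] fun x ↦ c + prim d x) : contRep g 1 = c + ∫ x, d x ∂vol01 := by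
  rw [contRep_eq (continuousOn_const_add_prim c hd) h.symm (show (1 : ℝ) ∈ Icc 0 1 by simp),
    ← prim_one]

/-! ### The space `H¹₀(0,1)` -/

/-- A mean zero `d` is an `L²` limit of derivatives of test functions, and the primitive is bounded
by its derivative. The squared `H¹` error is thus at most twice the derivative error, whence `ε²/2`.
-/
theorem memH10_of_ae_eq {g d : ℝ → ℝ} (hd : MemLp d 2 vol01) (h0 : ∫ x, d x ∂vol01 = 0)
    (h : g =ᵐ[vol01] prim d) : MemH10 g := by
  have h' : g =ᵐ[vol01] fun x ↦ 0 + prim d x := by simpa only [zero_add] using h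
  have hg := memH1_of_ae_eq hd h'
  refine ⟨hg, fun ε hε ↦ ?_⟩
  obtain ⟨w, hw, hlt⟩ := exists_test_deriv_near hd h0 (ε := ε ^ 2 / 2) (by positivity)
  refine ⟨w, hw, ?_⟩
  have hwd := hw.deriv.memLp_vol01 2
  have hD : HasWeakDeriv (fun x ↦ g x - w x) (d - deriv w) :=
    (hasWeakDeriv_of_ae_eq hd h').sub hw.hasWeakDeriv hg.1 (hw.memLp_vol01 2)
  rw [h1Norm_eq hD, Real.sqrt_lt' hε]
  have e1 : ∫ x, (g x - w x) ^ 2 ∂vol01 = ∫ x, prim (d - deriv w) x ^ 2 ∂vol01 := by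
    refine integral_congr_ae ?_
    filter_upwards [h, ae_restrict_mem measurableSet_Ioo] with x hx hm
    rw [prim_sub hd hwd (Ioo_subset_Icc_self hm), hw.prim_deriv, hx]
  have e2 := integral_prim_sq_le (hd.sub hwd)
  simp only [Pi.sub_apply] at e2 ⊢
  rw [e1]
  linarith

theorem MemH10.exists_ae_eq {g : ℝ → ℝ} (hg : MemH10 g) :
    ∃ d, MemLp d 2 vol01 ∧ ∫ x, d x ∂vol01 = 0 ∧ g =ᵐ[vol01] prim d := by
  obtain ⟨⟨hgm, d, hd⟩, happ⟩ := hg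
  obtain ⟨c, hc⟩ := hd.exists_ae_eq hgm
  -- With `g = c + prim d`, the number `c` is `(g - w)` minus the primitive of `d - w'`, and the
  -- mean of `d` equals that of `d - w'`. Both are therefore controlled by the distance from `g` to
  -- the test functions.
  have hest : ∀ ε > 0, c ^ 2 ≤ 4 * ε ∧ (∫ x, d x ∂vol01) ^ 2 ≤ ε := by
    intro ε hε
    obtain ⟨w, hw, hlt⟩ := happ (√ε) (Real.sqrt_pos.2 hε)
    have hwd := hw.deriv.memLp_vol01 2
    have hD : HasWeakDeriv (fun x ↦ g x - w x) (d - deriv w) :=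
      hd.sub hw.hasWeakDeriv hgm (hw.memLp_vol01 2)
    have hem := hd.1.sub hwd
    rw [h1Norm_eq hD, Real.sqrt_lt_sqrt_iff (add_nonneg (integral_nonneg fun _ ↦ sq_nonneg _)
      (integral_nonneg fun _ ↦ sq_nonneg _))] at hlt
    have e1 : 0 ≤ ∫ x, (g x - w x) ^ 2 ∂vol01 := integral_nonneg fun _ ↦ sq_nonneg _
    have e2 : 0 ≤ ∫ x, (d - deriv w) x ^ 2 ∂vol01 := integral_nonneg fun _ ↦ sq_nonneg _
    constructor
    · have e3 := integral_sub_sq_le (hgm.sub (hw.memLp_vol01 2))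
        (memLp_of_continuousOn (continuousOn_prim hem))
      have e4 := integral_prim_sq_le hem
      have e5 : ∫ x, ((g - w) x - prim (d - deriv w) x) ^ 2 ∂vol01 = c ^ 2 := by
        have : ∫ x, ((g - w) x - prim (d - deriv w) x) ^ 2 ∂vol01 = ∫ _, c ^ 2 ∂vol01 := by
          refine integral_congr_ae ?_
          filter_upwards [hc, ae_restrict_mem measurableSet_Ioo] with x hx hm
          rw [prim_sub hd.1 hwd (Ioo_subset_Icc_self hm), hw.prim_deriv, Pi.sub_apply, hx]
          ring
        rw [this]; simp
      rw [e5] at e3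
      simp only [Pi.sub_apply] at e1 e2 e3 e4 hlt
      linarith
    · have e3 := prim_sq_le hem (x := 1) (by simp)
      rw [prim_sub hd.1 hwd (by simp), hw.prim_deriv, hw.eq_zero (by simp), sub_zero,
        prim_one] at e3
      linarith
  have hlim : ∀ {a K : ℝ}, 0 < K → (∀ ε > 0, a ^ 2 ≤ K * ε) → a = 0 := fun {a K} hK h ↦ by
    by_contra ha
    have h1 : 0 < a ^ 2 := by positivity
    have h2 := h (a ^ 2 / (2 * K)) (by positivity)
    have h3 : K * (a ^ 2 / (2 * K)) = a ^ 2 / 2 := by field_simp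
    linarith
  have hc0 : c = 0 := hlim four_pos fun ε hε ↦ (hest ε hε).1
  refine ⟨d, hd.1, hlim one_pos fun ε hε ↦ by simpa using (hest ε hε).2, ?_⟩
  simpa only [hc0, zero_add] using hc

/-! ### The derivative of the fractional integral on `H^{1-β}₀(0,1)` -/

section

variable {β θ : ℝ}

theorem IsTest.fracDeriv_sub (hβ : 0 < β) {u w : ℝ → ℝ} (hu : IsTest u) (hw : IsTest w) :
    fracDeriv β θ (u - w) = fracDeriv β θ u - fracDeriv β θ w := by
  have h : ∀ k : ℝ → ℝ, LocallyIntegrable k → conv k (_root_.deriv (u - w)) =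
      conv k (_root_.deriv u) - conv k (_root_.deriv w) := fun k hk ↦ by
    rw [show u - w = u + (-1 : ℝ) • w by rw [neg_one_smul, sub_eq_add_neg],
      hu.deriv_add (hw.smul _), hw.deriv_smul, hu.deriv.conv_add hk (hw.deriv.smul _), conv_smul,
      neg_one_smul, sub_eq_add_neg]
  ext x
  simp only [fracDeriv, h _ (locallyIntegrable_dker hβ), h _ (locallyIntegrable_rker hβ),
    Pi.sub_apply]
  ring

/-- `w` is a sequence of test functions converging to `φ` in the `H^{1-β}` norm, whose fractional
derivatives converge to `a` in `L²(0,1)`. -/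
structure FracApprox (β θ : ℝ) (φ a : ℝ → ℝ) (w : ℕ → ℝ → ℝ) : Prop where
  approx : Approx (1 - β) φ w
  memLp : MemLp a 2 vol01
  tendsto : Tendsto (fun n ↦ ∫ x, (a x - fracDeriv β θ (w n) x) ^ 2 ∂vol01) atTop (𝓝 0)

/-- The bound for `A_θ` on test functions makes the fractional derivatives Cauchy in `L²`; their
limit plays the role of `A_θ φ`. -/
theorem Approx.exists_fracApprox (hβ : 0 < β) (hβ1 : β ≤ 1) (h0 : 0 ≤ θ) (h1 : θ ≤ 1)
    {φ : ℝ → ℝ} {w : ℕ → ℝ → ℝ} (h : Approx (1 - β) φ w) : ∃ a, FracApprox β θ φ a w := by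
  have hm : ∀ n, MemLp (fracDeriv β θ (w n)) 2 vol01 := fun n ↦ (h.isTest n).memLp_fracDeriv hβ θ
  have hcau : CauchySeq fun n ↦ (hm n).toLp _ := by
    rw [Metric.cauchySeq_iff]
    intro ε hε
    obtain ⟨N, hN⟩ := eventually_atTop.1
      (h.tendsto.eventually (gt_mem_nhds (show 0 < ε ^ 2 / 4 by positivity)))
    refine ⟨N, fun n hn m hm' ↦ ?_⟩
    rw [dist_eq_norm, ← MemLp.toLp_sub]
    refine lt_of_pow_lt_pow_left₀ 2 hε.le ?_
    rw [norm_toLp_sq]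
    have e1 := ((h.isTest n).sub (h.isTest m)).integral_fracDeriv_sq_le hβ hβ1 h0 h1
    rw [(h.isTest n).fracDeriv_sub hβ (h.isTest m)] at e1
    have e2 := h.testSq_sub_le (by linarith) (by linarith) n m
    linarith [hN n hn, hN m hm']
  obtain ⟨f, hf⟩ := cauchySeq_tendsto_of_complete hcau
  have hfm : MemLp f 2 vol01 := Lp.memLp f
  refine ⟨f, h, hfm, ?_⟩
  have h2 : ∀ n, ∫ x, (f x - fracDeriv β θ (w n) x) ^ 2 ∂vol01 = ‖(hm n).toLp _ - f‖ ^ 2 := by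
    intro n
    conv_rhs => rw [← Lp.toLp_coeFn f hfm]
    rw [norm_sub_rev, ← MemLp.toLp_sub, norm_toLp_sq]
    rfl
  simp_rw [h2]
  simpa using (tendsto_iff_norm_sub_tendsto_zero.1 hf).pow 2

namespace FracApprox

variable {φ ψ a b : ℝ → ℝ} {w u : ℕ → ℝ → ℝ}

theorem memLp_fracDeriv (h : FracApprox β θ φ a w) (hβ : 0 < β) (n : ℕ) :
    MemLp (fracDeriv β θ (w n)) 2 vol01 := (h.approx.isTest n).memLp_fracDeriv hβ θ

theorem sub (h : FracApprox β θ φ a w) (k : FracApprox β θ ψ b u) (hβ : 0 < β) (hβ1 : β ≤ 1) :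
    FracApprox β θ (φ - ψ) (a - b) (fun n ↦ w n - u n) := by
  refine ⟨⟨h.approx.finNorm.sub k.approx.finNorm, fun n ↦ (h.approx.isTest n).sub
    (k.approx.isTest n), ?_⟩, h.memLp.sub k.memLp, ?_⟩
  · refine squeeze_zero (fun n ↦ hSq_nonneg _ _) (fun n ↦ ?_)
      (by simpa using (h.approx.tendsto.const_mul 2).add (k.approx.tendsto.const_mul 2))
    rw [sub_sub_sub_comm]
    exact hSq_sub_le (h.approx.finNorm_sub (by linarith) (by linarith) n)
      (k.approx.finNorm_sub (by linarith) (by linarith) n)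
  · refine squeeze_zero (fun n ↦ integral_nonneg fun _ ↦ sq_nonneg _) (fun n ↦ ?_)
      (by simpa using (h.tendsto.const_mul 2).add (k.tendsto.const_mul 2))
    rw [(h.approx.isTest n).fracDeriv_sub hβ (k.approx.isTest n)]
    have := integral_sub_sq_le (h.memLp.sub (h.memLp_fracDeriv hβ n))
      (k.memLp.sub (k.memLp_fracDeriv hβ n))
    simpa only [Pi.sub_apply, sub_sub_sub_comm] using this

/-- The fundamental theorem of calculus holds for each test function. The fractional integrals
converge at every point of `[0,1]`, and the primitives follow the `L²` convergence. -/
theorem twoSidedInt_eq (h : FracApprox β θ φ a w) (hβ : 0 < β) (hβ' : β < 1 / 2) {x : ℝ}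
    (hx : x ∈ Icc (0 : ℝ) 1) : twoSidedInt β θ φ x = twoSidedInt β θ φ 0 + prim a x := by
  have e1 : ∀ y ∈ Icc (0 : ℝ) 1, Tendsto (fun n ↦ twoSidedInt β θ (w n) y) atTop
      (𝓝 (twoSidedInt β θ φ y)) := fun y hy ↦
    h.approx.tendsto_twoSidedInt (by linarith) (by linarith) hβ θ hy
  have e2 : Tendsto (fun n ↦ prim (fracDeriv β θ (w n)) x) atTop (𝓝 (prim a x)) := by
    have e3 := (squeeze_zero (fun n ↦ sq_nonneg _)
      (fun n ↦ prim_sq_le (h.memLp.sub (h.memLp_fracDeriv hβ n)) hx) h.tendsto).sqrt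
    simp only [Real.sqrt_sq_eq_abs, Real.sqrt_zero,
      prim_sub h.memLp (h.memLp_fracDeriv hβ _) hx] at e3
    rw [tendsto_iff_norm_sub_tendsto_zero]
    simpa only [Real.norm_eq_abs, abs_sub_comm] using e3
  refine tendsto_nhds_unique (e1 x hx) (((e1 0 (by simp)).add e2).congr fun n ↦ ?_)
  exact ((h.approx.isTest n).twoSidedInt_eq hβ θ hx).symm

theorem integral_sq_le (h : FracApprox β θ φ a w) (hβ : 0 < β) (hβ1 : β ≤ 1) (h0 : 0 ≤ θ)
    (h1 : θ ≤ 1) : ∫ x, a x ^ 2 ∂vol01 ≤ 4 * hSq (1 - β) φ := by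
  have hlim : Tendsto (fun n ↦ 2 * (∫ x, (a x - fracDeriv β θ (w n) x) ^ 2 ∂vol01) +
      (4 * hSq (1 - β) φ + 4 * hSq (1 - β) (φ - w n))) atTop (𝓝 (4 * hSq (1 - β) φ)) := by
    simpa using (h.tendsto.const_mul 2).add ((h.approx.tendsto.const_mul 4).const_add _)
  refine ge_of_tendsto' hlim fun n ↦ ?_
  have hf := h.memLp_fracDeriv hβ n
  have e1 := integral_sub_sq_le (h.memLp.sub hf) hf.neg
  have e2 := (h.approx.isTest n).integral_fracDeriv_sq_le hβ hβ1 h0 h1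
  have e3 := h.approx.testSq_le (by linarith) (by linarith) n
  simp only [Pi.sub_apply, Pi.neg_apply, sub_neg_eq_add, sub_add_cancel, neg_sq] at e1
  linarith

theorem hSq_le (h : FracApprox β θ φ a w) (hβ : 0 < β) (hβ1 : β ≤ 1) {κ : ℝ} (hκ0 : 0 < κ)
    (hκ : ∀ w, IsTest w → ∀ c : ℝ,
      κ * testSq (1 - β) w ≤ ∫ x, (fracDeriv β θ w x - c) ^ 2 ∂vol01) (c : ℝ) :
    κ * hSq (1 - β) φ ≤ 4 * ∫ x, (a x - c) ^ 2 ∂vol01 := by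
  set A := ∫ x, (a x - c) ^ 2 ∂vol01 with hA
  have hlim : Tendsto (fun n ↦ 4 * A + 4 * (∫ x, (a x - fracDeriv β θ (w n) x) ^ 2 ∂vol01) +
      2 * κ * hSq (1 - β) (φ - w n)) atTop (𝓝 (4 * A)) := by
    simpa using ((h.tendsto.const_mul 4).const_add _).add (h.approx.tendsto.const_mul (2 * κ))
  refine ge_of_tendsto' hlim fun n ↦ ?_
  have hf := h.memLp_fracDeriv hβ n
  have e1 := integral_sub_sq_le (h.memLp.sub (memLp_const c)) (h.memLp.sub hf)
  have e2 := hκ _ (h.approx.isTest n) c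
  have e3 := h.approx.hSq_le (by linarith) (by linarith) n
  simp only [Pi.sub_apply, sub_sub_sub_cancel_left] at e1
  have e4 := mul_le_mul_of_nonneg_left e3 hκ0.le
  linarith

end FracApprox

/-- The fractional derivative maps `H^{1-β}₀(0,1)` onto `L²(0,1)` modulo constants. -/
theorem exists_fracApprox_sub_const (hβ : 0 < β) (hβ' : β < 1 / 2) (h0 : 0 ≤ θ) (h1 : θ ≤ 1)
    {d : ℝ → ℝ} (hd : MemLp d 2 vol01) :
    ∃ (c : ℝ) (φ : ℝ → ℝ) (w : ℕ → ℝ → ℝ), FracApprox β θ φ (fun x ↦ d x - c) w := by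
  obtain ⟨c, hc⟩ := exists_fracDeriv_near hβ hβ' h0 h1 hd
  obtain ⟨κ, hκ0, hκ⟩ := exists_testSq_le hβ hβ' h0 h1
  choose w hw hlt using fun n : ℕ ↦ hc (damp n) (damp_pos n)
  have ham : MemLp (fun x ↦ d x - c) 2 vol01 := hd.sub (memLp_const c)
  have hlim : Tendsto (fun n ↦ ∫ x, (fracDeriv β θ (w n) x - (d x - c)) ^ 2 ∂vol01) atTop (𝓝 0) :=
    squeeze_zero (fun n ↦ integral_nonneg fun _ ↦ sq_nonneg _) (fun n ↦ (hlt n).le) tendsto_damp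
  obtain ⟨φ, hφ⟩ := exists_approx_of_cauchy (μ := 1 - β) (by linarith) (by linarith) hw
    fun ε hε ↦ by
      obtain ⟨N, hN⟩ := eventually_atTop.1
        (hlim.eventually (gt_mem_nhds (show 0 < κ * ε / 4 by positivity)))
      refine ⟨N, fun n hn m hm ↦ ?_⟩
      -- The lower bound modulo constants, with constant `0`, makes the test functions Cauchy
      -- because their fractional derivatives converge.
      have e1 := hκ _ ((hw n).sub (hw m)) 0
      have e2 := integral_sub_sq_le (((hw n).memLp_fracDeriv hβ θ).sub ham)
        (((hw m).memLp_fracDeriv hβ θ).sub ham)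
      simp only [Pi.sub_apply, sub_sub_sub_cancel_right] at e2
      simp only [(hw n).fracDeriv_sub hβ (hw m), sub_zero, Pi.sub_apply] at e1
      have e3 := hN n hn
      have e4 := hN m hm
      exact le_of_mul_le_mul_left (by linarith) hκ0
  refine ⟨c, φ, w, hφ, ham, hlim.congr fun n ↦ ?_⟩
  simp only [sub_sq_comm]

/-! ### The integral equation -/

theorem twoSidedInt_zero (β θ : ℝ) (φ : ℝ → ℝ) :
    twoSidedInt β θ φ 0 = (1 - θ) * rightInt β φ 0 := by
  simp [twoSidedInt, leftInt]

theorem twoSidedInt_one (β θ : ℝ) (φ : ℝ → ℝ) :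
    twoSidedInt β θ φ 1 = θ * leftInt β φ 1 := by
  simp [twoSidedInt, rightInt]

namespace FracApprox

variable {φ ψ a b g : ℝ → ℝ} {w u : ℕ → ℝ → ℝ}

/-- The fractional integral with prescribed boundary values. -/
theorem add_linear_eq (h : FracApprox β θ φ a w) (hβ : 0 < β) (hβ' : β < 1 / 2) (p q : ℝ) {x : ℝ}
    (hx : x ∈ Icc (0 : ℝ) 1) :
    twoSidedInt β θ φ x + (p - (1 - θ) * rightInt β φ 0) * (1 - x)
      + (q - θ * leftInt β φ 1) * x =
    p + prim (fun t ↦ a t - ((∫ t, a t ∂vol01) - (q - p))) x := by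
  have e1 := prim_sub h.memLp (memLp_const ((∫ t, a t ∂vol01) - (q - p))) hx
  rw [prim_const] at e1
  rw [← twoSidedInt_zero, ← twoSidedInt_one, h.twoSidedInt_eq hβ hβ' hx,
    h.twoSidedInt_eq hβ hβ' (x := 1) (by simp), prim_one]
  refine Eq.trans ?_ (congrArg (p + ·) e1.symm)
  ring

/-- The affine correction alters the derivative by a constant and enforces the boundary values, so
the equation says that `g'` and the fractional derivative of `φ` differ by the one constant
compatible with `g(1) - g(0)`. -/
theorem solves_iff (h : FracApprox β θ φ a w) (hβ : 0 < β) (hβ' : β < 1 / 2) :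
    Solves β θ g φ ↔ g =ᵐ[vol01] fun x ↦ contRep g 0 +
      prim (fun t ↦ a t - ((∫ t, a t ∂vol01) - (contRep g 1 - contRep g 0))) x := by
  rw [Solves, eventuallyEq_comm]
  have := (ae_restrict_mem (μ := volume) (measurableSet_Ioo (a := (0 : ℝ)) (b := 1))).mono
    fun x hx ↦ h.add_linear_eq hβ hβ' (contRep g 0) (contRep g 1) (Ioo_subset_Icc_self hx)
  exact ⟨fun e ↦ e.trans this, fun e ↦ e.trans (EventuallyEq.symm this)⟩

/-- The fractional derivatives of two solutions differ by a constant, and the lower bound modulo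
constants then annihilates `φ - ψ`. -/
theorem ae_eq_of_solves (h : FracApprox β θ φ a w) (k : FracApprox β θ ψ b u) (hβ : 0 < β)
    (hβ' : β < 1 / 2) (h0 : 0 ≤ θ) (h1 : θ ≤ 1) (hφ : Solves β θ g φ) (hψ : Solves β θ g ψ) :
    φ =ᵐ[vol01] ψ := by
  rw [h.solves_iff hβ hβ'] at hφ
  rw [k.solves_iff hβ hβ'] at hψ
  obtain ⟨κ, hκ0, hκ⟩ := exists_testSq_le hβ hβ' h0 h1
  have e1 := (hasWeakDeriv_of_ae_eq (h.memLp.sub (memLp_const _)) hφ).ae_eq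
    (hasWeakDeriv_of_ae_eq (k.memLp.sub (memLp_const _)) hψ)
  have hs := h.sub k hβ (by linarith)
  have e2 := hs.hSq_le hβ (by linarith) hκ0 hκ
    ((∫ t, a t ∂vol01) - ∫ t, b t ∂vol01)
  have e3 : ∫ x, ((a - b) x - ((∫ t, a t ∂vol01) - ∫ t, b t ∂vol01)) ^ 2 ∂vol01 = 0 := by
    rw [← integral_zero ℝ ℝ (μ := vol01)]
    refine integral_congr_ae (e1.mono fun x hx ↦ ?_)
    simp only [Pi.sub_apply] at hx ⊢
    rw [sq_eq_zero_iff]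
    linarith
  rw [e3, mul_zero] at e2
  have e4 : ∫ x, (φ - ψ) x ^ 2 ∂vol01 ≤ 0 :=
    (le_add_of_nonneg_right (integral_nonneg fun _ ↦ sq_nonneg _)).trans
      (nonpos_of_mul_nonpos_right e2 hκ0)
  have e5 := (integral_eq_zero_iff_of_nonneg (fun x ↦ sq_nonneg ((φ - ψ) x))
    hs.approx.finNorm.1.integrable_sq).1 (le_antisymm e4 (integral_nonneg fun _ ↦ sq_nonneg _))
  exact e5.mono fun x hx ↦ sub_eq_zero.1 (sq_eq_zero_iff.1 hx)

end FracApprox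

/-- It suffices to match the derivative of `g` modulo a constant: the mean of `d - c` cancels the
unknown `c` in the criterion for solutions. -/
theorem exists_solves (hβ : 0 < β) (hβ' : β < 1 / 2) (h0 : 0 ≤ θ) (h1 : θ ≤ 1) {g : ℝ → ℝ}
    (hg : MemH1 g) : ∃ (φ a : ℝ → ℝ) (w : ℕ → ℝ → ℝ), FracApprox β θ φ a w ∧ Solves β θ g φ := by
  obtain ⟨hgm, d, hd⟩ := hg
  obtain ⟨p, hp⟩ := hd.exists_ae_eq hgm
  obtain ⟨c, φ, w, h⟩ := exists_fracApprox_sub_const hβ hβ' h0 h1 hd.1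
  refine ⟨φ, _, w, h, (h.solves_iff hβ hβ').2 ?_⟩
  rw [contRep_zero hd.1 hp, contRep_one hd.1 hp,
    integral_sub (integrable_of_memLp hd.1) (integrable_const c)]
  simpa using hp

theorem MemH0.exists_fracApprox (hβ : 0 < β) (hβ1 : β ≤ 1) (h0 : 0 ≤ θ) (h1 : θ ≤ 1) {φ : ℝ → ℝ}
    (hφ : MemH0 (1 - β) φ) : ∃ (a : ℝ → ℝ) (w : ℕ → ℝ → ℝ), FracApprox β θ φ a w := by
  obtain ⟨w, hw⟩ := hφ.exists_approx
  obtain ⟨a, ha⟩ := hw.exists_fracApprox hβ hβ1 h0 h1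
  exact ⟨a, w, ha⟩

theorem MemH0.memH10 (hβ : 0 < β) (hβ' : β < 1 / 2) (h0 : 0 ≤ θ) (h1 : θ ≤ 1) {φ : ℝ → ℝ}
    (hφ : MemH0 (1 - β) φ) :
    MemH10 (fun x ↦ twoSidedInt β θ φ x
      - (1 - θ) * rightInt β φ 0 * (1 - x) - θ * leftInt β φ 1 * x) := by
  obtain ⟨a, w, h⟩ := hφ.exists_fracApprox hβ (by linarith) h0 h1
  refine memH10_of_ae_eq (h.memLp.sub (memLp_const (∫ t, a t ∂vol01))) ?_ ?_
  · simp only [Pi.sub_apply]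
    rw [integral_sub (integrable_of_memLp h.memLp) (integrable_const _)]
    simp
  · filter_upwards [ae_restrict_mem measurableSet_Ioo] with x hx
    have e := h.add_linear_eq hβ hβ' 0 0 (Ioo_subset_Icc_self hx)
    rw [sub_zero, sub_zero, zero_add] at e
    refine Eq.trans ?_ e
    ring

theorem exists_norm_equiv (hβ : 0 < β) (hβ' : β < 1 / 2) (h0 : 0 ≤ θ) (h1 : θ ≤ 1) :
    ∃ C₃ C₄ : ℝ, 0 < C₃ ∧ 0 < C₄ ∧
      ∀ g φ : ℝ → ℝ, MemH10 g → MemH0 (1 - β) φ → Solves β θ g φ →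
        C₃ * hNorm (1 - β) φ ≤ h1Norm g ∧ h1Norm g ≤ C₄ * hNorm (1 - β) φ := by
  obtain ⟨κ, hκ0, hκ⟩ := exists_testSq_le hβ hβ' h0 h1
  -- Here `g' = a - m` with `m` the mean of `a`. The lower constant is the bound modulo constants.
  -- For the upper one, `‖g‖² ≤ ‖g'‖²`, `‖a - m‖² ≤ 4‖a‖²` and `‖a‖² ≤ 4‖φ‖²` multiply to `2 · 4 · 4
  -- = 32`.
  refine ⟨√(κ / 4), √32, by positivity, by positivity, fun g φ hg hφ hs ↦ ?_⟩
  obtain ⟨a, w, h⟩ := hφ.exists_fracApprox hβ (by linarith) h0 h1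
  obtain ⟨d, hd, hd0, hgd⟩ := hg.exists_ae_eq
  have hgd' : g =ᵐ[vol01] fun x ↦ 0 + prim d x := by simpa only [zero_add] using hgd
  rw [h.solves_iff hβ hβ', contRep_one hd hgd', contRep_zero hd hgd', hd0, zero_add, sub_zero,
    sub_zero] at hs
  set m := ∫ t, a t ∂vol01 with hm
  have ham : MemLp (fun t ↦ a t - m) 2 vol01 := h.memLp.sub (memLp_const m)
  rw [h1Norm_eq (hasWeakDeriv_of_ae_eq ham hs), hNorm_eq, ← Real.sqrt_mul (by positivity),
    ← Real.sqrt_mul (by positivity)]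
  have e1 : ∫ x, g x ^ 2 ∂vol01 ≤ ∫ x, (a x - m) ^ 2 ∂vol01 := by
    refine le_trans (le_of_eq (integral_congr_ae (hs.mono fun x hx ↦ ?_))) (integral_prim_sq_le ham)
    simp only [hx, zero_add]
  have e2 : 0 ≤ ∫ x, g x ^ 2 ∂vol01 := integral_nonneg fun _ ↦ sq_nonneg _
  have e3 := h.hSq_le hβ (by linarith) hκ0 hκ m
  have e4 := h.integral_sq_le hβ (by linarith) h0 h1
  have e5 := integral_sub_sq_le h.memLp (memLp_const m)
  have e6 : m ^ 2 ≤ ∫ x, a x ^ 2 ∂vol01 := by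
    rw [hm, ← prim_one]
    exact prim_sq_le h.memLp (by simp)
  simp only [integral_const, measureReal_restrict_apply_univ, Real.volume_real_Ioo,
    sub_zero, max_eq_left zero_le_one, one_smul] at e5
  exact ⟨Real.sqrt_le_sqrt (by linarith), Real.sqrt_le_sqrt (by linarith)⟩

end

end FracInt

/-! ### Assembly of the theorem -/

theorem theorem4p3 (β θ : ℝ) (hβ : 0 < β) (hβ' : β < 1 / 2) (hθ : 0 ≤ θ) (hθ' : θ ≤ 1) :
    -- unique solvability in `H₀^{1-β}(0,1)`
    (∀ g : ℝ → ℝ, MemH1 g →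
      ∃ φ : ℝ → ℝ, MemH0 (1 - β) φ ∧ Solves β θ g φ ∧
        ∀ ψ : ℝ → ℝ, MemH0 (1 - β) ψ → Solves β θ g ψ → ψ =ᵐ[vol01] φ) ∧
    -- converse
    (∀ φ : ℝ → ℝ, MemH0 (1 - β) φ →
      MemH10 (fun x ↦ twoSidedInt β θ φ x
        - (1 - θ) * rightInt β φ 0 * (1 - x) - θ * leftInt β φ 1 * x)) ∧
    -- norm equivalence
    (∃ C₃ C₄ : ℝ, 0 < C₃ ∧ 0 < C₄ ∧
      ∀ g φ : ℝ → ℝ, MemH10 g → MemH0 (1 - β) φ → Solves β θ g φ →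
        C₃ * hNorm (1 - β) φ ≤ h1Norm g ∧ h1Norm g ≤ C₄ * hNorm (1 - β) φ) := by
  refine ⟨fun g hg ↦ ?_, fun φ hφ ↦ hφ.memH10 hβ hβ' hθ hθ', exists_norm_equiv hβ hβ' hθ hθ'⟩
  obtain ⟨φ, a, w, h, hs⟩ := exists_solves hβ hβ' hθ hθ' hg
  refine ⟨φ, h.approx.memH0, hs, fun ψ hψ hψs ↦ ?_⟩
  obtain ⟨b, u, k⟩ := hψ.exists_fracApprox hβ (by linarith) hθ hθ'
  exact k.ae_eq_of_solves h hβ hβ' hθ hθ' hψs hs
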